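/- Let $N\ge 1$ and $\ell\ge 0$ be integers (the case of interest being $N\ge 2$, $\ell\ge1$, the $SU(N)$ WZW model at level $\ell$), $t\in\mathbb C$, $q=e^{2\mathrm i\pi/(\ell+N)}$ and $q^x:=e^{2\mathrm i\pi x/(\ell+N)}$ for $x\in\mathbb R$. *Notation.* Weights of $\mathfrak{sl}_N$ are vectors in $\mathbb R^N=\bigoplus_i\mathbb R e_i^*$ modulo $\sum_i e_i^*$, with $\langle x,y\rangle=\sum_i x_iy_i-\frac1N(\sum_i x_i)(\sum_i y_i)$. The positive roots $\alpha>0$ are $e_i^*-e_j^*$, $i<j$ (let $|\Delta_+|=N(N-1)/2$), $\rho=\frac12\sum_i(N+1-2i)e_i^*$, and $\mathfrak S_N$ permutes coordinates. Let $\Lambda$ be the set of $\lambda=(\lambda_1\ge\dots\ge\lambda_{N-1}\ge\lambda_N=0)$ of integers with $\lambda_1\le\ell$, with the involution $\lambda^\dagger_i=\lambda_1-\lambda_{N+1-i}$. Let $D_\ell$ be the index of $(\ell+N)$ times the root lattice in the weight lattice ($D_\ell=N(\ell+N)^{N-1}$), $[x]_q=q^{x/2}-q^{-x/2}$, $\dim_qV_\lambda=\prod_{\alpha>0}[\langle\alpha,\lambda+\rho\rangle]_q/[\langle\alpha,\rho\rangle]_q$,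 $c=\ell(N^2-1)/(\ell+N)$, $r_\lambda=\langle\lambda,\lambda+2\rho\rangle/(2(\ell+N))$. For a partition $\mu$ and a weight $\beta$, $p_\mu(q^\beta)=\prod_j\sum_{i=1}^N q^{\mu_j\langle e_i^*,\beta\rangle}$. The S-matrix is $\underline S_{\lambda\mu}=\mathrm i^{|\Delta_+|}\overline{\mathcal S_{\lambda\mu}}$ with $\mathcal S_{\lambda\mu}=D_\ell^{-1/2}\sum_{w\in\mathfrak S_N}\mathrm{sgn}(w)\,q^{\langle\lambda+\rho,w(\mu+\rho)\rangle}$. Let $\mathcal A$ be the complex vector space with basis $(e_\lambda)_{\lambda\in\Lambda}$, with bilinear pairing $b(e_\lambda,e_\mu)=\delta_{\lambda\mu^\dagger}$ and $b^\dagger=\sum_\lambda e_\lambda\otimes e_{\lambda^\dagger}$; put $\underline\epsilon_\lambda=\sum_\mu\underline S_{\lambda\mu}e_\mu$, let $R(u)$ be the endomorphism $e_\lambda\mapsto e^{ut(r_\lambda+c/24)}e_\lambda$, and let $$B(u_1,u_2)=\frac{b^\dagger-R(u_1)\otimes R(u_2)\cdot b^\dagger}{u_1+u_2}$$ be the 2-point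 function. Set $B_{\lambda_1\lambda_2}(u)=\sum_{\tau\in\Lambda}e^{ut(r_\tau+c/24)}\,\underline S_{\lambda_2\tau}(\underline S^{-1})_{\tau\lambda_1}$. For $\nu\vdash d$ let $\chi_\nu$ be the corresponding irreducible character of $\mathfrak S_d$, $C_\mu$ the class of permutations of cycle type $\mu\vdash d$, $C_{(2)}$ the set of transpositions, $f_\nu(C_{(2)})=\#C_{(2)}\,\chi_\nu(C_{(2)})/\chi_\nu(1)$ (equal to $0$ if $d<2$), and define the truncated genus-$0$ double Hurwitz series $$H_0^{d,[\ell,N]}(\mu_1,\mu_2\,|\,T)=\frac1{d!^2}\sum_{\substack{\nu\vdash d\\ \ell(\nu)\le N-1,\ \nu_1\le\ell}}\#C_{\mu_1}\,\#C_{\mu_2}\,\chi_\nu(C_{\mu_1})\chi_\nu(C_{\mu_2})\,e^{T f_\nu(C_{(2)})}.$$ *Statement.* The family $(\underline\epsilon_\lambda)_{\lambda\in\Lambda}$ is orthonormal for $b$; for all $u_1,u_2\in\mathbb C$ with $u_1+u_2\ne0$, $$B(u_1,u_2)=\sum_{\lambda_1,\lambda_2\in\Lambda}\frac{\delta_{\lambda_1\lambda_2}-B_{\lambda_1\lambda_2}(u_1+u_2)}{u_1+u_2}\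 \underline\epsilon_{\lambda_1}\otimes\underline\epsilon_{\lambda_2};$$ and for all $\lambda_1,\lambda_2\in\Lambda$ and $u\in\mathbb C$, with $T=ut/(\ell+N)$, $$B_{\lambda_1\lambda_2}(u)=D_\ell^{-1}\Big|\prod_{\alpha>0}[\langle\alpha,\rho\rangle]_q\Big|^2\dim_qV_{\lambda_1}\,\overline{\dim_qV_{\lambda_2}}\ \sum_{d\ge0}e^{\left(\frac{Nd}2-\frac{d^2}{2N}+\frac{(\ell+N)c}{24}\right)T}\sum_{\mu_1,\mu_2\vdash d}p_{\mu_1}(q^{\lambda_1+\rho})\,p_{\mu_2}(q^{-(\lambda_2+\rho)})\,H_0^{d,[\ell,N]}(\mu_1,\mu_2\,|\,T),$$ where the series over $d$ converges (absolutely; only finitely many terms are non-zero). -/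

import Mathlib

open scoped BigOperators TensorProduct ComplexConjugate

noncomputable section

namespace WZW

/-! ### Characters of the symmetric group -/

/-- The parts of a partition listed in weakly decreasing order. -/
def rowLens {d : ℕ} (ν : Nat.Partition d) : List ℕ := ν.parts.sort (· ≥ ·)

theorem sum_rowLens {d : ℕ} (ν : Nat.Partition d) :
    ∑ i : Fin (rowLens ν).length, (rowLens ν).get i = d := by
  have h : (rowLens ν).sum = d := by
    rw [← Multiset.sum_coe, rowLens, Multiset.sort_eq, ν.parts_sum]
  calc ∑ i : Fin (rowLens ν).length, (rowLens ν).get i = (rowLens ν).sum := by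
        rw [← List.sum_ofFn, List.ofFn_get]
    _ = d := h

/-- The tableau of shape `ν` filled with `0, …, d - 1` in reading order: it sends a number to
its box, recorded as (row, column in that row). -/
def tableau {d : ℕ} (ν : Nat.Partition d) :
    Fin d ≃ (i : Fin (rowLens ν).length) × Fin ((rowLens ν).get i) :=
  (finCongr (sum_rowLens ν).symm).trans finSigmaFinEquiv.symm

/-- The row of the number `k` in the tableau. -/
def row {d : ℕ} (ν : Nat.Partition d) (k : Fin d) : ℕ := (tableau ν k).1

/-- The column of the number `k` in the tableau. -/
def col {d : ℕ} (ν : Nat.Partition d) (k : Fin d) : ℕ := (tableau ν k).2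

/-- The row group of the tableau: permutations preserving each row. -/
def rowGroup {d : ℕ} (ν : Nat.Partition d) : Finset (Equiv.Perm (Fin d)) :=
  {σ | ∀ k, row ν (σ k) = row ν k}

/-- The column group of the tableau: permutations preserving each column. -/
def colGroup {d : ℕ} (ν : Nat.Partition d) : Finset (Equiv.Perm (Fin d)) :=
  {σ | ∀ k, col ν (σ k) = col ν k}

/-- The Young symmetrizer `(∑ p) (∑ sgn(q) q)`, `p` in the row group, `q` in the column group. -/
def youngSymmetrizer {d : ℕ} (ν : Nat.Partition d) : MonoidAlgebra ℂ (Equiv.Perm (Fin d)) :=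
  (∑ p ∈ rowGroup ν, MonoidAlgebra.of ℂ (Equiv.Perm (Fin d)) p) *
    ∑ q ∈ colGroup ν,
      (((Equiv.Perm.sign q : ℤˣ) : ℤ) : ℂ) • MonoidAlgebra.of ℂ (Equiv.Perm (Fin d)) q

/-- The Specht module of shape `ν`: the left ideal of the group algebra generated by the Young
symmetrizer. -/
abbrev Specht {d : ℕ} (ν : Nat.Partition d) : Ideal (MonoidAlgebra ℂ (Equiv.Perm (Fin d))) :=
  Ideal.span {youngSymmetrizer ν}

/-- The irreducible character `χ_ν` of `𝔖_d`: the trace of `σ` on the Specht module. -/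
def chi {d : ℕ} (ν : Nat.Partition d) (σ : Equiv.Perm (Fin d)) : ℂ :=
  LinearMap.trace ℂ (Specht ν)
    (Algebra.lsmul ℂ ℂ (Specht ν) (MonoidAlgebra.of ℂ (Equiv.Perm (Fin d)) σ))

/-- The conjugacy class `C_μ` of permutations with cycle type `μ` (fixed points counted as
cycles of length one). -/
def conjClass {d : ℕ} (μ : Nat.Partition d) : Finset (Equiv.Perm (Fin d)) :=
  {σ | σ.partition.parts = μ.parts}

theorem conjClass_nonempty {d : ℕ} (μ : Nat.Partition d) : (conjClass μ).Nonempty := by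
  have hsplit := Multiset.filter_add_not (fun n => 2 ≤ n) μ.parts
  have hones : μ.parts.filter (fun n => ¬ 2 ≤ n) =
      Multiset.replicate (Multiset.card (μ.parts.filter fun n => ¬ 2 ≤ n)) 1 := by
    rw [Multiset.eq_replicate_card]
    intro n hn
    have h := Multiset.mem_filter.mp hn
    have := μ.parts_pos h.1
    omega
  have hsum : (μ.parts.filter fun n => 2 ≤ n).sum +
      Multiset.card (μ.parts.filter fun n => ¬ 2 ≤ n) = d := by
    have h := congrArg Multiset.sum hsplit
    rw [Multiset.sum_add, hones, μ.parts_sum] at h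
    simpa using h
  obtain ⟨g, hg⟩ := (Equiv.Perm.exists_with_cycleType_iff (Fin d)
    (m := μ.parts.filter fun n => 2 ≤ n)).mpr
      ⟨by rw [Fintype.card_fin]; omega, fun n hn => (Multiset.mem_filter.mp hn).2⟩
  refine ⟨g, ?_⟩
  have hcard : Fintype.card (Fin d) - g.support.card =
      Multiset.card (μ.parts.filter fun n => ¬ 2 ≤ n) := by
    rw [← Equiv.Perm.sum_cycleType, hg, Fintype.card_fin]
    omega
  simp only [conjClass, Finset.mem_filter, Finset.mem_univ, true_and]
  rw [Equiv.Perm.parts_partition, hcard, hg, ← hones]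
  exact hsplit

/-- The value `χ_ν(C_μ)` of `χ_ν` on the class `C_μ`. -/
def chiClass {d : ℕ} (ν μ : Nat.Partition d) : ℂ := chi ν (conjClass_nonempty μ).choose

/-- The class `C_(2)` of transpositions; it is empty for `d < 2`. -/
def transpositions (d : ℕ) : Finset (Equiv.Perm (Fin d)) :=
  open scoped Classical in {σ | σ.IsSwap}

/-- `f_ν(C_(2)) = #C_(2) χ_ν(C_(2)) / χ_ν(1)`, written as a sum over the class, on which `χ_ν`
is constant, so that it makes sense (and vanishes) when the class is empty. -/
def fTransp {d : ℕ} (ν : Nat.Partition d) : ℂ :=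
  (∑ σ ∈ transpositions d, chi ν σ) / chi ν 1

/-- The truncated generating series `H_0^{d,[ℓ,N]}(μ₁, μ₂ | T)` of genus 0 double Hurwitz
numbers: only partitions with at most `N - 1` parts, all of size at most `ℓ`, contribute. -/
def truncHurwitz (N ℓ d : ℕ) (μ₁ μ₂ : Nat.Partition d) (T : ℂ) : ℂ :=
  1 / (d.factorial : ℂ) ^ 2 *
    ∑ ν : Nat.Partition d with ν.parts.card ≤ N - 1 ∧ ∀ p ∈ ν.parts, p ≤ ℓ,
      ((conjClass μ₁).card : ℂ) * ((conjClass μ₂).card : ℂ) *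
        chiClass ν μ₁ * chiClass ν μ₂ * Complex.exp (T * fTransp ν)

/-! ### Weights of `𝔰𝔩_N`

Weights are written in the coordinates of the spanning family `e_1^*, …, e_N^*`, so they are
vectors `Fin N → ℝ`, and two vectors differing by a constant vector are the same weight. -/

/-- The scalar product on weights induced by the Killing form, normalized by `⟨θ, θ⟩ = 2`. -/
def killing {N : ℕ} (x y : Fin N → ℝ) : ℝ :=
  ∑ i, x i * y i - (∑ i, x i) * (∑ i, y i) / N

/-- The weight `e_i^*`. -/
def coordWeight {N : ℕ} (i : Fin N) : Fin N → ℝ := Pi.single i 1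

/-- The Weyl vector `ρ = ½ ∑_{i=1}^N (N + 1 - 2 i) e_i^*` (here `i` starts at 0). -/
def rho (N : ℕ) : Fin N → ℝ := fun i => ((N : ℝ) - 1 - 2 * (i : ℝ)) / 2

/-- The positive roots `e_i^* - e_j^*`, `i < j`, given by the pair `(i, j)`. -/
def posRoots (N : ℕ) : Finset (Fin N × Fin N) := {p | p.1 < p.2}

/-- The root attached to a pair of indices. -/
def root {N : ℕ} (p : Fin N × Fin N) : Fin N → ℝ := coordWeight p.1 - coordWeight p.2

/-- The action of the Weyl group `𝔖_N` on weights. -/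
def weyl {N : ℕ} (w : Equiv.Perm (Fin N)) (x : Fin N → ℝ) : Fin N → ℝ := fun i => x (w.symm i)

/-- `q ^ x` for `q = exp(2iπ / (ℓ + N))` and real `x`. -/
def qpow (N ℓ : ℕ) (x : ℝ) : ℂ :=
  Complex.exp (2 * Real.pi * Complex.I * (x : ℂ) / ((ℓ : ℂ) + (N : ℂ)))

/-- `[x]_q = q^{x/2} - q^{-x/2}`. -/
def qbracket (N ℓ : ℕ) (x : ℝ) : ℂ := qpow N ℓ (x / 2) - qpow N ℓ (-x / 2)

/-- The power sum `p_μ(q^β)`: the variables are `x_i = q^{⟨e_i^*, β⟩}`, `1 ≤ i ≤ N`, and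
`p_μ = ∏_j (∑_i x_i^{μ_j})`. -/
def powerSum (N ℓ : ℕ) {d : ℕ} (μ : Nat.Partition d) (β : Fin N → ℝ) : ℂ :=
  (μ.parts.map fun m => ∑ i : Fin N, qpow N ℓ (killing (coordWeight i) β) ^ m).prod

/-- The weight lattice: `ℤ^N` modulo `e_1^* + ⋯ + e_N^*`. -/
abbrev WeightLattice (N : ℕ) : Type :=
  (Fin N → ℤ) ⧸ AddSubgroup.zmultiples (fun _ : Fin N => (1 : ℤ))

/-- The lattice `L_θ` spanned by the Weyl orbit of the highest root, i.e. by the roots. -/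
def rootLattice (N : ℕ) : AddSubgroup (WeightLattice N) :=
  AddSubgroup.closure
    {x | ∃ i j : Fin N, i ≠ j ∧
      x = QuotientAddGroup.mk (Pi.single i (1 : ℤ) - Pi.single j (1 : ℤ))}

/-- `D_ℓ`, the index of `(ℓ + N) L_θ` in the weight lattice. -/
def levelIndex (N ℓ : ℕ) : ℕ :=
  ((rootLattice N).map (nsmulAddMonoidHom (ℓ + N))).index

/-- The label set `Λ`: `λ_1 ≥ ⋯ ≥ λ_{N-1} ≥ λ_N = 0` with `λ_1 ≤ ℓ`. -/
abbrev Label (N ℓ : ℕ) [NeZero N] : Type :=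
  {a : Fin N → Fin (ℓ + 1) // Antitone a ∧ a (Fin.rev 0) = 0}

instance (N ℓ : ℕ) [NeZero N] : Fintype (Label N ℓ) := Fintype.ofFinite _

/-- The highest weight of a label. -/
def Label.wt {N ℓ : ℕ} [NeZero N] (a : Label N ℓ) : Fin N → ℝ := fun i => ((a.1 i : ℕ) : ℝ)

/-- The involution `λ†_i = λ_1 - λ_{N-i+1}`, the highest weight of the dual representation. -/
def Label.dag {N ℓ : ℕ} [NeZero N] (a : Label N ℓ) : Label N ℓ :=
  ⟨fun i => ⟨(a.1 0 : ℕ) - (a.1 i.rev : ℕ), by have := (a.1 0).2; omega⟩, by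
    refine ⟨fun i j hij => ?_, ?_⟩
    · have h : a.1 i.rev ≤ a.1 j.rev := a.2.1 (Fin.rev_le_rev.mpr hij)
      have h' : (a.1 i.rev : ℕ) ≤ (a.1 j.rev : ℕ) := h
      rw [Fin.le_def]
      simp only
      omega
    · ext
      simp⟩

/-- The `q`-dimension `∏_{α > 0} [⟨α, λ + ρ⟩]_q / [⟨α, ρ⟩]_q`. -/
def qdim {N ℓ : ℕ} [NeZero N] (a : Label N ℓ) : ℂ :=
  ∏ p ∈ posRoots N,
    qbracket N ℓ (killing (root p) (a.wt + rho N)) / qbracket N ℓ (killing (root p) (rho N))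

/-- The central charge `c = ℓ (N² - 1) / (ℓ + N)`. -/
def centralCharge (N ℓ : ℕ) : ℝ := (ℓ : ℝ) * ((N : ℝ) ^ 2 - 1) / ((ℓ : ℝ) + (N : ℝ))

/-- The conformal weight `r_λ = ⟨λ, λ + 2ρ⟩ / (2 (ℓ + N))`. -/
def confWeight {N ℓ : ℕ} [NeZero N] (a : Label N ℓ) : ℝ :=
  killing a.wt (a.wt + (2 : ℝ) • rho N) / (2 * ((ℓ : ℝ) + (N : ℝ)))

/-! ### The S-matrix, the R-matrix and the 2-point function -/

/-- The matrix `𝒮_{λμ} = D_ℓ^{-1/2} ∑_w sgn(w) q^{⟨λ + ρ, w(μ + ρ)⟩}`. -/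
def calS (N ℓ : ℕ) [NeZero N] : Matrix (Label N ℓ) (Label N ℓ) ℂ := fun a b =>
  ((Real.sqrt (levelIndex N ℓ) : ℝ) : ℂ)⁻¹ *
    ∑ w : Equiv.Perm (Fin N), (((Equiv.Perm.sign w : ℤˣ) : ℤ) : ℂ) *
      qpow N ℓ (killing (a.wt + rho N) (weyl w (b.wt + rho N)))

/-- The S-matrix of the model, given by the Kač–Peterson formula `i^{|Δ₊|} 𝒮^*`. -/
def Smat (N ℓ : ℕ) [NeZero N] : Matrix (Label N ℓ) (Label N ℓ) ℂ := fun a b =>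
  Complex.I ^ (posRoots N).card * conj (calS N ℓ a b)

/-- The vector space `𝒜` with basis `(e_λ)`. -/
abbrev Alg (N ℓ : ℕ) [NeZero N] : Type := Label N ℓ → ℂ

/-- The basis vector `e_λ`. -/
def e {N ℓ : ℕ} [NeZero N] (a : Label N ℓ) : Alg N ℓ := Pi.single a 1

/-- The bilinear pairing with `b(e_λ, e_μ) = δ_{λ μ†}`. -/
def pairing {N ℓ : ℕ} [NeZero N] (x y : Alg N ℓ) : ℂ := ∑ a : Label N ℓ, x a * y a.dag

/-- The bivector `b† = ∑ e_λ ⊗ e_{λ†}`. -/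
def bivector (N ℓ : ℕ) [NeZero N] : Alg N ℓ ⊗[ℂ] Alg N ℓ :=
  ∑ a : Label N ℓ, e a ⊗ₜ[ℂ] e a.dag

/-- The vectors `ε_λ = ∑_μ S_{λμ} e_μ`. -/
def eps {N ℓ : ℕ} [NeZero N] (a : Label N ℓ) : Alg N ℓ := ∑ m : Label N ℓ, Smat N ℓ a m • e m

/-- The R-matrix `R(u)`, acting on `e_λ` by `exp(u t (r_λ + c/24))`. -/
def Rmat (N ℓ : ℕ) [NeZero N] (t u : ℂ) : Alg N ℓ →ₗ[ℂ] Alg N ℓ :=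
  Matrix.toLin' (Matrix.diagonal fun a : Label N ℓ =>
    Complex.exp (u * t * ((confWeight a : ℂ) + (centralCharge N ℓ : ℂ) / 24)))

/-- The 2-point function `B(u₁, u₂) = (b† - R(u₁) ⊗ R(u₂) b†) / (u₁ + u₂)`. -/
def twoPoint (N ℓ : ℕ) [NeZero N] (t u₁ u₂ : ℂ) : Alg N ℓ ⊗[ℂ] Alg N ℓ :=
  (u₁ + u₂)⁻¹ •
    (bivector N ℓ - TensorProduct.map (Rmat N ℓ t u₁) (Rmat N ℓ t u₂) (bivector N ℓ))

/-- The functions `B_{λ₁λ₂}(u) = ∑_τ exp(u h_τ / 2) S_{λ₂τ} (S⁻¹)_{τλ₁}` with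
`h_τ = 2 t (r_τ + c/24)`. -/
def Bcoef {N ℓ : ℕ} [NeZero N] (t : ℂ) (a₁ a₂ : Label N ℓ) (u : ℂ) : ℂ :=
  ∑ τ : Label N ℓ,
    Complex.exp (u * (2 * t * ((confWeight τ : ℂ) + (centralCharge N ℓ : ℂ) / 24)) / 2) *
      Smat N ℓ a₂ τ * (Smat N ℓ)⁻¹ τ a₁

end WZW

end

noncomputable section

namespace WZW

/-! ### Combinatorics of the standard tableau -/

section Tableau

variable {d : ℕ} (ν : Nat.Partition d)

/-! The matrix S is unitary and satisfies `Smat a b.dag = conj (Smat a b)`, so the bilinear pairing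
of two vectors `eps` is a Hermitian product of two rows of S; this gives orthonormality. The
R-matrix is diagonal in the basis `e` and the conformal weight is invariant under the duality, so
R(u₁) ⊗ R(u₂) scales e_τ ⊗ e_τ† by a factor depending only on u₁ + u₂. Rewriting in the basis `eps`
produces the coefficients `Bcoef`.

Each entry of 𝒮 is, up to D_ℓ^{-1/2}, the alternant det(x_i^{τ_j + N - j}) at x = q^{λ+ρ}. Hence B
is a sum over τ of an exponential times a product of two alternants. An alternant is a Vandermonde
product, which yields the q-dimension and the brackets of ρ, times a Schur function, which the
Frobenius formula expands in power sums with coefficients χ_τ. The conformal weight of τ is, up to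
terms in d = |τ|, the content sum of its diagram divided by ℓ + N, and the content sum is
f_τ(C_(2)). Labels are exactly the partitions allowed in the truncated series, and grouping them by
size gives the result.

Two inputs are proved from scratch. Unitarity (`sum_altProd_labels`): label exponents are the
N-subsets of ℤ/(ℓ+N) containing 0; averaging over translations replaces them by arbitrary exponents,
and the sum factors into geometric sums.

The Frobenius formula (`vand_mul_powerFunctional`): let c be the Young symmetrizer, with c² = n c
and n ≠ 0. Averaging a class function against χ_ν amounts to evaluating it on c (`sum_chi_smul`), so
the claim concerns the image f of c under σ ↦ p_σ. The sum of transpositions multiplies c by the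
content sum, and the cut-and-join equation turns this into an eigenvalue equation for ∑ (x_i ∂_i)²
on Δ f, where Δ is the Vandermonde product. All exponents of Δ f therefore have the same norm as ν +
δ, with δ = (N-1, …, 0). The antisymmetrization over columns makes them dominated by ν + δ. Equal
norm and dominance leave only the permutations of ν + δ, so Δ f is a multiple of one alternant, and
comparing one coefficient gives the factor n. -/

/-- The length of the `i`-th row of the diagram of `ν`, zero beyond the last row. -/
def rowLen (i : ℕ) : ℕ := (rowLens ν).getD i 0

theorem rowLen_of_lt {i : ℕ} (h : i < (rowLens ν).length) :
    rowLen ν i = (rowLens ν).get ⟨i, h⟩ := by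
  simp [rowLen, h]

theorem rowLen_of_le {i : ℕ} (h : (rowLens ν).length ≤ i) : rowLen ν i = 0 := by
  simp [rowLen, h]

theorem rowLen_antitone : Antitone (rowLen ν) := by
  intro i j hij
  by_cases hj : j < (rowLens ν).length
  · rw [rowLen_of_lt ν hj, rowLen_of_lt ν (hij.trans_lt hj)]
    have hs : (rowLens ν).SortedGE := (Multiset.pairwise_sort ν.parts (· ≥ ·)).sortedGE
    exact hs.antitone_get (show (⟨i, _⟩ : Fin _) ≤ ⟨j, hj⟩ from hij)
  · rw [rowLen_of_le ν (not_lt.mp hj)]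
    exact Nat.zero_le _

variable {ν}

theorem box_ext {k l : Fin d} (hr : row ν k = row ν l) (hc : col ν k = col ν l) : k = l := by
  apply (tableau ν).injective
  unfold row col at *
  generalize tableau ν k = x at *
  generalize tableau ν l = y at *
  obtain ⟨i, j⟩ := x
  obtain ⟨i', j'⟩ := y
  obtain rfl : i = i' := Fin.ext hr
  obtain rfl : j = j' := Fin.ext hc
  rfl

theorem col_lt_rowLen (k : Fin d) : col ν k < rowLen ν (row ν k) := by
  rw [row, rowLen_of_lt ν (tableau ν k).1.2]
  exact (tableau ν k).2.2

theorem exists_box {i j : ℕ} (h : j < rowLen ν i) : ∃ k, row ν k = i ∧ col ν k = j := by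
  have hi : i < (rowLens ν).length := by
    by_contra hi
    rw [rowLen_of_le ν (not_lt.mp hi)] at h
    exact absurd h (Nat.not_lt_zero _)
  rw [rowLen_of_lt ν hi] at h
  refine ⟨(tableau ν).symm ⟨⟨i, hi⟩, ⟨j, h⟩⟩, by simp [row], ?_⟩
  rw [col, Equiv.apply_symm_apply]

theorem exists_box_above (k : Fin d) {i : ℕ} (h : i ≤ row ν k) :
    ∃ l, row ν l = i ∧ col ν l = col ν k :=
  exists_box ((col_lt_rowLen k).trans_le (rowLen_antitone ν h))

/-! ### Counting boxes by rows and columns -/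

theorem card_row_eq (i : ℕ) : (Finset.univ.filter fun k : Fin d => row ν k = i).card = rowLen ν i := by
  rw [← Finset.card_range (rowLen ν i)]
  refine Finset.card_bij (fun k _ => col ν k) ?_ ?_ ?_
  · intro k hk
    rw [Finset.mem_filter] at hk
    rw [Finset.mem_range, ← hk.2]
    exact col_lt_rowLen k
  · intro k hk l hl h
    rw [Finset.mem_filter] at hk hl
    exact box_ext (hk.2.trans hl.2.symm) h
  · intro j hj
    obtain ⟨k, h1, h2⟩ := exists_box (Finset.mem_range.mp hj)
    exact ⟨k, by simp [h1], h2⟩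

theorem card_row_lt (i : ℕ) :
    (Finset.univ.filter fun k : Fin d => row ν k < i).card = ∑ j ∈ Finset.range i, rowLen ν j := by
  rw [Finset.card_eq_sum_card_fiberwise (f := row ν) (t := Finset.range i)
    (fun k hk => by simpa using hk)]
  refine Finset.sum_congr rfl fun j hj => ?_
  rw [← card_row_eq, Finset.filter_filter]
  congr 1
  ext k
  simp only [Finset.mem_filter, Finset.mem_univ, true_and]
  exact ⟨fun h => h.2, fun h => ⟨h ▸ Finset.mem_range.mp hj, h⟩⟩

/-- In a column, the boxes in the first `i` rows are `min i h` in number, `h` the height. -/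
theorem card_col_row_lt (i j : ℕ) :
    (Finset.univ.filter fun k : Fin d => col ν k = j ∧ row ν k < i).card =
      min i (Finset.univ.filter fun k : Fin d => col ν k = j).card := by
  set s := Finset.univ.filter fun k : Fin d => col ν k = j with hs
  have hinj : Set.InjOn (row ν) s := by
    intro k hk l hl h
    simp only [hs, Finset.coe_filter, Finset.mem_univ, true_and, Set.mem_ofPred_eq] at hk hl
    exact box_ext h (hk.trans hl.symm)
  have himg : s.image (row ν) = Finset.range s.card := by
    -- Columns have no gaps, so the rows met by a column form a down-closed set of naturals, hence
    -- an initial segment.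
    have hlow : ∀ a ∈ s.image (row ν), ∀ b ≤ a, b ∈ s.image (row ν) := by
      intro a ha b hb
      obtain ⟨k, hk, rfl⟩ := Finset.mem_image.mp ha
      obtain ⟨l, h1, h2⟩ := exists_box_above k hb
      refine Finset.mem_image.mpr ⟨l, ?_, h1⟩
      simp only [hs, Finset.mem_filter, Finset.mem_univ, true_and] at hk ⊢
      exact h2.trans hk
    have hcard : (s.image (row ν)).card = s.card := Finset.card_image_of_injOn hinj
    refine Finset.eq_of_subset_of_card_le (fun a ha => ?_) (by rw [hcard, Finset.card_range])
    rw [Finset.mem_range, ← hcard]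
    have : Finset.range (a + 1) ⊆ s.image (row ν) := fun b hb =>
      hlow a ha b (Nat.lt_succ_iff.mp (Finset.mem_range.mp hb))
    have := Finset.card_le_card this
    rw [Finset.card_range] at this
    omega
  have : (Finset.univ.filter fun k : Fin d => col ν k = j ∧ row ν k < i) =
      s.filter fun k => row ν k < i := by
    rw [hs, Finset.filter_filter]
  rw [this, ← Finset.card_image_of_injOn (hinj.mono (Finset.filter_subset _ _)),
    ← Finset.filter_image (p := fun a => a < i), himg]
  have h2 : (Finset.range s.card).filter (fun a => a < i) = Finset.range (min i s.card) := by
    ext a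
    simp only [Finset.mem_filter, Finset.mem_range, lt_min_iff]
    tauto
  rw [h2, Finset.card_range]

/-- If the column were no taller than `row ν k`, the thresholds `row ν k` and `row ν k + 1` would
count the same boxes, although `k` itself distinguishes them. -/
theorem row_lt_card_col (k : Fin d) :
    row ν k < (Finset.univ.filter fun l : Fin d => col ν l = col ν k).card := by
  have h := card_col_row_lt (ν := ν) (row ν k + 1) (col ν k)
  have h1 := card_col_row_lt (ν := ν) (row ν k) (col ν k)
  by_contra hlt
  rw [min_eq_right (by omega)] at h h1
  have hss : (Finset.univ.filter fun l : Fin d => col ν l = col ν k ∧ row ν l < row ν k) ⊂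
      Finset.univ.filter fun l : Fin d => col ν l = col ν k ∧ row ν l < row ν k + 1 := by
    rw [Finset.ssubset_iff_of_subset]
    · exact ⟨k, by simp, by simp⟩
    · intro l hl
      simp only [Finset.mem_filter, Finset.mem_univ, true_and] at hl ⊢
      exact ⟨hl.1, hl.2.trans (Nat.lt_succ_self _)⟩
  have := Finset.card_lt_card hss
  omega

/-- A filling is column-injective if no letter is repeated in a column. -/
def ColInjective {α : Type*} (ν : Nat.Partition d) (V : Fin d → α) : Prop :=
  ∀ k l, col ν k = col ν l → V k = V l → k = l

section Fillings

variable {α : Type*} [DecidableEq α] {V : Fin d → α}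

/-- Injectivity bounds the left side both by `I.card` and by the height of the column; the minimum
of the two is exactly the right side. -/
theorem ColInjective.card_col_le (hV : ColInjective ν V) (I : Finset α) (j : ℕ) :
    (Finset.univ.filter fun k : Fin d => col ν k = j ∧ V k ∈ I).card ≤
      (Finset.univ.filter fun k : Fin d => col ν k = j ∧ row ν k < I.card).card := by
  rw [card_col_row_lt]
  refine le_min ?_ ?_
  · refine Finset.card_le_card_of_injOn V (fun k hk => ?_) ?_
    · simp only [Finset.coe_filter, Set.mem_ofPred_eq] at hk
      exact hk.2.2
    · intro k hk l hl h
      simp only [Finset.coe_filter, Set.mem_ofPred_eq] at hk hl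
      exact hV k l (hk.2.1.trans hl.2.1.symm) h
  · exact Finset.card_le_card fun k hk => by
      simp only [Finset.mem_filter, Finset.mem_univ, true_and] at hk ⊢
      exact hk.1

theorem card_eq_sum_col (p : Fin d → Prop) [DecidablePred p] :
    (Finset.univ.filter fun k : Fin d => p k).card =
      ∑ j ∈ Finset.univ.image (col ν),
        (Finset.univ.filter fun k : Fin d => col ν k = j ∧ p k).card := by
  rw [Finset.card_eq_sum_card_image (col ν)]
  have h : ((Finset.univ.filter fun k : Fin d => p k).image (col ν)) ⊆ Finset.univ.image (col ν) :=
    Finset.image_subset_image (Finset.filter_subset _ _)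
  rw [← Finset.sum_subset h]
  · refine Finset.sum_congr rfl fun j _ => ?_
    rw [Finset.filter_filter]
    congr 1
    ext k
    simp [and_comm]
  · intro j _ hj
    rw [Finset.card_eq_zero, Finset.filter_eq_empty_iff]
    rintro k - ⟨h1, h2⟩
    exact hj (Finset.mem_image.mpr ⟨k, by simpa using h2, h1⟩)

/-- Dominance: the letters of `I` fill at most as many boxes as there are in the first `#I`
rows. -/
theorem ColInjective.card_le (hV : ColInjective ν V) (I : Finset α) :
    (Finset.univ.filter fun k : Fin d => V k ∈ I).card ≤
      (Finset.univ.filter fun k : Fin d => row ν k < I.card).card := by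
  rw [card_eq_sum_col (ν := ν) fun k => V k ∈ I, card_eq_sum_col (ν := ν) fun k => row ν k < I.card]
  exact Finset.sum_le_sum fun j _ => hV.card_col_le I j

end Fillings

/-- A column-injective filling of content `ν` becomes the row filling after permuting the
columns. -/
theorem ColInjective.exists_perm {V : Fin d → ℕ} (hV : ColInjective ν V)
    (hcont : ∀ i, (Finset.univ.filter fun k : Fin d => V k = i).card = rowLen ν i) :
    ∃ q ∈ colGroup ν, ∀ k, V (q k) = row ν k := by
  have hcard : ∀ i, (Finset.univ.filter fun k : Fin d => V k ∈ Finset.range i).card =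
      (Finset.univ.filter fun k : Fin d => row ν k < (Finset.range i).card).card := by
    intro i
    rw [Finset.card_range]
    have e1 : (Finset.univ.filter fun k : Fin d => V k ∈ Finset.range i).card =
        ∑ j ∈ Finset.range i, (Finset.univ.filter fun k : Fin d => V k = j).card := by
      rw [Finset.card_eq_sum_card_fiberwise (f := V) (t := Finset.range i)
        (fun k hk => by simpa using hk)]
      refine Finset.sum_congr rfl fun j hj => ?_
      rw [Finset.filter_filter]
      congr 1
      ext k
      simp only [Finset.mem_filter, Finset.mem_univ, true_and]
      exact ⟨fun h => h.2, fun h => ⟨h ▸ hj, h⟩⟩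
    rw [e1, card_row_lt]
    exact Finset.sum_congr rfl fun j _ => hcont j
  -- The columnwise inequalities add up to an equality, so each of them is an equality.
  have hcol : ∀ i, ∀ j ∈ Finset.univ.image (col ν),
      (Finset.univ.filter fun k : Fin d => col ν k = j ∧ V k ∈ Finset.range i).card =
      (Finset.univ.filter fun k : Fin d => col ν k = j ∧ row ν k < (Finset.range i).card).card := by
    intro i
    have h := hcard i
    rw [card_eq_sum_col (ν := ν) fun k => V k ∈ Finset.range i,
      card_eq_sum_col (ν := ν) fun k => row ν k < (Finset.range i).card] at h
    exact (Finset.sum_eq_sum_iff_of_le fun j _ => hV.card_col_le _ j).mp h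
  -- every column contains exactly the letters `0, …, h - 1`
  have hex : ∀ k, ∃ l, col ν l = col ν k ∧ V l = row ν k := by
    intro k
    have h1 := hcol (row ν k + 1) (col ν k) (Finset.mem_image_of_mem _ (Finset.mem_univ _))
    have h0 := hcol (row ν k) (col ν k) (Finset.mem_image_of_mem _ (Finset.mem_univ _))
    rw [Finset.card_range, card_col_row_lt] at h0 h1
    have hk := row_lt_card_col (ν := ν) k
    rw [min_eq_left (by omega)] at h0 h1
    by_contra hne
    push Not at hne
    have : (Finset.univ.filter fun l : Fin d => col ν l = col ν k ∧ V l ∈ Finset.range (row ν k + 1))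
        = Finset.univ.filter fun l : Fin d => col ν l = col ν k ∧ V l ∈ Finset.range (row ν k) := by
      ext l
      simp only [Finset.mem_filter, Finset.mem_univ, true_and, Finset.mem_range]
      constructor
      · rintro ⟨h, h'⟩
        exact ⟨h, lt_of_le_of_ne (Nat.lt_succ_iff.mp h') (hne l h)⟩
      · rintro ⟨h, h'⟩
        exact ⟨h, h'.trans (Nat.lt_succ_self _)⟩
    rw [this] at h1
    omega
  choose f hf using hex
  have hinj : Function.Injective f := by
    intro k l h
    refine box_ext (ν := ν) ?_ ?_
    · rw [← (hf k).2, ← (hf l).2, h]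
    · rw [← (hf k).1, ← (hf l).1, h]
  refine ⟨Equiv.ofBijective f (Finite.injective_iff_bijective.mp hinj), ?_, fun k => (hf k).2⟩
  simp only [colGroup, Finset.mem_filter, Finset.mem_univ, true_and]
  exact fun k => (hf k).1

/-- The sum of the row indices of all boxes counts the pairs of distinct boxes in a common
column. -/
theorem card_col_pairs :
    (Finset.univ.filter fun p : Fin d × Fin d => p.1 ≠ p.2 ∧ col ν p.1 = col ν p.2).card =
      2 * ∑ k, row ν k := by
  have key : ∀ k : Fin d,
      (Finset.univ.filter fun l : Fin d => col ν l = col ν k ∧ row ν l < row ν k).card = row ν k := by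
    intro k
    rw [card_col_row_lt, min_eq_left (row_lt_card_col k).le]
  have hsplit : (Finset.univ.filter fun p : Fin d × Fin d => p.1 ≠ p.2 ∧ col ν p.1 = col ν p.2) =
      (Finset.univ.filter fun p : Fin d × Fin d => col ν p.2 = col ν p.1 ∧ row ν p.2 < row ν p.1) ∪
      (Finset.univ.filter fun p : Fin d × Fin d => col ν p.1 = col ν p.2 ∧ row ν p.1 < row ν p.2) := by
    ext ⟨k, l⟩
    simp only [Finset.mem_filter, Finset.mem_univ, true_and, Finset.mem_union]
    constructor
    · rintro ⟨h1, h2⟩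
      rcases lt_trichotomy (row ν k) (row ν l) with h | h | h
      · exact Or.inr ⟨h2, h⟩
      · exact absurd (box_ext h h2) h1
      · exact Or.inl ⟨h2.symm, h⟩
    · rintro (⟨h1, h2⟩ | ⟨h1, h2⟩)
      · exact ⟨fun h => by simp [h] at h2, h1.symm⟩
      · exact ⟨fun h => by simp [h] at h2, h1⟩
  rw [hsplit, Finset.card_union_of_disjoint, two_mul]
  · have h1 : (Finset.univ.filter
        fun p : Fin d × Fin d => col ν p.2 = col ν p.1 ∧ row ν p.2 < row ν p.1).card =
        ∑ k, row ν k := by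
      rw [Finset.card_filter, Fintype.sum_prod_type]
      refine Finset.sum_congr rfl fun k _ => ?_
      rw [← key k, Finset.card_filter]
    have h2 : (Finset.univ.filter
        fun p : Fin d × Fin d => col ν p.1 = col ν p.2 ∧ row ν p.1 < row ν p.2).card =
        ∑ k, row ν k := by
      rw [Finset.card_filter, Fintype.sum_prod_type_right]
      refine Finset.sum_congr rfl fun k _ => ?_
      rw [← key k, Finset.card_filter]
    rw [h1, h2]
  · rw [Finset.disjoint_filter]
    rintro ⟨k, l⟩ - ⟨_, h1⟩ ⟨_, h2⟩
    exact absurd h1 (not_lt.mpr h2.le)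

theorem card_row_pairs (m : ℕ) (hm : (rowLens ν).length ≤ m) :
    (Finset.univ.filter fun p : Fin d × Fin d => row ν p.1 = row ν p.2).card =
      ∑ i ∈ Finset.range m, rowLen ν i ^ 2 := by
  have hrow : ∀ k : Fin d, row ν k < m := fun k => (tableau ν k).1.2.trans_le hm
  rw [Finset.card_eq_sum_card_fiberwise (f := fun p : Fin d × Fin d => row ν p.1)
    (t := Finset.range m) (fun k _ => by simpa using hrow _)]
  refine Finset.sum_congr rfl fun i _ => ?_
  rw [sq, ← card_row_eq, ← Finset.card_product]
  congr 1
  ext ⟨k, l⟩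
  simp only [Finset.mem_filter, Finset.mem_univ, true_and, Finset.mem_product]
  constructor
  · rintro ⟨h1, h2⟩
    exact ⟨h2, h1 ▸ h2⟩
  · rintro ⟨h1, h2⟩
    exact ⟨h1.trans h2.symm, h1⟩

theorem sum_row_eq (m : ℕ) (hm : (rowLens ν).length ≤ m) :
    ∑ k, row ν k = ∑ i ∈ Finset.range m, i * rowLen ν i := by
  have hrow : ∀ k : Fin d, row ν k < m := fun k => (tableau ν k).1.2.trans_le hm
  rw [← Finset.sum_fiberwise_of_maps_to (g := row ν) (t := Finset.range m)
    (fun k _ => by simpa using hrow _)]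
  refine Finset.sum_congr rfl fun i _ => ?_
  rw [Finset.sum_congr rfl (g := fun _ => i) (fun k hk => (Finset.mem_filter.mp hk).2),
    Finset.sum_const, card_row_eq, smul_eq_mul, mul_comm]

theorem sum_rowLen (m : ℕ) (hm : (rowLens ν).length ≤ m) :
    ∑ i ∈ Finset.range m, rowLen ν i = d := by
  rw [← card_row_lt, Finset.filter_true_of_mem, Finset.card_univ, Fintype.card_fin]
  exact fun k _ => (tableau ν k).1.2.trans_le hm

end Tableau

/-! ### The group algebra of a finite group -/

section GroupAlgebra

variable {G : Type*} [Group G] {M : Type*} [AddCommMonoid M] [Module ℂ M]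

theorem coeff_of [DecidableEq G] (g h : G) :
    (MonoidAlgebra.of ℂ G g).coeff h = if g = h then 1 else 0 := by
  simp [MonoidAlgebra.of_apply, Finsupp.single_apply]

theorem coeff_eq_coeff_one (x : MonoidAlgebra ℂ G) (g : G) :
    x.coeff g = (MonoidAlgebra.of ℂ G g⁻¹ * x).coeff 1 := by
  simp [MonoidAlgebra.of_apply]

/-- The basis of the group algebra given by the group elements. -/
def groupBasis (G : Type*) [Group G] : Module.Basis G ℂ (MonoidAlgebra ℂ G) :=
  Module.Basis.ofRepr (MonoidAlgebra.coeffLinearEquiv ℂ)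

theorem groupBasis_apply (g : G) : groupBasis G g = MonoidAlgebra.of ℂ G g := rfl

variable [Fintype G]

/-- The linear extension to the group algebra of a function on the group. -/
def linExt (φ : G → M) : MonoidAlgebra ℂ G →ₗ[ℂ] M where
  toFun x := ∑ g, x.coeff g • φ g
  map_add' x y := by simp [add_smul, Finset.sum_add_distrib]
  map_smul' r x := by simp [mul_smul, Finset.smul_sum]

theorem linExt_of (φ : G → M) (g : G) : linExt φ (MonoidAlgebra.of ℂ G g) = φ g := by
  classical
  simp [linExt, MonoidAlgebra.of_apply, Finsupp.single_apply]

theorem eq_sum_coeff_of (x : MonoidAlgebra ℂ G) :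
    x = ∑ g, x.coeff g • MonoidAlgebra.of ℂ G g := by
  classical
  ext h
  simp [MonoidAlgebra.of_apply]

theorem trace_groupAlgebra (f : MonoidAlgebra ℂ G →ₗ[ℂ] MonoidAlgebra ℂ G) :
    LinearMap.trace ℂ _ f = ∑ g, (f (MonoidAlgebra.of ℂ G g)).coeff g := by
  classical
  rw [LinearMap.trace_eq_matrix_trace ℂ (groupBasis G), Matrix.trace]
  refine Finset.sum_congr rfl fun g _ => ?_
  rw [Matrix.diag_apply, LinearMap.toMatrix_apply, groupBasis_apply]
  rfl

end GroupAlgebra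

/-! ### Young symmetrizers -/

section Symmetrizer

variable {d : ℕ} (ν : Nat.Partition d)

/-- The group element `σ` in the group algebra of `𝔖_d`. -/
abbrev ofPerm (σ : Equiv.Perm (Fin d)) : MonoidAlgebra ℂ (Equiv.Perm (Fin d)) :=
  MonoidAlgebra.of ℂ (Equiv.Perm (Fin d)) σ

/-- The sign of a permutation as a complex number. -/
abbrev csign {α : Type*} [DecidableEq α] [Fintype α] (σ : Equiv.Perm α) : ℂ :=
  (((Equiv.Perm.sign σ : ℤˣ) : ℤ) : ℂ)

theorem csign_mul {α : Type*} [DecidableEq α] [Fintype α] (σ τ : Equiv.Perm α) :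
    csign (σ * τ) = csign σ * csign τ := by
  simp [csign]

theorem csign_inv {α : Type*} [DecidableEq α] [Fintype α] (σ : Equiv.Perm α) :
    csign σ⁻¹ = csign σ := by
  simp [csign]

theorem csign_mul_self {α : Type*} [DecidableEq α] [Fintype α] (σ : Equiv.Perm α) :
    csign σ * csign σ = 1 := by
  rw [← csign_mul, csign, Equiv.Perm.sign_mul, Int.units_mul_self]
  simp

theorem csign_swap {α : Type*} [DecidableEq α] [Fintype α] {k l : α} (h : k ≠ l) :
    csign (Equiv.swap k l) = -1 := by
  simp [csign, Equiv.Perm.sign_swap h]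

/-- The sum of the row group. -/
def rowSym : MonoidAlgebra ℂ (Equiv.Perm (Fin d)) := ∑ p ∈ rowGroup ν, ofPerm p

/-- The signed sum of the column group. -/
def colAnti : MonoidAlgebra ℂ (Equiv.Perm (Fin d)) := ∑ q ∈ colGroup ν, csign q • ofPerm q

theorem youngSymmetrizer_eq : youngSymmetrizer ν = rowSym ν * colAnti ν := rfl

variable {ν}

theorem mem_rowGroup {σ : Equiv.Perm (Fin d)} :
    σ ∈ rowGroup ν ↔ ∀ k, row ν (σ k) = row ν k := by
  simp [rowGroup]

theorem mem_colGroup {σ : Equiv.Perm (Fin d)} :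
    σ ∈ colGroup ν ↔ ∀ k, col ν (σ k) = col ν k := by
  simp [colGroup]

theorem one_mem_rowGroup : (1 : Equiv.Perm (Fin d)) ∈ rowGroup ν := mem_rowGroup.mpr fun _ => rfl

theorem one_mem_colGroup : (1 : Equiv.Perm (Fin d)) ∈ colGroup ν := mem_colGroup.mpr fun _ => rfl

theorem mul_mem_rowGroup {σ τ : Equiv.Perm (Fin d)} (hσ : σ ∈ rowGroup ν) (hτ : τ ∈ rowGroup ν) :
    σ * τ ∈ rowGroup ν :=
  mem_rowGroup.mpr fun k => (mem_rowGroup.mp hσ (τ k)).trans (mem_rowGroup.mp hτ k)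

theorem mul_mem_colGroup {σ τ : Equiv.Perm (Fin d)} (hσ : σ ∈ colGroup ν) (hτ : τ ∈ colGroup ν) :
    σ * τ ∈ colGroup ν :=
  mem_colGroup.mpr fun k => (mem_colGroup.mp hσ (τ k)).trans (mem_colGroup.mp hτ k)

theorem inv_mem_rowGroup {σ : Equiv.Perm (Fin d)} (hσ : σ ∈ rowGroup ν) : σ⁻¹ ∈ rowGroup ν :=
  mem_rowGroup.mpr fun k => by simpa using (mem_rowGroup.mp hσ (σ⁻¹ k)).symm

theorem inv_mem_colGroup {σ : Equiv.Perm (Fin d)} (hσ : σ ∈ colGroup ν) : σ⁻¹ ∈ colGroup ν :=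
  mem_colGroup.mpr fun k => by simpa using (mem_colGroup.mp hσ (σ⁻¹ k)).symm

theorem eq_one_of_mem_row_col {σ : Equiv.Perm (Fin d)} (h1 : σ ∈ rowGroup ν)
    (h2 : σ ∈ colGroup ν) : σ = 1 :=
  Equiv.ext fun k => box_ext (mem_rowGroup.mp h1 k) (mem_colGroup.mp h2 k)

theorem swap_mem_rowGroup {k l : Fin d} : Equiv.swap k l ∈ rowGroup ν ↔ row ν k = row ν l := by
  rw [mem_rowGroup]
  constructor
  · intro h
    simpa using (h k).symm
  · intro h m
    rcases eq_or_ne m k with rfl | hk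
    · simp [h]
    rcases eq_or_ne m l with rfl | hl
    · simp [h]
    rw [Equiv.swap_apply_of_ne_of_ne hk hl]

theorem swap_mem_colGroup {k l : Fin d} : Equiv.swap k l ∈ colGroup ν ↔ col ν k = col ν l := by
  rw [mem_colGroup]
  constructor
  · intro h
    simpa using (h k).symm
  · intro h m
    rcases eq_or_ne m k with rfl | hk
    · simp [h]
    rcases eq_or_ne m l with rfl | hl
    · simp [h]
    rw [Equiv.swap_apply_of_ne_of_ne hk hl]

theorem rowSym_mul_of {p : Equiv.Perm (Fin d)} (hp : p ∈ rowGroup ν) :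
    rowSym ν * ofPerm p = rowSym ν := by
  rw [rowSym, Finset.sum_mul]
  refine Finset.sum_equiv (Equiv.mulRight p) (fun σ => ?_) (fun σ _ => by simp [ofPerm])
  refine ⟨fun h => mul_mem_rowGroup h hp, fun h => ?_⟩
  simpa using mul_mem_rowGroup h (inv_mem_rowGroup hp)

theorem of_mul_colAnti {q : Equiv.Perm (Fin d)} (hq : q ∈ colGroup ν) :
    ofPerm q * colAnti ν = csign q • colAnti ν := by
  rw [colAnti, Finset.mul_sum, Finset.smul_sum]
  refine Finset.sum_equiv (Equiv.mulLeft q) (fun σ => ?_) (fun σ _ => ?_)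
  · refine ⟨fun h => mul_mem_colGroup hq h, fun h => ?_⟩
    simpa using mul_mem_colGroup (inv_mem_colGroup hq) h
  · rw [Equiv.coe_mulLeft, csign_mul, smul_smul, ← mul_assoc, csign_mul_self, one_mul,
      mul_smul_comm, ofPerm, ofPerm, ← map_mul]

theorem youngSymmetrizer_eq_sum : youngSymmetrizer ν =
    ∑ p ∈ rowGroup ν, ∑ q ∈ colGroup ν, csign q • ofPerm (p * q) := by
  rw [youngSymmetrizer_eq, rowSym, colAnti, Finset.sum_mul]
  refine Finset.sum_congr rfl fun p _ => ?_
  rw [Finset.mul_sum]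
  refine Finset.sum_congr rfl fun q _ => ?_
  rw [mul_smul_comm, ofPerm, ofPerm, ← map_mul]

/-- If p q = 1 then p lies in both the row and the column group, hence is trivial; only the pair (1,
1) contributes. -/
theorem coeff_one_youngSymmetrizer : (youngSymmetrizer ν).coeff 1 = 1 := by
  rw [youngSymmetrizer_eq_sum]
  simp only [MonoidAlgebra.coeff_sum, Finsupp.coe_finsetSum, Finset.sum_apply,
    MonoidAlgebra.coeff_smul_apply, coeff_of, smul_eq_mul]
  rw [Finset.sum_eq_single_of_mem 1 one_mem_rowGroup, Finset.sum_eq_single_of_mem 1 one_mem_colGroup]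
  · simp
  · intro q _ hq
    simp [hq]
  · intro p hp hp1
    refine Finset.sum_eq_zero fun q hq => ?_
    rw [if_neg, mul_zero]
    intro h
    apply hp1
    refine eq_one_of_mem_row_col hp ?_
    rw [eq_inv_of_mul_eq_one_left h]
    exact inv_mem_colGroup hq

/-- For a permutation `g`, `a g b` is a multiple of the Young symmetrizer `a b`. -/
theorem rowSym_mul_of_mul_colAnti (g : Equiv.Perm (Fin d)) :
    ∃ r : ℂ, rowSym ν * ofPerm g * colAnti ν = r • youngSymmetrizer ν := by
  -- If no two boxes of a column are sent by `g` to the same row, rearranging the columns gives `q`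
  -- with `g * q` in the row group, and both factors of `g` are absorbed. Otherwise a transposition
  -- of such boxes is absorbed on the left with sign + and on the right with sign -, so the product
  -- is zero.
  by_cases hV : ColInjective ν fun k => row ν (g k)
  · obtain ⟨q, hq, h⟩ := hV.exists_perm fun i => by
      rw [← card_row_eq]
      exact Finset.card_equiv g fun k => by simp
    have hp : g * q ∈ rowGroup ν := mem_rowGroup.mpr h
    refine ⟨csign q⁻¹, ?_⟩
    have : ofPerm g = ofPerm (g * q) * ofPerm q⁻¹ := by
      rw [ofPerm, ofPerm, ofPerm, ← map_mul]
      simp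
    rw [this, ← mul_assoc, rowSym_mul_of hp, mul_assoc, of_mul_colAnti (inv_mem_colGroup hq),
      mul_smul_comm, youngSymmetrizer_eq]
  · simp only [ColInjective, not_forall] at hV
    obtain ⟨k, l, hc, hr, hne⟩ := hV
    refine ⟨0, ?_⟩
    have h1 : Equiv.swap (g k) (g l) ∈ rowGroup ν := swap_mem_rowGroup.mpr hr
    have h2 : Equiv.swap k l ∈ colGroup ν := swap_mem_colGroup.mpr hc
    have h3 : ofPerm (Equiv.swap (g k) (g l)) * ofPerm g = ofPerm g * ofPerm (Equiv.swap k l) := by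
      rw [ofPerm, ofPerm, ofPerm, ← map_mul, ← map_mul, Equiv.swap_apply_apply]
      simp
    have h4 : rowSym ν * ofPerm g * colAnti ν = -(rowSym ν * ofPerm g * colAnti ν) := by
      nth_rewrite 1 [← rowSym_mul_of h1]
      rw [mul_assoc (rowSym ν), h3, mul_assoc, mul_assoc, of_mul_colAnti h2, csign_swap hne]
      simp [mul_assoc]
    rw [zero_smul]
    have h5 : (2 : ℂ) • (rowSym ν * ofPerm g * colAnti ν) = 0 := by
      rw [two_smul]
      nth_rewrite 1 [h4]
      exact neg_add_cancel _
    exact (smul_eq_zero.mp h5).resolve_left two_ne_zero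

/-- The scalar can be read off at the identity because the Young symmetrizer has coefficient 1
there. -/
theorem rowSym_mul_mul_colAnti (x : MonoidAlgebra ℂ (Equiv.Perm (Fin d))) :
    rowSym ν * x * colAnti ν = (rowSym ν * x * colAnti ν).coeff 1 • youngSymmetrizer ν := by
  have key : ∃ r : ℂ, rowSym ν * x * colAnti ν = r • youngSymmetrizer ν := by
    choose f hf using rowSym_mul_of_mul_colAnti (ν := ν)
    refine ⟨∑ g, x.coeff g * f g, ?_⟩
    conv_lhs => rw [eq_sum_coeff_of x]
    rw [Finset.mul_sum, Finset.sum_mul, Finset.sum_smul]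
    refine Finset.sum_congr rfl fun g _ => ?_
    rw [mul_smul_comm, smul_mul_assoc, mul_smul, ← hf]
  obtain ⟨r, hr⟩ := key
  rw [hr, MonoidAlgebra.coeff_smul_apply, coeff_one_youngSymmetrizer, smul_eq_mul, mul_one]

variable (ν)

/-- The scalar `n` with `c * c = n c` for the Young symmetrizer `c`. -/
def hookScalar : ℂ := (youngSymmetrizer ν * youngSymmetrizer ν).coeff 1

theorem youngSymmetrizer_mul_self :
    youngSymmetrizer ν * youngSymmetrizer ν = hookScalar ν • youngSymmetrizer ν := by
  have h := rowSym_mul_mul_colAnti (ν := ν) (colAnti ν * rowSym ν)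
  have e : rowSym ν * (colAnti ν * rowSym ν) * colAnti ν =
      youngSymmetrizer ν * youngSymmetrizer ν := by
    rw [youngSymmetrizer_eq]
    simp only [mul_assoc]
  rw [e] at h
  rw [hookScalar]
  exact h

/-- Otherwise right multiplication by c squares to zero and has trace 0, whereas its diagonal
entries in the group basis are all 1, so its trace is d!. -/
theorem hookScalar_ne_zero : hookScalar ν ≠ 0 := by
  intro h0
  have hsq : youngSymmetrizer ν * youngSymmetrizer ν = 0 := by
    rw [youngSymmetrizer_mul_self, h0, zero_smul]
  have hnil : IsNilpotent (LinearMap.mulRight ℂ (youngSymmetrizer ν)) :=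
    ⟨2, LinearMap.ext fun x => by
      rw [sq, Module.End.mul_apply, LinearMap.mulRight_apply, LinearMap.mulRight_apply, mul_assoc,
        hsq, mul_zero, LinearMap.zero_apply]⟩
  have htr := (LinearMap.isNilpotent_trace_of_isNilpotent hnil).eq_zero
  rw [trace_groupAlgebra, Finset.sum_congr rfl (g := fun _ => (1 : ℂ))] at htr
  · simp [Fintype.card_perm, Nat.factorial_ne_zero] at htr
  · intro g _
    rw [coeff_eq_coeff_one, LinearMap.mulRight_apply, ← mul_assoc,
      ← map_mul (MonoidAlgebra.of ℂ (Equiv.Perm (Fin d))), inv_mul_cancel,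
      map_one (MonoidAlgebra.of ℂ (Equiv.Perm (Fin d))), one_mul, coeff_one_youngSymmetrizer]

/-- A map with values in a submodule has the same trace as its restriction to that submodule. This
moves the trace on the Specht module to the group algebra, where the group elements are a basis. -/
theorem hookScalar_mul_chi (σ : Equiv.Perm (Fin d)) :
    hookScalar ν * chi ν σ = ∑ g : Equiv.Perm (Fin d),
      (ofPerm (g⁻¹ * σ * g) * youngSymmetrizer ν).coeff 1 := by
  set c := youngSymmetrizer ν with hc
  -- `x ↦ σ x c` maps the group algebra to the Specht module and is `n σ` there
  let f : MonoidAlgebra ℂ (Equiv.Perm (Fin d)) →ₗ[ℂ] MonoidAlgebra ℂ (Equiv.Perm (Fin d)) :=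
    (LinearMap.mulRight ℂ c).comp (LinearMap.mulLeft ℂ (ofPerm σ))
  let S : Submodule ℂ (MonoidAlgebra ℂ (Equiv.Perm (Fin d))) := (Specht ν).restrictScalars ℂ
  have hfS : ∀ x, f x ∈ S := fun x => by
    change ofPerm σ * x * c ∈ Specht ν
    exact Ideal.mul_mem_left _ _ (Ideal.subset_span rfl)
  have htr := LinearMap.trace_restrict_eq_of_forall_mem S f hfS
  let L : S →ₗ[ℂ] S :=
    Algebra.lsmul ℂ ℂ (Specht ν) (MonoidAlgebra.of ℂ (Equiv.Perm (Fin d)) σ)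
  have hres : f.restrict (fun x _ => hfS x) = hookScalar ν • L := by
    refine LinearMap.ext fun ⟨x, hx⟩ => ?_
    obtain ⟨y, rfl⟩ := Ideal.mem_span_singleton'.mp hx
    apply Subtype.ext
    change ofPerm σ * (y * c) * c = hookScalar ν • (ofPerm σ * (y * c))
    rw [mul_assoc, mul_assoc y, hc, youngSymmetrizer_mul_self, mul_smul_comm, mul_smul_comm]
  have hchi : LinearMap.trace ℂ S (f.restrict (fun x _ => hfS x)) = hookScalar ν * chi ν σ := by
    rw [hres, map_smul, smul_eq_mul]
    rfl
  rw [← hchi, htr, trace_groupAlgebra]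
  refine Finset.sum_congr rfl fun g _ => ?_
  rw [coeff_eq_coeff_one]
  change (_ * (ofPerm σ * ofPerm g * c)).coeff 1 = _
  simp only [ofPerm, map_mul, mul_assoc]

/-- The characteristic of `χ_ν`: averaging a central function against `χ_ν` amounts to
evaluating it on the Young symmetrizer. -/
theorem sum_chi_smul {M : Type*} [AddCommGroup M] [Module ℂ M] (φ : Equiv.Perm (Fin d) → M)
    (hconj : ∀ σ g, φ (g * σ * g⁻¹) = φ σ) (hinv : ∀ σ, φ σ⁻¹ = φ σ) :
    hookScalar ν • ∑ σ, chi ν σ • φ σ =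
      (d.factorial : ℂ) • linExt φ (youngSymmetrizer ν) := by
  simp only [Finset.smul_sum, smul_smul, hookScalar_mul_chi, Finset.sum_smul]
  rw [Finset.sum_comm]
  have h : ∀ g : Equiv.Perm (Fin d),
      ∑ σ, (ofPerm (g⁻¹ * σ * g) * youngSymmetrizer ν).coeff 1 • φ σ =
        linExt φ (youngSymmetrizer ν) := by
    intro g
    -- The coefficient at 1 of h c is the coefficient of c at h⁻¹; this dictates the substitution σ
    -- ↦ (g⁻¹ σ g)⁻¹, under which the class function φ does not change.
    refine Fintype.sum_equiv ((MulAut.conj g⁻¹).toEquiv.trans (Equiv.inv _)) _ _ fun σ => ?_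
    have h1 : ((MulAut.conj g⁻¹).toEquiv.trans (Equiv.inv _)) σ = (g⁻¹ * σ * g)⁻¹ := by simp
    rw [h1, coeff_eq_coeff_one (youngSymmetrizer ν), inv_inv, hinv]
    congr 1
    simpa using (hconj σ g⁻¹).symm
  simp only [h, Finset.sum_const, Finset.card_univ, Fintype.card_perm, Fintype.card_fin]
  rw [← Nat.cast_smul_eq_nsmul ℂ]

/-! ### The sum of all transpositions -/

/-- Each transposition comes from exactly two ordered pairs; sums over pairs are the ones that can
be matched with counts of boxes. -/
theorem two_smul_sum_transpositions {M : Type*} [AddCommGroup M] (f : Equiv.Perm (Fin d) → M) :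
    2 • ∑ t ∈ transpositions d, f t =
      ∑ p : Fin d × Fin d with p.1 ≠ p.2, f (Equiv.swap p.1 p.2) := by
  classical
  rw [← Finset.sum_fiberwise_of_maps_to (g := fun p : Fin d × Fin d => Equiv.swap p.1 p.2)
    (t := transpositions d)]
  · rw [Finset.smul_sum]
    refine Finset.sum_congr rfl fun t ht => ?_
    rw [transpositions, Finset.mem_filter] at ht
    obtain ⟨x, y, hxy, rfl⟩ := ht.2
    have : ({p : Fin d × Fin d | p.1 ≠ p.2} : Finset _).filter
        (fun p => Equiv.swap p.1 p.2 = Equiv.swap x y) = {(x, y), (y, x)} := by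
      ext ⟨k, l⟩
      simp only [Finset.mem_filter, Finset.mem_univ, true_and, Finset.mem_insert,
        Finset.mem_singleton, Prod.mk.injEq]
      constructor
      · rintro ⟨hkl, h⟩
        have hk := congrArg (fun σ => σ k) h
        have hl := congrArg (fun σ => σ l) h
        simp only [Equiv.swap_apply_left, Equiv.swap_apply_right] at hk hl
        rcases eq_or_ne k x with rfl | hkx
        · left; simpa using hk
        rcases eq_or_ne k y with rfl | hky
        · right; simpa using hk
        rw [Equiv.swap_apply_of_ne_of_ne hkx hky] at hk
        exact absurd hk.symm hkl
      · rintro (⟨rfl, rfl⟩ | ⟨rfl, rfl⟩)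
        · exact ⟨hxy, rfl⟩
        · exact ⟨hxy.symm, Equiv.swap_comm _ _⟩
    rw [this, Finset.sum_insert (by simp [hxy]), Finset.sum_singleton, Equiv.swap_comm y x, two_smul]
  · intro p hp
    simp only [transpositions, Finset.mem_filter, Finset.mem_univ, true_and] at hp ⊢
    exact ⟨p.1, p.2, hp, rfl⟩

/-- The class sum of the transpositions. -/
def transpSum (d : ℕ) : MonoidAlgebra ℂ (Equiv.Perm (Fin d)) := ∑ t ∈ transpositions d, ofPerm t

theorem mem_transpositions {t : Equiv.Perm (Fin d)} : t ∈ transpositions d ↔ t.IsSwap := by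
  simp [transpositions]

theorem transpSum_mul_of (g : Equiv.Perm (Fin d)) :
    transpSum d * ofPerm g = ofPerm g * transpSum d := by
  rw [transpSum, Finset.sum_mul, Finset.mul_sum]
  refine Finset.sum_equiv (MulAut.conj g⁻¹).toEquiv (fun t => ?_) (fun t _ => ?_)
  · rw [mem_transpositions, mem_transpositions]
    simp only [MulEquiv.toEquiv_eq_coe, EquivLike.coe_coe, MulAut.conj_apply, inv_inv]
    constructor
    · rintro ⟨x, y, hxy, rfl⟩
      refine ⟨g⁻¹ x, g⁻¹ y, by simpa using hxy, ?_⟩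
      rw [Equiv.swap_apply_apply]
      simp
    · rintro ⟨x, y, hxy, h⟩
      refine ⟨g x, g y, by simpa using hxy, ?_⟩
      rw [Equiv.swap_apply_apply, ← h]
      simp [mul_assoc]
  · simp [ofPerm, mul_assoc]

theorem transpSum_mul_comm (x : MonoidAlgebra ℂ (Equiv.Perm (Fin d))) :
    transpSum d * x = x * transpSum d := by
  rw [eq_sum_coeff_of x, Finset.mul_sum, Finset.sum_mul]
  exact Finset.sum_congr rfl fun g _ => by
    rw [mul_smul_comm, smul_mul_assoc, transpSum_mul_of]

/-- A swap inside a row is absorbed by the row sum, and one inside a column by the signed column sum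
at the cost of a sign. For any other swap, no product p (k l) q is the identity. -/
theorem coeff_one_rowSym_swap_colAnti {k l : Fin d} (hkl : k ≠ l) :
    (rowSym ν * ofPerm (Equiv.swap k l) * colAnti ν).coeff 1 =
      (if row ν k = row ν l then 1 else 0) - (if col ν k = col ν l then 1 else 0) := by
  by_cases hr : row ν k = row ν l
  · have hc : col ν k ≠ col ν l := fun hc => hkl (box_ext hr hc)
    rw [rowSym_mul_of (swap_mem_rowGroup.mpr hr), ← youngSymmetrizer_eq,
      coeff_one_youngSymmetrizer, if_pos hr, if_neg hc, sub_zero]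
  by_cases hc : col ν k = col ν l
  · rw [mul_assoc, of_mul_colAnti (swap_mem_colGroup.mpr hc), csign_swap hkl, mul_smul_comm,
      ← youngSymmetrizer_eq, MonoidAlgebra.coeff_smul_apply, coeff_one_youngSymmetrizer,
      if_neg hr, if_pos hc]
    simp
  rw [if_neg hr, if_neg hc, sub_zero, rowSym, colAnti, Finset.sum_mul, Finset.sum_mul]
  simp only [Finset.mul_sum, MonoidAlgebra.coeff_sum, Finsupp.coe_finsetSum, Finset.sum_apply]
  refine Finset.sum_eq_zero fun p hp => Finset.sum_eq_zero fun q hq => ?_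
  rw [mul_smul_comm, MonoidAlgebra.coeff_smul_apply, ofPerm, ofPerm, ofPerm, ← map_mul, ← map_mul,
    coeff_of, if_neg, smul_zero]
  intro h
  -- `swap k l = p⁻¹ q⁻¹`
  have hsw : ∀ m, Equiv.swap k l (q m) = p⁻¹ m := by
    intro m
    have := congrArg (fun σ => p⁻¹ (σ m)) h
    simpa using this
  have hrow : ∀ m, row ν (Equiv.swap k l (q m)) = row ν m := fun m => by
    rw [hsw m]; exact mem_rowGroup.mp (inv_mem_rowGroup hp) m
  -- Where the swap does not interfere, `q` preserves the row as well as the column.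
  have hfix : ∀ m, q m ≠ k → q m ≠ l → q m = m := by
    intro m h1 h2
    have := hrow m
    rw [Equiv.swap_apply_of_ne_of_ne h1 h2] at this
    exact box_ext this (mem_colGroup.mp hq m)
  -- The preimage `m` of `k` lies in the row of `l` and the column of `k`, so it differs from both.
  -- Hence `q` fixes the preimage of `m`, that is `q m = m`, contradicting `q m = k`.
  obtain ⟨m, hm⟩ := q.surjective k
  have hm1 : row ν m = row ν l := by rw [← hrow m, hm, Equiv.swap_apply_left]
  have hm2 : col ν m = col ν k := by rw [← hm]; exact (mem_colGroup.mp hq m).symm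
  have hmk : m ≠ k := fun e => hr (by rw [← hm1, e])
  have hml : m ≠ l := fun e => hc (by rw [← hm2, e])
  obtain ⟨m', hm'⟩ := q.surjective m
  have := hfix m' (by rw [hm']; exact hmk) (by rw [hm']; exact hml)
  rw [hm'] at this
  rw [← this, hm] at hm'
  exact hmk hm'.symm

/-- The content sum of the diagram of `ν`. -/
def contentSum : ℂ :=
  (((Finset.univ.filter fun p : Fin d × Fin d => row ν p.1 = row ν p.2).card : ℂ) - d) / 2 -
    ((∑ k, row ν k : ℕ) : ℂ)

/-- The class sum is central, so it can be placed between the row and the column sums, where any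
element acts as a scalar. That scalar is the coefficient at 1: pairs of boxes in a common row minus
pairs in a common column. -/
theorem transpSum_mul_youngSymmetrizer :
    transpSum d * youngSymmetrizer ν = contentSum ν • youngSymmetrizer ν := by
  have h1 : transpSum d * youngSymmetrizer ν = rowSym ν * transpSum d * colAnti ν := by
    rw [youngSymmetrizer_eq, ← mul_assoc, transpSum_mul_comm]
  rw [h1, rowSym_mul_mul_colAnti]
  congr 1
  have h2 : 2 * (rowSym ν * transpSum d * colAnti ν).coeff 1 = 2 * contentSum ν := by
    rw [transpSum, Finset.mul_sum, Finset.sum_mul]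
    simp only [MonoidAlgebra.coeff_sum, Finsupp.coe_finsetSum, Finset.sum_apply]
    have h := two_smul_sum_transpositions fun t => (rowSym ν * ofPerm t * colAnti ν).coeff 1
    rw [two_nsmul, ← two_mul] at h
    rw [h, Finset.sum_congr rfl (g := fun p : Fin d × Fin d =>
      (if row ν p.1 = row ν p.2 then (1 : ℂ) else 0) - (if col ν p.1 = col ν p.2 then 1 else 0))
      (fun p hp => coeff_one_rowSym_swap_colAnti ν (Finset.mem_filter.mp hp).2)]
    rw [Finset.sum_sub_distrib, ← Finset.sum_filter, ← Finset.sum_filter, Finset.filter_filter,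
      Finset.filter_filter, Finset.sum_const, Finset.sum_const, card_col_pairs, contentSum]
    -- `contentSum` counts all ordered pairs in a row; the d diagonal pairs account for its term `-
    -- d`.
    have h3 : (Finset.univ.filter fun p : Fin d × Fin d => row ν p.1 = row ν p.2).card =
        (Finset.univ.filter fun p : Fin d × Fin d => p.1 ≠ p.2 ∧ row ν p.1 = row ν p.2).card + d := by
      rw [← Finset.card_filter_add_card_filter_not (fun p : Fin d × Fin d => p.1 ≠ p.2),
        Finset.filter_filter, Finset.filter_filter]
      congr 1
      · congr 1
        ext p
        simp [and_comm]
      · have : (Finset.univ.filter fun p : Fin d × Fin d => row ν p.1 = row ν p.2 ∧ ¬ p.1 ≠ p.2) =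
            Finset.univ.image fun k : Fin d => (k, k) := by
          ext ⟨k, l⟩
          simp only [ne_eq, not_not, Finset.mem_filter, Finset.mem_univ, true_and,
            Finset.mem_image, Prod.mk.injEq, exists_eq_left]
          exact ⟨fun h => h.2, fun h => ⟨by rw [h], h⟩⟩
        rw [this, Finset.card_image_of_injective _ fun k l h => (Prod.mk.inj h).1,
          Finset.card_univ, Fintype.card_fin]
    rw [h3]
    push_cast
    simp only [nsmul_eq_mul, mul_one]
    push_cast
    ring
  exact mul_left_cancel₀ two_ne_zero h2

/-- After multiplication by the hook scalar, χ_ν(1) becomes d! and the sum of χ_ν over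
transpositions becomes d! times the eigenvalue of the class sum on c. -/
theorem fTransp_eq_contentSum : fTransp ν = contentSum ν := by
  have hn := hookScalar_ne_zero ν
  have h1 : hookScalar ν * chi ν 1 = d.factorial := by
    rw [hookScalar_mul_chi]
    simp [coeff_one_youngSymmetrizer, Fintype.card_perm]
  have h2 : hookScalar ν * ∑ t ∈ transpositions d, chi ν t = d.factorial * contentSum ν := by
    rw [Finset.mul_sum]
    simp only [hookScalar_mul_chi]
    rw [Finset.sum_comm]
    have : ∀ g : Equiv.Perm (Fin d), ∑ t ∈ transpositions d,
        (ofPerm (g⁻¹ * t * g) * youngSymmetrizer ν).coeff 1 = contentSum ν := by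
      intro g
      have e : ∑ t ∈ transpositions d, (ofPerm (g⁻¹ * t * g) * youngSymmetrizer ν) =
          contentSum ν • youngSymmetrizer ν := by
        rw [← transpSum_mul_youngSymmetrizer, ← Finset.sum_mul]
        congr 1
        have : transpSum d = ofPerm g⁻¹ * (transpSum d * ofPerm g) := by
          rw [transpSum_mul_of, ← mul_assoc, ofPerm, ofPerm, ← map_mul, inv_mul_cancel, map_one,
            one_mul]
        rw [this, transpSum, Finset.sum_mul, Finset.mul_sum]
        simp [ofPerm, mul_assoc]
      have := congrArg (fun x => x.coeff 1) e
      simpa [coeff_one_youngSymmetrizer] using this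
    rw [Finset.sum_congr rfl fun g _ => this g]
    simp [Fintype.card_perm]
  have hf : (d.factorial : ℂ) ≠ 0 := by exact_mod_cast d.factorial_ne_zero
  have hchi : chi ν 1 ≠ 0 := fun h => hf (by rw [← h1, h, mul_zero])
  rw [fTransp, div_eq_iff hchi]
  apply mul_left_cancel₀ hn
  rw [h2, ← h1]
  ring

end Symmetrizer

/-! ### Power sums as sums over words, and the cut-and-join equation -/

section Words

variable {N d : ℕ}

open MvPolynomial

/-- The monomial of a word. -/
def wordMon (W : Fin d → Fin N) : MvPolynomial (Fin N) ℂ := ∏ k, X (W k)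

/-- The content of a word: the number of occurrences of each letter. -/
def wordContent (W : Fin d → Fin N) : Fin N →₀ ℕ := ∑ k, Finsupp.single (W k) 1

theorem wordMon_eq_monomial (W : Fin d → Fin N) : wordMon W = monomial (wordContent W) 1 := by
  rw [wordMon, wordContent, monomial_sum_one]
  rfl

theorem wordContent_apply (W : Fin d → Fin N) (i : Fin N) :
    wordContent W i = (Finset.univ.filter fun k => W k = i).card := by
  rw [wordContent, Finsupp.finsetSum_apply, Finset.card_filter]
  exact Finset.sum_congr rfl fun k _ => Finsupp.single_apply

theorem wordMon_comp (W : Fin d → Fin N) (g : Equiv.Perm (Fin d)) :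
    wordMon (W ∘ g) = wordMon W :=
  Equiv.prod_comp g fun k => X (W k)

/-- The power sum attached to the cycles of `σ`, as the sum over the words fixed by `σ`. -/
def permPoly (N : ℕ) (σ : Equiv.Perm (Fin d)) : MvPolynomial (Fin N) ℂ :=
  ∑ W : Fin d → Fin N with W ∘ σ = W, wordMon W

theorem permPoly_conj (σ g : Equiv.Perm (Fin d)) : permPoly N (g * σ * g⁻¹) = permPoly N σ := by
  refine Finset.sum_equiv (Equiv.arrowCongr g⁻¹ (Equiv.refl (Fin N))) (fun W => ?_) (fun W _ => ?_)
  · simp only [Finset.mem_filter, Finset.mem_univ, true_and]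
    have e : (Equiv.arrowCongr g⁻¹ (Equiv.refl (Fin N))) W = W ∘ g := by
      rfl
    rw [e]
    constructor
    · intro h
      funext k
      have := congrFun h (g k)
      simpa using this
    · intro h
      funext k
      have := congrFun h (g⁻¹ k)
      simpa using this
  · have e : (Equiv.arrowCongr g⁻¹ (Equiv.refl (Fin N))) W = W ∘ g := by
      rfl
    rw [e, wordMon_comp]

theorem permPoly_inv (σ : Equiv.Perm (Fin d)) : permPoly N σ⁻¹ = permPoly N σ := by
  rw [permPoly, permPoly]
  congr 1
  ext W
  simp only [Finset.mem_filter, Finset.mem_univ, true_and]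
  constructor
  · intro h
    funext k
    simpa using (congrFun h (σ k)).symm
  · intro h
    funext k
    simpa using (congrFun h (σ⁻¹ k)).symm

/-! ### Euler operators on polynomials -/

/-- The Euler derivation `x_i ∂/∂x_i`. -/
def euler (i : Fin N) : Derivation ℂ (MvPolynomial (Fin N) ℂ) (MvPolynomial (Fin N) ℂ) :=
  (X i : MvPolynomial (Fin N) ℂ) • pderiv i

theorem euler_monomial (i : Fin N) (s : Fin N →₀ ℕ) (a : ℂ) :
    euler i (monomial s a) = (s i : ℂ) • monomial s a := by
  rw [euler, Derivation.smul_apply, smul_eq_mul, X_mul_pderiv_monomial, Nat.cast_smul_eq_nsmul]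

theorem euler_X (i j : Fin N) :
    euler i (X j : MvPolynomial (Fin N) ℂ) = if i = j then X j else 0 := by
  rw [X, euler_monomial]
  by_cases h : i = j
  · subst h; simp
  · simp [h]

/-- The operator `∑ (x_i ∂/∂x_i)²`. -/
def eulerSq : MvPolynomial (Fin N) ℂ →ₗ[ℂ] MvPolynomial (Fin N) ℂ :=
  ∑ i, (euler i).toLinearMap.comp (euler i).toLinearMap

theorem eulerSq_apply (f : MvPolynomial (Fin N) ℂ) : eulerSq f = ∑ i, euler i (euler i f) := by
  simp [eulerSq]

theorem eulerSq_monomial (s : Fin N →₀ ℕ) (a : ℂ) :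
    eulerSq (monomial s a) = (∑ i, (s i : ℂ) ^ 2) • monomial s a := by
  rw [eulerSq_apply, Finset.sum_smul]
  refine Finset.sum_congr rfl fun i _ => ?_
  rw [euler_monomial, Derivation.map_smul, euler_monomial, smul_smul, sq]

/-- Monomials are eigenvectors, with eigenvalue the squared norm of the exponent. An eigenvalue
equation for `eulerSq` is thus a norm condition on every exponent that occurs. -/
theorem coeff_eulerSq (f : MvPolynomial (Fin N) ℂ) (s : Fin N →₀ ℕ) :
    coeff s (eulerSq f) = (∑ i, (s i : ℂ) ^ 2) * coeff s f := by
  induction f using MvPolynomial.induction_on' with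
  | monomial u a =>
    rw [eulerSq_monomial, coeff_smul, smul_eq_mul, coeff_monomial]
    split_ifs with h
    · rw [h]
    · simp
  | add p q hp hq => rw [map_add, coeff_add, coeff_add, hp, hq, mul_add]

theorem eulerSq_mul (f g : MvPolynomial (Fin N) ℂ) :
    eulerSq (f * g) = eulerSq f * g + 2 * ∑ i, euler i f * euler i g + f * eulerSq g := by
  simp only [eulerSq_apply, Derivation.leibniz, smul_eq_mul, map_add, Finset.sum_mul,
    Finset.mul_sum, ← Finset.sum_add_distrib]
  refine Finset.sum_congr rfl fun i _ => ?_
  ring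

theorem euler_wordMon (i : Fin N) (W : Fin d → Fin N) :
    euler i (wordMon W) = ∑ k, if W k = i then wordMon W else 0 := by
  rw [wordMon_eq_monomial, euler_monomial, wordContent_apply, ← Finset.sum_filter,
    Finset.sum_const, Nat.cast_smul_eq_nsmul]

/-! ### Words fixed after a transposition, and the cut-and-join identity -/

/-- The words fixed by `σ` composed with a transposition of boxes carrying the letters `i`, `j`. -/
def joinPoly (σ : Equiv.Perm (Fin d)) (i j : Fin N) : MvPolynomial (Fin N) ℂ :=
  ∑ k, ∑ l, ∑ W : Fin d → Fin N,
    if W ∘ (Equiv.swap k l * σ : Equiv.Perm (Fin d)) = W ∧ W k = i ∧ W l = j then wordMon W else 0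

theorem joinPoly_comm (σ : Equiv.Perm (Fin d)) (i j : Fin N) : joinPoly σ i j = joinPoly σ j i := by
  rw [joinPoly, Finset.sum_comm]
  refine Finset.sum_congr rfl fun k _ => Finset.sum_congr rfl fun l _ =>
    Finset.sum_congr rfl fun W _ => ?_
  simp only [Equiv.swap_comm l k, and_comm (a := W l = i)]

theorem wordMon_update (W : Fin d → Fin N) (l : Fin d) (i : Fin N) :
    X (W l) * wordMon (Function.update W l i) = X i * wordMon W := by
  rw [wordMon, wordMon, ← Finset.mul_prod_erase _ _ (Finset.mem_univ l),
    ← Finset.mul_prod_erase _ (fun k => X (W k)) (Finset.mem_univ l), Function.update_self]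
  have : ∏ x ∈ Finset.univ.erase l, (X (Function.update W l i x) : MvPolynomial (Fin N) ℂ) =
      ∏ x ∈ Finset.univ.erase l, X (W x) :=
    Finset.prod_congr rfl fun x hx => by rw [Function.update_of_ne (Finset.ne_of_mem_erase hx)]
  rw [this]
  ring

/-- A word fixed by (k l) σ with distinct letters i at k and j at l colours a cycle of σ by two
arcs: i from k up to just before l, and j from l up to just before k. The map moves the boundary
point from l to σ l and recolours l with i. The cases k = l and k = σ l are the degenerate ones in
which one arc is the whole cycle. -/
theorem shift_left_mem {σ : Equiv.Perm (Fin d)} {i j : Fin N} (hij : i ≠ j) {k l : Fin d}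
    {W : Fin d → Fin N}
    (h : W ∘ (Equiv.swap k l * σ : Equiv.Perm (Fin d)) = W ∧ W l = j ∧ (W k = i ∨ k = l)) :
    Function.update W l i ∘ (Equiv.swap k (σ l) * σ : Equiv.Perm (Fin d)) = Function.update W l i ∧
      Function.update W l i k = i ∧ (Function.update W l i (σ l) = j ∨ k = σ l) := by
  obtain ⟨h1, h2, h3⟩ := h
  have hm : ∀ m, W (Equiv.swap k l (σ m)) = W m := fun m => congrFun h1 m
  have hinj : ∀ m m', σ m = σ m' → m = m' := fun m m' h => σ.injective h
  refine ⟨?_, ?_, ?_⟩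
  · funext m
    have hl := hm l
    have hmm := hm m
    have hi := hinj m l
    simp only [Function.comp_apply, Equiv.Perm.mul_apply, Function.update_apply,
      Equiv.swap_apply_def] at *
    grind
  · simp only [Function.update_apply]
    grind
  · have hl := hm l
    simp only [Function.update_apply, Equiv.swap_apply_def] at *
    grind

/-- The inverse move: the boundary returns from σ l to l, and l gets the letter j again. -/
theorem shift_right_mem {σ : Equiv.Perm (Fin d)} {i j : Fin N} (hij : i ≠ j) {k l : Fin d}
    {W : Fin d → Fin N}
    (h : W ∘ (Equiv.swap k (σ l) * σ : Equiv.Perm (Fin d)) = W ∧ W k = i ∧ (W (σ l) = j ∨ k = σ l)) :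
    Function.update W l j ∘ (Equiv.swap k l * σ : Equiv.Perm (Fin d)) = Function.update W l j ∧
      Function.update W l j l = j ∧ (Function.update W l j k = i ∨ k = l) := by
  obtain ⟨h1, h2, h3⟩ := h
  have hm : ∀ m, W (Equiv.swap k (σ l) (σ m)) = W m := fun m => congrFun h1 m
  have hinj : ∀ m m', σ m = σ m' → m = m' := fun m m' h => σ.injective h
  refine ⟨?_, ?_, ?_⟩
  · funext m
    have hl := hm l
    have hmm := hm m
    have hi := hinj m l
    simp only [Function.comp_apply, Equiv.Perm.mul_apply, Function.update_apply,
      Equiv.swap_apply_def] at *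
    grind
  · simp
  · simp only [Function.update_apply]
    grind

theorem eq_of_shift_left {σ : Equiv.Perm (Fin d)} {i : Fin N} {k l : Fin d}
    {W : Fin d → Fin N} (h : W ∘ (Equiv.swap k (σ l) * σ : Equiv.Perm (Fin d)) = W ∧ W k = i) :
    W l = i := by
  rw [← h.2, ← congrFun h.1 l]
  simp

/-- Moving the boundary between the two arcs by one box is a bijection that trades one letter j for
one letter i, hence multiplies the monomial by x_i / x_j. -/
theorem sum_shift (σ : Equiv.Perm (Fin d)) {i j : Fin N} (hij : i ≠ j) :
    X i * ∑ x : Fin d × Fin d × (Fin d → Fin N) with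
        x.2.2 ∘ (Equiv.swap x.1 x.2.1 * σ : Equiv.Perm (Fin d)) = x.2.2 ∧ x.2.2 x.2.1 = j ∧
          (x.2.2 x.1 = i ∨ x.1 = x.2.1), wordMon x.2.2 =
      X j * ∑ x : Fin d × Fin d × (Fin d → Fin N) with
        x.2.2 ∘ (Equiv.swap x.1 x.2.1 * σ : Equiv.Perm (Fin d)) = x.2.2 ∧ x.2.2 x.1 = i ∧
          (x.2.2 x.2.1 = j ∨ x.1 = x.2.1), wordMon x.2.2 := by
  rw [Finset.mul_sum, Finset.mul_sum]
  refine Finset.sum_bij' (fun x _ => (x.1, σ x.2.1, Function.update x.2.2 x.2.1 i))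
    (fun x _ => (x.1, σ⁻¹ x.2.1, Function.update x.2.2 (σ⁻¹ x.2.1) j)) ?_ ?_ ?_ ?_ ?_
  · rintro ⟨k, l, W⟩ hx
    simp only [Finset.mem_filter, Finset.mem_univ, true_and] at hx ⊢
    exact shift_left_mem hij hx
  · rintro ⟨k, l, W⟩ hx
    simp only [Finset.mem_filter, Finset.mem_univ, true_and] at hx ⊢
    refine shift_right_mem hij ?_
    simpa using hx
  · rintro ⟨k, l, W⟩ hx
    simp only [Finset.mem_filter, Finset.mem_univ, true_and] at hx
    have : Function.update W l j = W := by rw [← hx.2.1, Function.update_eq_self]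
    simp [this]
  · rintro ⟨k, l, W⟩ hx
    simp only [Finset.mem_filter, Finset.mem_univ, true_and] at hx
    have h : W (σ⁻¹ l) = i := by
      refine eq_of_shift_left (σ := σ) (k := k) ⟨?_, hx.2.1⟩
      simpa using hx.1
    have : Function.update W (σ⁻¹ l) i = W := by rw [← h, Function.update_eq_self]
    simp only [Function.update_idem, this]
    rw [← Equiv.Perm.mul_apply, mul_inv_cancel, Equiv.Perm.one_apply]
  · rintro ⟨k, l, W⟩ hx
    simp only [Finset.mem_filter, Finset.mem_univ, true_and] at hx
    rw [← hx.2.1]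
    exact (wordMon_update W l i).symm

theorem euler_permPoly (σ : Equiv.Perm (Fin d)) (i : Fin N) :
    euler i (permPoly N σ) =
      ∑ k, ∑ W : Fin d → Fin N, if W ∘ σ = W ∧ W k = i then wordMon W else 0 := by
  rw [permPoly, map_sum, Finset.sum_comm, Finset.sum_filter]
  refine Finset.sum_congr rfl fun W _ => ?_
  split_ifs with h
  · rw [euler_wordMon]
    exact Finset.sum_congr rfl fun k _ => by simp [h]
  · simp [h]

/-- The terms with k ≠ l form `joinPoly`. For k = l the swap is trivial, and what remains is the
count of letters j in words fixed by σ, an Euler derivative; `joinPoly` has no such terms because i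
≠ j. -/
theorem sum_left_eq (σ : Equiv.Perm (Fin d)) {i j : Fin N} (hij : i ≠ j) :
    ∑ x : Fin d × Fin d × (Fin d → Fin N) with
        x.2.2 ∘ (Equiv.swap x.1 x.2.1 * σ : Equiv.Perm (Fin d)) = x.2.2 ∧ x.2.2 x.2.1 = j ∧
          (x.2.2 x.1 = i ∨ x.1 = x.2.1), wordMon x.2.2 =
      joinPoly σ i j + euler j (permPoly N σ) := by
  rw [Finset.sum_filter, Fintype.sum_prod_type, joinPoly, euler_permPoly, ← Finset.sum_add_distrib]
  refine Finset.sum_congr rfl fun k _ => ?_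
  rw [Fintype.sum_prod_type]
  have : ∑ W : Fin d → Fin N, (if W ∘ σ = W ∧ W k = j then wordMon W else 0) =
      ∑ l, ∑ W : Fin d → Fin N, if k = l ∧ W ∘ σ = W ∧ W k = j then wordMon W else 0 := by
    rw [Finset.sum_eq_single k]
    · simp
    · intro l _ hl
      simp [hl.symm]
    · simp
  rw [this, ← Finset.sum_add_distrib]
  refine Finset.sum_congr rfl fun l _ => ?_
  rw [← Finset.sum_add_distrib]
  refine Finset.sum_congr rfl fun W _ => ?_
  rcases eq_or_ne k l with rfl | hkl
  · have h1 : ¬ (W k = i ∧ W k = j) := fun h => hij (h.1.symm.trans h.2)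
    have h2 : (Equiv.swap k k * σ : Equiv.Perm (Fin d)) = σ := by rw [Equiv.swap_self]; rfl
    simp only [h2]
    simp [h1]
  · simp [hkl, and_comm]

theorem sum_right_eq (σ : Equiv.Perm (Fin d)) {i j : Fin N} (hij : i ≠ j) :
    ∑ x : Fin d × Fin d × (Fin d → Fin N) with
        x.2.2 ∘ (Equiv.swap x.1 x.2.1 * σ : Equiv.Perm (Fin d)) = x.2.2 ∧ x.2.2 x.1 = i ∧
          (x.2.2 x.2.1 = j ∨ x.1 = x.2.1), wordMon x.2.2 =
      joinPoly σ i j + euler i (permPoly N σ) := by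
  rw [joinPoly_comm, ← sum_left_eq σ hij.symm]
  refine Finset.sum_equiv ⟨fun x => (x.2.1, x.1, x.2.2), fun x => (x.2.1, x.1, x.2.2),
    fun _ => rfl, fun _ => rfl⟩ (fun x => ?_) (fun x _ => rfl)
  simp only [Finset.mem_filter, Finset.mem_univ, true_and, Equiv.coe_fn_mk]
  rw [Equiv.swap_comm, eq_comm (a := x.1)]

/-- Rearrangement of x_i (J + E_j) = x_j (J + E_i). It exhibits the quotient by x_i - x_j, which the
derivative of the Vandermonde product requires, as a polynomial. -/
theorem euler_sub_eq (σ : Equiv.Perm (Fin d)) {i j : Fin N} (hij : i ≠ j) :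
    X i * euler i (permPoly N σ) - X j * euler j (permPoly N σ) =
      (X i - X j) * (euler i (permPoly N σ) + euler j (permPoly N σ) + joinPoly σ i j) := by
  have h := sum_shift σ hij
  rw [sum_left_eq σ hij, sum_right_eq σ hij] at h
  linear_combination -h

/-- By the Leibniz rule each factor x_p - x_{p'} is differentiated once; the hypothesis says that
the result is again divisible by that factor, with quotient T. -/
theorem sum_euler_prod_mul (s : Finset (Fin N × Fin N)) (P : MvPolynomial (Fin N) ℂ)
    (T : Fin N × Fin N → MvPolynomial (Fin N) ℂ)
    (hT : ∀ p ∈ s, X p.1 * euler p.1 P - X p.2 * euler p.2 P = (X p.1 - X p.2) * T p) :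
    ∑ i, euler i (∏ p ∈ s, (X p.1 - X p.2)) * euler i P =
      (∏ p ∈ s, (X p.1 - X p.2)) * ∑ p ∈ s, T p := by
  classical
  induction s using Finset.induction_on with
  | empty => simp
  | insert p s hp ih =>
    have ih' := ih fun q hq => hT q (Finset.mem_insert_of_mem hq)
    have h1 : ∑ i, euler i (X p.1 - X p.2) * euler i P = (X p.1 - X p.2) * T p := by
      rw [← hT p (Finset.mem_insert_self _ _)]
      simp only [map_sub, euler_X, sub_mul, Finset.sum_sub_distrib, ite_mul, zero_mul]
      simp
    rw [Finset.prod_insert hp, Finset.sum_insert hp]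
    simp only [Derivation.leibniz, smul_eq_mul, add_mul, Finset.sum_add_distrib]
    have h2 : ∑ i, (X p.1 - X p.2) * euler i (∏ q ∈ s, (X q.1 - X q.2)) * euler i P =
        (X p.1 - X p.2) * ∑ i, euler i (∏ q ∈ s, (X q.1 - X q.2)) * euler i P := by
      rw [Finset.mul_sum]
      exact Finset.sum_congr rfl fun i _ => by ring
    have h3 : ∑ i, (∏ q ∈ s, (X q.1 - X q.2)) * euler i (X p.1 - X p.2) * euler i P =
        (∏ q ∈ s, (X q.1 - X q.2)) * ∑ i, euler i (X p.1 - X p.2) * euler i P := by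
      rw [Finset.mul_sum]
      exact Finset.sum_congr rfl fun i _ => by ring
    rw [h2, h3, ih', h1]
    ring

theorem sum_euler_permPoly (σ : Equiv.Perm (Fin d)) :
    ∑ i, euler i (permPoly N σ) = (d : ℂ) • permPoly N σ := by
  simp only [euler_permPoly]
  rw [Finset.sum_comm]
  have : ∀ k : Fin d, ∑ i, ∑ W : Fin d → Fin N,
      (if W ∘ σ = W ∧ W k = i then wordMon W else 0) = permPoly N σ := by
    intro k
    rw [Finset.sum_comm, permPoly, Finset.sum_filter]
    refine Finset.sum_congr rfl fun W _ => ?_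
    split_ifs with h <;> simp [h]
  simp [this, Nat.cast_smul_eq_nsmul]

theorem eulerSq_wordMon (W : Fin d → Fin N) :
    eulerSq (wordMon W) = ∑ k, ∑ l, if W k = W l then wordMon W else 0 := by
  have h : ∑ i, (wordContent W i : ℂ) ^ 2 = ∑ k, ∑ l, if W k = W l then (1 : ℂ) else 0 := by
    have e : ∀ i, (wordContent W i : ℂ) = ∑ k, if W k = i then (1 : ℂ) else 0 := by
      intro i
      rw [wordContent_apply, Finset.card_filter]
      push_cast
      rfl
    simp only [e, sq, Finset.sum_mul_sum]
    rw [Finset.sum_comm]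
    refine Finset.sum_congr rfl fun k _ => ?_
    rw [Finset.sum_comm]
    refine Finset.sum_congr rfl fun l _ => ?_
    simp [eq_comm]
  rw [wordMon_eq_monomial, eulerSq_monomial, h]
  simp only [Finset.sum_smul, ite_smul, one_smul, zero_smul]

/-- If the letters at k and l agree, the swap is invisible and one counts pairs of equal letters in
words fixed by σ, which is `eulerSq`. If they differ, the word contributes to one `joinPoly`. -/
theorem sum_permPoly_swap (σ : Equiv.Perm (Fin d)) :
    ∑ k, ∑ l, permPoly N (Equiv.swap k l * σ) = eulerSq (permPoly N σ) +
      ∑ p : Fin N × Fin N with p.1 ≠ p.2, joinPoly σ p.1 p.2 := by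
  have h1 : eulerSq (permPoly N σ) = ∑ k, ∑ l, ∑ W : Fin d → Fin N,
      if W ∘ (Equiv.swap k l * σ : Equiv.Perm (Fin d)) = W ∧ W k = W l then wordMon W else 0 := by
    have : ∀ W : Fin d → Fin N, ∀ k l : Fin d,
        (W ∘ (Equiv.swap k l * σ : Equiv.Perm (Fin d)) = W ∧ W k = W l) ↔
          (W ∘ σ = W ∧ W k = W l) := by
      intro W k l
      refine and_congr_left fun h => ?_
      have : W ∘ (Equiv.swap k l * σ : Equiv.Perm (Fin d)) = W ∘ σ := by
        funext m
        simp only [Function.comp_apply, Equiv.Perm.mul_apply, Equiv.swap_apply_def]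
        split_ifs with h1 h2
        · rw [h1, h]
        · rw [h2, h]
        · rfl
      rw [this]
    simp only [this]
    have e : ∀ k : Fin d, (∑ l, ∑ W : Fin d → Fin N,
        if W ∘ σ = W ∧ W k = W l then wordMon W else 0) = ∑ W : Fin d → Fin N, ∑ l,
        if W ∘ σ = W ∧ W k = W l then wordMon W else 0 := fun k => Finset.sum_comm
    simp only [e]
    rw [Finset.sum_comm, permPoly, map_sum, Finset.sum_filter]
    refine Finset.sum_congr rfl fun W _ => ?_
    split_ifs with h
    · rw [eulerSq_wordMon]
      simp [h]
    · simp [h]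
  have h2 : ∑ p : Fin N × Fin N with p.1 ≠ p.2, joinPoly σ p.1 p.2 =
      ∑ k, ∑ l, ∑ W : Fin d → Fin N,
      if W ∘ (Equiv.swap k l * σ : Equiv.Perm (Fin d)) = W ∧ W k ≠ W l then wordMon W else 0 := by
    simp only [joinPoly]
    rw [Finset.sum_comm]
    refine Finset.sum_congr rfl fun k _ => ?_
    rw [Finset.sum_comm]
    refine Finset.sum_congr rfl fun l _ => ?_
    rw [Finset.sum_comm]
    refine Finset.sum_congr rfl fun W _ => ?_
    by_cases h : W k = W l
    · rw [if_neg (by simp [h])]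
      refine Finset.sum_eq_zero fun p hp => if_neg ?_
      rintro ⟨-, h1, h2⟩
      exact (Finset.mem_filter.mp hp).2 (by rw [← h1, ← h2, h])
    · rw [Finset.sum_eq_single (W k, W l)]
      · simp [h]
      · intro p _ hp
        refine if_neg ?_
        rintro ⟨-, h1, h2⟩
        exact hp (by rw [h1, h2])
      · intro hn
        simp [h] at hn
  rw [h1, h2, ← Finset.sum_add_distrib]
  refine Finset.sum_congr rfl fun k _ => ?_
  rw [← Finset.sum_add_distrib]
  refine Finset.sum_congr rfl fun l _ => ?_
  rw [← Finset.sum_add_distrib, permPoly, Finset.sum_filter]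
  refine Finset.sum_congr rfl fun W _ => ?_
  by_cases h : W k = W l <;> by_cases h' : W ∘ (Equiv.swap k l * σ : Equiv.Perm (Fin d)) = W <;>
    simp only [h, h', ne_eq, not_true, not_false_iff, and_true, and_false, if_true, if_false,
      add_zero, zero_add]

theorem sum_ne_eq_two_mul {M : Type*} [CommRing M] (f : Fin N → Fin N → M)
    (hf : ∀ i j, f i j = f j i) :
    ∑ p : Fin N × Fin N with p.1 ≠ p.2, f p.1 p.2 = 2 * ∑ p ∈ posRoots N, f p.1 p.2 := by
  have h : (Finset.univ.filter fun p : Fin N × Fin N => p.1 ≠ p.2) =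
      posRoots N ∪ Finset.univ.filter fun p : Fin N × Fin N => p.2 < p.1 := by
    ext p
    simp only [posRoots, Finset.mem_filter, Finset.mem_univ, true_and, Finset.mem_union]
    exact ne_iff_lt_or_gt
  rw [h, Finset.sum_union, two_mul]
  · congr 1
    refine Finset.sum_equiv (Equiv.prodComm _ _) (fun p => ?_) (fun p _ => hf _ _)
    simp [posRoots]
  · rw [posRoots, Finset.disjoint_filter]
    intro p _ h1 h2
    exact absurd h1 (not_lt.mpr h2.le)

theorem sum_posRoots_add {M : Type*} [CommRing M] [IsDomain M] [CharZero M] (f : Fin N → M) :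
    ∑ p ∈ posRoots N, (f p.1 + f p.2) = ((N : M) - 1) * ∑ i, f i := by
  have h := sum_ne_eq_two_mul (fun i j => f i + f j) fun i j => add_comm _ _
  apply mul_left_cancel₀ (two_ne_zero (α := M))
  rw [← h, Finset.sum_filter, Fintype.sum_prod_type]
  have e : ∀ i : Fin N, ∑ j, (if i ≠ j then f i + f j else 0) =
      ((N : M) - 2) * f i + ∑ j, f j := by
    intro i
    have : ∀ j, (if i ≠ j then f i + f j else 0) = (f i + f j) - if i = j then 2 * f i else 0 := by
      intro j
      by_cases hij : i = j
      · subst hij; simp; ring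
      · simp [hij]
    simp only [this, Finset.sum_sub_distrib, Finset.sum_add_distrib]
    simp
    ring
  simp only [e, Finset.sum_add_distrib, ← Finset.mul_sum]
  simp
  ring

end Words

/-! ### Majorization -/

section Majorization

/-- Abel summation, carried out by induction on n. -/
theorem mul_sum_le_sum_mul_of_partial_sums_nonneg (z y : ℕ → ℤ) (n : ℕ)
    (hz : ∀ m ≤ n, 0 ≤ ∑ i ∈ Finset.range m, z i) (hy : ∀ i, i + 1 ≤ n → y (i + 1) ≤ y i) :
    y n * ∑ i ∈ Finset.range (n + 1), z i ≤ ∑ i ∈ Finset.range (n + 1), z i * y i := by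
  induction n with
  | zero => simp [mul_comm]
  | succ n ih =>
    have h := ih (fun m hm => hz m (hm.trans n.le_succ)) fun i hi => hy i (hi.trans n.le_succ)
    rw [Finset.sum_range_succ _ (n + 1), Finset.sum_range_succ _ (n + 1)]
    have h1 := mul_le_mul_of_nonneg_right (hy n le_rfl) (hz (n + 1) le_rfl)
    linarith [mul_comm (y (n + 1)) (z (n + 1))]

variable {N : ℕ}

/-- The first `m` elements of `Fin N`. -/
def firstFin (N m : ℕ) : Finset (Fin N) := Finset.univ.filter fun i => (i : ℕ) < m

theorem sum_firstFin {M : Type*} [AddCommMonoid M] {m : ℕ} (hm : m ≤ N) (f : ℕ → M) :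
    ∑ i ∈ firstFin N m, f i = ∑ j ∈ Finset.range m, f j := by
  refine Finset.sum_bij (fun i _ => (i : ℕ)) ?_ ?_ ?_ ?_
  · intro i hi
    simpa [firstFin] using hi
  · intro i _ j _ h
    exact Fin.ext h
  · intro j hj
    have hj' := Finset.mem_range.mp hj
    exact ⟨⟨j, hj'.trans_le hm⟩, by simpa [firstFin] using hj', rfl⟩
  · intro i _
    rfl

theorem card_firstFin {m : ℕ} (hm : m ≤ N) : (firstFin N m).card = m := by
  have := sum_firstFin hm fun _ => 1
  simpa using this

theorem firstFin_self : firstFin N N = Finset.univ := by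
  simp [firstFin]

/-- If `X` dominates the antitone sequence `Y` and they have the same norm, they are equal. -/
theorem eq_of_majorize {X Y : Fin N → ℤ} (hY : Antitone Y)
    (hle : ∀ m ≤ N, ∑ i ∈ firstFin N m, Y i ≤ ∑ i ∈ firstFin N m, X i)
    (htot : ∑ i, X i = ∑ i, Y i) (hsq : ∑ i, X i ^ 2 = ∑ i, Y i ^ 2) : X = Y := by
  -- Abel summation for X - Y, whose partial sums are nonnegative with total zero. Then |X - Y|² =
  -- |X|² - |Y|² - 2⟨X - Y, Y⟩ is at most 0.
  have key : 0 ≤ ∑ i, (X i - Y i) * Y i := by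
    cases N with
    | zero => simp
    | succ n =>
      let z : ℕ → ℤ := fun i => if h : i < n + 1 then X ⟨i, h⟩ - Y ⟨i, h⟩ else 0
      let y : ℕ → ℤ := fun i => if h : i < n + 1 then Y ⟨i, h⟩ else 0
      have hz : ∀ i : Fin (n + 1), z i = X i - Y i := fun i => dif_pos i.2
      have hy : ∀ i : Fin (n + 1), y i = Y i := fun i => dif_pos i.2
      have hs : ∀ m ≤ n + 1, ∑ i ∈ Finset.range m, z i = ∑ i ∈ firstFin (n + 1) m, (X i - Y i) := by
        intro m hm
        rw [← sum_firstFin hm]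
        exact Finset.sum_congr rfl fun i _ => hz i
      have h := mul_sum_le_sum_mul_of_partial_sums_nonneg z y n ?_ ?_
      · rw [hs (n + 1) le_rfl, firstFin_self, Finset.sum_sub_distrib, htot, sub_self, mul_zero,
          ← sum_firstFin le_rfl, firstFin_self] at h
        simpa only [hz, hy] using h
      · intro m hm
        rw [hs m (hm.trans n.le_succ), Finset.sum_sub_distrib]
        exact sub_nonneg.mpr (hle m (hm.trans n.le_succ))
      · intro i hi
        simp only [y]
        rw [dif_pos (show i + 1 < n + 1 by omega), dif_pos (show i < n + 1 by omega)]
        exact hY (Fin.mk_le_mk.mpr i.le_succ)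
  have hzero : ∑ i, (X i - Y i) ^ 2 ≤ 0 := by
    have : ∑ i, (X i - Y i) ^ 2 = ∑ i, X i ^ 2 - ∑ i, Y i ^ 2 - 2 * ∑ i, (X i - Y i) * Y i := by
      rw [Finset.mul_sum, ← Finset.sum_sub_distrib, ← Finset.sum_sub_distrib]
      exact Finset.sum_congr rfl fun i _ => by ring
    rw [this, hsq]
    linarith
  funext i
  have := (Finset.sum_eq_zero_iff_of_nonneg fun i _ => sq_nonneg (X i - Y i)).mp
    (le_antisymm hzero (Finset.sum_nonneg fun i _ => sq_nonneg _)) i (Finset.mem_univ _)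
  exact sub_eq_zero.mp (pow_eq_zero_iff two_ne_zero |>.mp this)

theorem sum_rev_le (J : Finset (Fin N)) :
    ∑ i ∈ J, (i.rev : ℕ) ≤ ∑ i ∈ firstFin N J.card, (i.rev : ℕ) := by
  set F := firstFin N J.card with hF
  have hcard : F.card = J.card := card_firstFin (by simpa using J.card_le_univ)
  have h1 : (J \ F).card = (F \ J).card := by
    have e1 := Finset.card_sdiff_add_card_inter J F
    have e2 := Finset.card_sdiff_add_card_inter F J
    rw [Finset.inter_comm] at e2
    omega
  rw [← Finset.sum_inter_add_sum_sdiff J F, ← Finset.sum_inter_add_sum_sdiff F J,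
    Finset.inter_comm F J]
  refine Nat.add_le_add_left ?_ _
  -- Exchange argument: the value N - #J separates the weights `rev` outside F (at most that) from
  -- those inside F (at least that).
  calc ∑ i ∈ J \ F, (i.rev : ℕ) ≤ (J \ F).card • (N - J.card) := by
        refine Finset.sum_le_card_nsmul _ _ _ fun i hi => ?_
        simp only [hF, firstFin, Finset.mem_sdiff, Finset.mem_filter, Finset.mem_univ, true_and,
          not_lt] at hi
        rw [Fin.val_rev]
        omega
    _ = (F \ J).card • (N - J.card) := by rw [h1]
    _ ≤ ∑ i ∈ F \ J, (i.rev : ℕ) := by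
        refine Finset.card_nsmul_le_sum _ _ _ fun i hi => ?_
        simp only [hF, firstFin, Finset.mem_sdiff, Finset.mem_filter, Finset.mem_univ,
          true_and] at hi
        rw [Fin.val_rev]
        omega

end Majorization

/-! ### Alternants -/

section Alternants

open MvPolynomial

variable {N d : ℕ}

/-- The alternant `det (x_i ^ μ_j)`. -/
def alternant (μ : Fin N → ℕ) : MvPolynomial (Fin N) ℂ :=
  Matrix.det (Matrix.of fun i j : Fin N => (X i : MvPolynomial (Fin N) ℂ) ^ μ j)

/-- The exponent vector of a function. -/
abbrev toExp (μ : Fin N → ℕ) : Fin N →₀ ℕ := Finsupp.equivFunOnFinite.symm μ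

theorem monomial_toExp (μ : Fin N → ℕ) :
    (monomial (toExp μ) 1 : MvPolynomial (Fin N) ℂ) = ∏ i, X i ^ μ i := by
  rw [monomial_eq, C_1, one_mul, Finsupp.prod_fintype]
  · rfl
  · simp

theorem alternant_eq_sum (μ : Fin N → ℕ) :
    alternant μ = ∑ w : Equiv.Perm (Fin N), csign w • monomial (toExp (μ ∘ w)) (1 : ℂ) := by
  rw [alternant, ← Matrix.det_transpose, Matrix.det_apply']
  refine Finset.sum_congr rfl fun w _ => ?_
  rw [monomial_toExp, smul_eq_C_mul]
  simp [csign]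

/-- The product `∏_{i<j} (x_i - x_j)`. -/
def vand (N : ℕ) : MvPolynomial (Fin N) ℂ := ∏ p ∈ posRoots N, (X p.1 - X p.2)

theorem prod_posRoots {M : Type*} [CommMonoid M] (f : Fin N → Fin N → M) :
    ∏ p ∈ posRoots N, f p.1 p.2 = ∏ i, ∏ j ∈ Finset.Ioi i, f i j := by
  rw [posRoots, Finset.prod_filter, Fintype.prod_prod_type]
  refine Finset.prod_congr rfl fun i _ => ?_
  rw [← Finset.prod_filter]
  congr 1
  ext j
  simp

/-- The Vandermonde determinant; with the exponents decreasing along the columns there is no sign.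
-/
theorem vand_eq_alternant : vand N = alternant fun j => (j.rev : ℕ) := by
  have h := Matrix.det_projVandermonde (fun _ => 1) (fun i : Fin N => (X i : MvPolynomial (Fin N) ℂ))
  rw [vand, prod_posRoots fun i j => (X i - X j : MvPolynomial (Fin N) ℂ), alternant]
  simp only [one_mul] at h
  rw [← h]
  congr 1
  ext1 i j
  simp [Matrix.projVandermonde_apply]

/-- All exponents of the alternant are permutations of (N - 1, …, 0), hence have the same norm. -/
theorem eulerSq_vand :
    eulerSq (vand N) = (∑ i : Fin N, ((i.rev : ℕ) : ℂ) ^ 2) • vand N := by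
  rw [vand_eq_alternant, alternant_eq_sum, map_sum, Finset.smul_sum]
  refine Finset.sum_congr rfl fun w _ => ?_
  rw [map_smul, eulerSq_monomial, smul_comm]
  congr 1
  exact Equiv.sum_comp w fun i => ((i.rev : ℕ) : ℂ) ^ 2

/-- The power sum functional on the group algebra. -/
def powerFunctional (N d : ℕ) :
    MonoidAlgebra ℂ (Equiv.Perm (Fin d)) →ₗ[ℂ] MvPolynomial (Fin N) ℂ :=
  linExt (permPoly N)

/-- The eigenvalue shift in the cut-and-join equation. -/
def cutJoinConst (N d : ℕ) : ℂ := ∑ i : Fin N, ((i.rev : ℕ) : ℂ) ^ 2 + (2 * N - 1) * d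

theorem two_smul_powerFunctional (σ : Equiv.Perm (Fin d)) :
    (2 : ℂ) • powerFunctional N d (transpSum d * ofPerm σ) + (d : ℂ) • permPoly N σ =
      ∑ k, ∑ l, permPoly N (Equiv.swap k l * σ) := by
  have h := two_smul_sum_transpositions (d := d) fun t => permPoly N (t * σ)
  have h1 : powerFunctional N d (transpSum d * ofPerm σ) =
      ∑ t ∈ transpositions d, permPoly N (t * σ) := by
    rw [transpSum, Finset.sum_mul, map_sum]
    refine Finset.sum_congr rfl fun t _ => ?_
    rw [ofPerm, ofPerm, ← map_mul, powerFunctional, linExt_of]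
  rw [h1, two_smul, ← two_nsmul, h, ← Fintype.sum_prod_type',
    ← Finset.sum_filter_add_sum_filter_not Finset.univ (fun p : Fin d × Fin d => p.1 ≠ p.2)]
  congr 1
  rw [Finset.sum_filter, Fintype.sum_prod_type]
  have : ∀ k : Fin d, ∑ l, (if ¬ (k, l).1 ≠ (k, l).2 then
      permPoly N (Equiv.swap (k, l).1 (k, l).2 * σ) else 0) = permPoly N σ := by
    intro k
    rw [Finset.sum_eq_single k]
    · simp only [ne_eq, not_true, not_false_iff, if_true, Equiv.swap_self]
      congr 1
    · intro l _ hl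
      simp [hl.symm]
    · simp
  rw [Finset.sum_congr rfl fun k _ => this k]
  simp [Nat.cast_smul_eq_nsmul]

/-- The cut-and-join equation. -/
theorem eulerSq_vand_mul (y : MonoidAlgebra ℂ (Equiv.Perm (Fin d))) :
    eulerSq (vand N * powerFunctional N d y) =
      vand N * ((2 : ℂ) • powerFunctional N d (transpSum d * y) +
        cutJoinConst N d • powerFunctional N d y) := by
  have key : ∀ σ : Equiv.Perm (Fin d), eulerSq (vand N * powerFunctional N d (ofPerm σ)) =
      vand N * ((2 : ℂ) • powerFunctional N d (transpSum d * ofPerm σ) +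
        cutJoinConst N d • powerFunctional N d (ofPerm σ)) := by
    intro σ
    have hP : powerFunctional N d (ofPerm σ) = permPoly N σ := linExt_of _ _
    have h2 := two_smul_powerFunctional (N := N) σ
    rw [sum_permPoly_swap, sum_ne_eq_two_mul _ fun i j => joinPoly_comm σ i j] at h2
    have h3 := sum_euler_prod_mul (posRoots N) (permPoly N σ)
      (fun p => euler p.1 (permPoly N σ) + euler p.2 (permPoly N σ) + joinPoly σ p.1 p.2)
      fun p hp => euler_sub_eq σ (ne_of_lt (by simpa [posRoots] using hp))
    rw [Finset.sum_add_distrib, sum_posRoots_add (fun i => euler i (permPoly N σ)),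
      sum_euler_permPoly] at h3
    rw [hP, eulerSq_mul, eulerSq_vand]
    change _ + 2 * ∑ i, euler i (vand N) * euler i (permPoly N σ) + _ = _
    have h3' : ∑ i, euler i (vand N) * euler i (permPoly N σ) = _ := h3
    -- In the second-order Leibniz rule the `joinPoly` terms of the cross term and of `eulerSq
    -- (permPoly N σ)` cancel. The multiples of d left over, 2(N - 1) d and d, form the second term
    -- of `cutJoinConst`.
    have h4 : eulerSq (permPoly N σ) =
        (2 : ℂ) • powerFunctional N d (transpSum d * ofPerm σ) + (d : ℂ) • permPoly N σ -
          2 * ∑ p ∈ posRoots N, joinPoly σ p.1 p.2 := by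
      rw [h2]; ring
    rw [h3', h4, cutJoinConst]
    change _ + 2 * (vand N * _) + _ = _
    simp only [smul_eq_C_mul, map_add, map_mul, map_sub, map_natCast, map_one, map_ofNat]
    ring
  rw [eq_sum_coeff_of y]
  simp only [map_sum, map_smul, Finset.mul_sum, mul_smul_comm, Finset.smul_sum,
    ← Finset.sum_add_distrib]
  refine Finset.sum_congr rfl fun σ _ => ?_
  rw [key σ, smul_comm (2 : ℂ), smul_comm (cutJoinConst N d), ← smul_add, ← mul_smul_comm]

end Alternants

/-! ### The characteristic of the Specht module is a Schur function -/

section Frobenius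

open MvPolynomial

variable {N d : ℕ} {ν : Nat.Partition d}

theorem coeff_permPoly (σ : Equiv.Perm (Fin d)) (s : Fin N →₀ ℕ) :
    coeff s (permPoly N σ) =
      ∑ W : Fin d → Fin N with wordContent W = s, if W ∘ σ = W then (1 : ℂ) else 0 := by
  rw [permPoly, coeff_sum, Finset.sum_filter, Finset.sum_filter]
  refine Finset.sum_congr rfl fun W _ => ?_
  rw [wordMon_eq_monomial, coeff_monomial]
  by_cases h1 : W ∘ σ = W <;> by_cases h2 : wordContent W = s <;> simp [h1, h2]

theorem powerFunctional_youngSymmetrizer :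
    powerFunctional N d (youngSymmetrizer ν) =
      ∑ p ∈ rowGroup ν, ∑ q ∈ colGroup ν, csign q • permPoly N (p * q) := by
  rw [youngSymmetrizer_eq_sum]
  simp only [map_sum, map_smul, powerFunctional, ofPerm, linExt_of]

theorem coeff_powerFunctional (s : Fin N →₀ ℕ) :
    coeff s (powerFunctional N d (youngSymmetrizer ν)) =
      ∑ p ∈ rowGroup ν, ∑ W : Fin d → Fin N with wordContent W = s, ∑ q ∈ colGroup ν,
        csign q * if (W ∘ p) ∘ q = W then 1 else 0 := by
  rw [powerFunctional_youngSymmetrizer, coeff_sum]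
  refine Finset.sum_congr rfl fun p _ => ?_
  rw [coeff_sum, Finset.sum_comm]
  refine Finset.sum_congr rfl fun q _ => ?_
  rw [coeff_smul, coeff_permPoly, smul_eq_mul, Finset.mul_sum]
  rfl

/-- Swapping two equal letters of a column does not change V, but it reverses the sign of q. -/
theorem sum_colGroup_eq_zero {α : Type*} [DecidableEq α] {V W : Fin d → α}
    (hV : ¬ ColInjective ν V) :
    ∑ q ∈ colGroup ν, csign q * (if V ∘ q = W then 1 else 0) = 0 := by
  simp only [ColInjective, not_forall] at hV
  obtain ⟨k, l, hc, hr, hne⟩ := hV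
  have ht : Equiv.swap k l ∈ colGroup ν := swap_mem_colGroup.mpr hc
  have hVt : V ∘ Equiv.swap k l = V := by
    funext m
    simp only [Function.comp_apply, Equiv.swap_apply_def]
    split_ifs with h1 h2
    · rw [h1, hr]
    · rw [h2, hr]
    · rfl
  have h : ∑ q ∈ colGroup ν, csign q * (if V ∘ q = W then 1 else 0) =
      ∑ q ∈ colGroup ν, -(csign q * (if V ∘ q = W then 1 else 0)) := by
    refine Finset.sum_equiv (Equiv.mulLeft (Equiv.swap k l)) (fun q => ?_) (fun q _ => ?_)
    · refine ⟨fun h => mul_mem_colGroup ht h, fun h => ?_⟩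
      simpa using mul_mem_colGroup ht h
    · have : V ∘ (Equiv.swap k l * q : Equiv.Perm (Fin d)) = V ∘ q := by
        rw [Equiv.Perm.coe_mul, ← Function.comp_assoc, hVt]
      rw [Equiv.coe_mulLeft, csign_mul, csign_swap hne, this]
      ring
  rw [Finset.sum_neg_distrib] at h
  exact self_eq_neg.mp h

theorem wordContent_comp (W : Fin d → Fin N) (g : Equiv.Perm (Fin d)) :
    wordContent (W ∘ g) = wordContent W :=
  Equiv.sum_comp g fun k => Finsupp.single (W k) 1

theorem sum_wordContent (W : Fin d → Fin N) (I : Finset (Fin N)) :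
    ∑ i ∈ I, wordContent W i = (Finset.univ.filter fun k => W k ∈ I).card := by
  rw [Finset.card_eq_sum_card_fiberwise (f := W) (t := I) (fun k hk => by simpa using hk)]
  refine Finset.sum_congr rfl fun i hi => ?_
  rw [wordContent_apply, Finset.filter_filter]
  congr 1
  ext k
  simp only [Finset.mem_filter, Finset.mem_univ, true_and]
  exact ⟨fun h => ⟨h ▸ hi, h⟩, fun h => h.2⟩

/-- The exponents occurring in the characteristic of the Specht module are dominated by `ν`. -/
theorem dominance_of_coeff_ne_zero {s : Fin N →₀ ℕ}
    (h : coeff s (powerFunctional N d (youngSymmetrizer ν)) ≠ 0) :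
    (∑ i, s i = d) ∧ ∀ I : Finset (Fin N), ∑ i ∈ I, s i ≤ ∑ j ∈ Finset.range I.card, rowLen ν j := by
  rw [coeff_powerFunctional] at h
  obtain ⟨p, -, hp⟩ := Finset.exists_ne_zero_of_sum_ne_zero h
  obtain ⟨W, hW, hq⟩ := Finset.exists_ne_zero_of_sum_ne_zero hp
  have hW' : wordContent W = s := (Finset.mem_filter.mp hW).2
  have hV : ColInjective ν (W ∘ p) := by
    by_contra hV
    exact hq (sum_colGroup_eq_zero hV)
  rw [← hW', ← wordContent_comp W p]
  refine ⟨?_, fun I => ?_⟩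
  · rw [sum_wordContent]
    simp
  · rw [sum_wordContent, ← card_row_lt]
    exact hV.card_le I

/-- Relabelling the letters commutes with permuting the positions, so the polynomial is symmetric.
-/
theorem coeff_comp_perm (s : Fin N → ℕ) (u : Equiv.Perm (Fin N)) :
    coeff (toExp (s ∘ u)) (powerFunctional N d (youngSymmetrizer ν)) =
      coeff (toExp s) (powerFunctional N d (youngSymmetrizer ν)) := by
  rw [coeff_powerFunctional, coeff_powerFunctional]
  refine Finset.sum_congr rfl fun p _ => ?_
  refine Finset.sum_equiv (Equiv.arrowCongr (Equiv.refl (Fin d)) u) (fun W => ?_) (fun W _ => ?_)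
  · have e : (Equiv.arrowCongr (Equiv.refl (Fin d)) u) W = u ∘ W := rfl
    have hc : ∀ i, wordContent (u ∘ W) (u i) = wordContent W i := by
      intro i
      rw [wordContent_apply, wordContent_apply]
      simp
    simp only [Finset.mem_filter, Finset.mem_univ, true_and, e]
    constructor
    · intro h
      ext i
      obtain ⟨i, rfl⟩ := u.surjective i
      rw [hc, h]
      rfl
    · intro h
      ext i
      rw [← hc, h]
      rfl
  · have e : (Equiv.arrowCongr (Equiv.refl (Fin d)) u) W = u ∘ W := rfl
    rw [e]
    refine Finset.sum_congr rfl fun q _ => ?_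
    have : ((u ∘ W) ∘ p) ∘ q = u ∘ W ↔ (W ∘ p) ∘ q = W := by
      rw [Function.comp_assoc, Function.comp_assoc, ← Function.comp_assoc W]
      exact u.injective.comp_left.eq_iff
    simp only [this]

/-- The row filling with values in `Fin N`. -/
def rowWord (ν : Nat.Partition d) (hN : (rowLens ν).length ≤ N) (k : Fin d) : Fin N :=
  ⟨row ν k, (tableau ν k).1.2.trans_le hN⟩

/-! ### The coefficient at the shape itself -/

theorem coeff_one_rowSym_mul (y : MonoidAlgebra ℂ (Equiv.Perm (Fin d))) :
    (rowSym ν * y).coeff 1 = linExt (fun g => if g ∈ rowGroup ν then (1 : ℂ) else 0) y := by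
  have key : ∀ g : Equiv.Perm (Fin d),
      (rowSym ν * ofPerm g).coeff 1 = if g ∈ rowGroup ν then (1 : ℂ) else 0 := by
    intro g
    rw [rowSym, Finset.sum_mul, MonoidAlgebra.coeff_sum, Finsupp.coe_finsetSum, Finset.sum_apply]
    have : ∀ p : Equiv.Perm (Fin d), (ofPerm p * ofPerm g).coeff 1 = if p = g⁻¹ then 1 else 0 := by
      intro p
      rw [ofPerm, ofPerm, ← map_mul, coeff_of]
      simp only [mul_eq_one_iff_eq_inv]
    simp only [this, Finset.sum_ite_eq']
    have hiff : g⁻¹ ∈ rowGroup ν ↔ g ∈ rowGroup ν :=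
      ⟨fun h => by simpa using inv_mem_rowGroup h, inv_mem_rowGroup⟩
    simp only [hiff]
  rw [eq_sum_coeff_of y]
  simp only [Finset.mul_sum, mul_smul_comm, map_sum, map_smul, MonoidAlgebra.coeff_sum,
    Finsupp.coe_finsetSum, Finset.sum_apply, MonoidAlgebra.coeff_smul_apply]
  refine Finset.sum_congr rfl fun g _ => ?_
  rw [key, linExt_of]

theorem hookScalar_eq_sum : hookScalar ν = ∑ p ∈ rowGroup ν, ∑ q₁ ∈ colGroup ν,
    ∑ q₂ ∈ colGroup ν, csign q₁ * csign q₂ * if q₁ * p * q₂ ∈ rowGroup ν then 1 else 0 := by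
  have h : youngSymmetrizer ν * youngSymmetrizer ν =
      rowSym ν * ∑ p ∈ rowGroup ν, ∑ q₁ ∈ colGroup ν, ∑ q₂ ∈ colGroup ν,
        (csign q₁ * csign q₂) • ofPerm (q₁ * p * q₂) := by
    conv_lhs => lhs; rw [youngSymmetrizer_eq]
    rw [mul_assoc, youngSymmetrizer_eq_sum, colAnti, Finset.sum_mul]
    congr 1
    refine Eq.trans ?_ Finset.sum_comm
    refine Finset.sum_congr rfl fun q₁ _ => ?_
    rw [Finset.mul_sum]
    refine Finset.sum_congr rfl fun p _ => ?_
    rw [Finset.mul_sum]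
    refine Finset.sum_congr rfl fun q₂ _ => ?_
    rw [smul_mul_smul_comm, ofPerm, ofPerm, ← map_mul, mul_assoc]
  rw [hookScalar, h, coeff_one_rowSym_mul]
  simp only [map_sum, map_smul, ofPerm, linExt_of, smul_eq_mul]

/-- Column-injective words of content ν are the row filling r with its columns permuted. Summing
over these permutations gives the signed count of products q₁ p q₂ in the row group, which is also
the coefficient at 1 of c². -/
theorem coeff_shape (hN : (rowLens ν).length ≤ N) :
    coeff (toExp fun i : Fin N => rowLen ν i) (powerFunctional N d (youngSymmetrizer ν)) =
      hookScalar ν := by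
  rw [coeff_powerFunctional, hookScalar_eq_sum]
  refine Finset.sum_congr rfl fun p hp => ?_
  set r := rowWord ν hN with hr
  have hrow : ∀ σ : Equiv.Perm (Fin d), r ∘ σ = r ↔ σ ∈ rowGroup ν := by
    intro σ
    rw [mem_rowGroup, funext_iff]
    exact forall_congr' fun k => Fin.ext_iff
  have hcont : wordContent r = toExp fun i : Fin N => rowLen ν i := by
    ext i
    rw [wordContent_apply]
    change _ = rowLen ν i
    rw [← card_row_eq]
    congr 1
    ext k
    simp [hr, rowWord, Fin.ext_iff]
  -- reindex by the word `V = W ∘ p`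
  have h1 : ∑ W : Fin d → Fin N with wordContent W = toExp fun i : Fin N => rowLen ν i,
      ∑ q ∈ colGroup ν, csign q * (if (W ∘ p) ∘ q = W then (1 : ℂ) else 0) =
      ∑ V : Fin d → Fin N with wordContent V = toExp fun i : Fin N => rowLen ν i,
      ∑ q ∈ colGroup ν, csign q * (if V ∘ q = V ∘ (p⁻¹ : Equiv.Perm (Fin d)) then (1 : ℂ) else 0) := by
    refine Finset.sum_equiv (Equiv.arrowCongr p⁻¹ (Equiv.refl (Fin N))) (fun W => ?_) (fun W _ => ?_)
    · have e : (Equiv.arrowCongr p⁻¹ (Equiv.refl (Fin N))) W = W ∘ p := rfl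
      simp only [Finset.mem_filter, Finset.mem_univ, true_and, e, wordContent_comp]
    · have e : (Equiv.arrowCongr p⁻¹ (Equiv.refl (Fin N))) W = W ∘ p := rfl
      have e2 : (W ∘ p) ∘ (p⁻¹ : Equiv.Perm (Fin d)) = W := by
        funext k
        simp
      rw [e, e2]
  rw [h1]
  -- only the words `r ∘ q₀` contribute
  have h2 : ∑ V : Fin d → Fin N with wordContent V = toExp fun i : Fin N => rowLen ν i,
      ∑ q ∈ colGroup ν, csign q * (if V ∘ q = V ∘ (p⁻¹ : Equiv.Perm (Fin d)) then (1 : ℂ) else 0) =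
      ∑ q₀ ∈ colGroup ν, ∑ q ∈ colGroup ν,
        csign q * (if (r ∘ q₀) ∘ q = (r ∘ q₀) ∘ (p⁻¹ : Equiv.Perm (Fin d)) then (1 : ℂ) else 0) := by
    symm
    rw [← Finset.sum_image (s := colGroup ν) (g := fun q₀ : Equiv.Perm (Fin d) => r ∘ q₀)
      (f := fun V : Fin d → Fin N => ∑ q ∈ colGroup ν,
        csign q * (if V ∘ q = V ∘ (p⁻¹ : Equiv.Perm (Fin d)) then (1 : ℂ) else 0))]
    · refine Finset.sum_subset ?_ ?_
      · intro V hV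
        obtain ⟨q₀, -, rfl⟩ := Finset.mem_image.mp hV
        simp only [Finset.mem_filter, Finset.mem_univ, true_and]
        rw [wordContent_comp, hcont]
      · intro V hV hV'
        by_contra hne
        have hinj : ColInjective ν V := by
          by_contra hinj
          exact hne (sum_colGroup_eq_zero hinj)
        have hinj' : ColInjective ν fun k => (V k : ℕ) := fun k l hc hv =>
          hinj k l hc (Fin.ext hv)
        have hVc : wordContent V = toExp fun i : Fin N => rowLen ν i := (Finset.mem_filter.mp hV).2
        obtain ⟨q, hq, h⟩ := hinj'.exists_perm fun i => by
          by_cases hi : i < N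
          · have := DFunLike.congr_fun hVc ⟨i, hi⟩
            rw [wordContent_apply] at this
            change _ = rowLen ν i at this
            rw [← this]
            congr 1
            ext k
            simp [Fin.ext_iff]
          · rw [rowLen_of_le ν (hN.trans (not_lt.mp hi)), Finset.card_eq_zero,
              Finset.filter_eq_empty_iff]
            intro k _ hk
            exact hi (hk ▸ (V k).2)
        refine hV' (Finset.mem_image.mpr ⟨q⁻¹, inv_mem_colGroup hq, ?_⟩)
        funext k
        apply Fin.ext
        change row ν (q⁻¹ k) = V k
        rw [← h]
        simp
    · intro q₀ h0 q₁ h1 h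
      have h' : r ∘ (q₀ * q₁⁻¹ : Equiv.Perm (Fin d)) = r := by
        funext k
        have := congrFun h (q₁⁻¹ k)
        simpa using this
      have := eq_one_of_mem_row_col ((hrow _).mp h') (mul_mem_colGroup h0 (inv_mem_colGroup h1))
      exact mul_inv_eq_one.mp this
  rw [h2]
  -- Row-filling words agree exactly when the permutations differ by the row group; the substitution
  -- is q₁ = q₀ q.
  have h3 : ∀ q₀ ∈ colGroup ν, ∑ q ∈ colGroup ν,
        csign q * (if (r ∘ q₀) ∘ q = (r ∘ q₀) ∘ (p⁻¹ : Equiv.Perm (Fin d)) then (1 : ℂ) else 0) =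
      ∑ q₁ ∈ colGroup ν, csign q₁ * csign q₀⁻¹ *
        if q₁ * p * q₀⁻¹ ∈ rowGroup ν then (1 : ℂ) else 0 := by
    intro q₀ h0
    refine Finset.sum_equiv (Equiv.mulLeft q₀) (fun q => ?_) (fun q _ => ?_)
    · refine ⟨fun h => mul_mem_colGroup h0 h, fun h => ?_⟩
      simpa using mul_mem_colGroup (inv_mem_colGroup h0) h
    · have hiff : (r ∘ q₀) ∘ q = (r ∘ q₀) ∘ (p⁻¹ : Equiv.Perm (Fin d)) ↔
          q₀ * q * p * q₀⁻¹ ∈ rowGroup ν := by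
        rw [← hrow]
        constructor
        · intro h
          funext k
          have := congrFun h (p (q₀⁻¹ k))
          simpa using this
        · intro h
          funext k
          have := congrFun h (q₀ (p⁻¹ k))
          simpa using this
      simp only [hiff, Equiv.coe_mulLeft, csign_mul, csign_inv]
      congr 1
      linear_combination -(csign q) * csign_mul_self q₀
  rw [Finset.sum_congr rfl h3, Finset.sum_comm]
  refine Finset.sum_congr rfl fun q₁ _ => ?_
  refine Finset.sum_equiv (Equiv.inv _) (fun q => ?_) (fun q _ => rfl)
  exact ⟨fun h => inv_mem_colGroup h, fun h => by simpa using inv_mem_colGroup h⟩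

theorem coeff_vand_mul (f : MvPolynomial (Fin N) ℂ) (s : Fin N →₀ ℕ) :
    coeff s (vand N * f) = ∑ w : Equiv.Perm (Fin N), csign w *
      if (toExp fun i => ((w i).rev : ℕ)) ≤ s then
        coeff (s - toExp fun i => ((w i).rev : ℕ)) f else 0 := by
  rw [vand_eq_alternant, alternant_eq_sum, Finset.sum_mul, coeff_sum]
  refine Finset.sum_congr rfl fun w _ => ?_
  rw [smul_mul_assoc, coeff_smul, coeff_monomial_mul', smul_eq_mul, one_mul]
  rfl

/-- The exponents `ν_i + N - 1 - i`. -/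
def shiftedShape (N : ℕ) (ν : Nat.Partition d) (i : Fin N) : ℕ := rowLen ν i + (i.rev : ℕ)

theorem shiftedShape_strictAnti : StrictAnti (shiftedShape N ν) := by
  intro i j hij
  have h1 : rowLen ν j ≤ rowLen ν i := rowLen_antitone ν (show (i : ℕ) ≤ j from hij.le)
  have h2 : (i : ℕ) < j := hij
  simp only [shiftedShape, Fin.val_rev]
  have := j.2
  omega

theorem sum_firstFin_comp_perm (s : Fin N → ℕ) (u : Equiv.Perm (Fin N)) (m : ℕ) :
    ∑ i ∈ firstFin N m, s (u i) = ∑ i ∈ (firstFin N m).map u.toEmbedding, s i := by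
  rw [Finset.sum_map]
  rfl

/-- The eigenvalue given by the cut-and-join equation on c is exactly the squared norm of ν + δ. -/
theorem sum_sq_shiftedShape (hN : (rowLens ν).length ≤ N) :
    ∑ i, (shiftedShape N ν i : ℂ) ^ 2 = 2 * contentSum ν + cutJoinConst N d := by
  have h1 : ∑ i : Fin N, (rowLen ν i : ℂ) = d := by
    have h := sum_firstFin (le_refl N) (rowLen ν)
    rw [firstFin_self, sum_rowLen N hN] at h
    exact_mod_cast h
  have h2 : ((Finset.univ.filter fun p : Fin d × Fin d => row ν p.1 = row ν p.2).card : ℂ) =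
      ∑ i : Fin N, (rowLen ν i : ℂ) ^ 2 := by
    have h := sum_firstFin (le_refl N) fun i => rowLen ν i ^ 2
    rw [firstFin_self, ← card_row_pairs N hN] at h
    exact_mod_cast h.symm
  have h3 : ((∑ k, row ν k : ℕ) : ℂ) = ∑ i : Fin N, (i : ℂ) * rowLen ν i := by
    have h := sum_firstFin (le_refl N) fun i => i * rowLen ν i
    rw [firstFin_self, ← sum_row_eq N hN] at h
    exact_mod_cast h.symm
  have h4 : ∀ i : Fin N, ((i.rev : ℕ) : ℂ) = N - 1 - i := by
    intro i
    rw [Fin.val_rev, Nat.cast_sub (by omega)]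
    push_cast
    ring
  rw [contentSum, h2, h3, cutJoinConst]
  have h5 : ∑ i, (shiftedShape N ν i : ℂ) ^ 2 = ∑ i : Fin N, (rowLen ν i : ℂ) ^ 2 +
      2 * (N - 1) * ∑ i : Fin N, (rowLen ν i : ℂ) - 2 * ∑ i : Fin N, (i : ℂ) * rowLen ν i +
      ∑ i : Fin N, ((i.rev : ℕ) : ℂ) ^ 2 := by
    rw [Finset.mul_sum, Finset.mul_sum, ← Finset.sum_add_distrib, ← Finset.sum_sub_distrib,
      ← Finset.sum_add_distrib]
    refine Finset.sum_congr rfl fun i _ => ?_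
    rw [shiftedShape]
    push_cast
    rw [h4]
    ring
  rw [h5, h1]
  ring

/-- A nonzero coefficient of `vand * f_ν` sits at a permutation of `ν + δ`. -/
theorem exists_perm_of_coeff_ne_zero (hN : (rowLens ν).length ≤ N) {s : Fin N →₀ ℕ}
    (h : coeff s (vand N * powerFunctional N d (youngSymmetrizer ν)) ≠ 0) :
    ∃ u : Equiv.Perm (Fin N), s = toExp (shiftedShape N ν ∘ u) := by
  -- the eigenvalue equation
  have heig := congrArg (coeff s) (eulerSq_vand_mul (N := N) (youngSymmetrizer ν))
  rw [transpSum_mul_youngSymmetrizer, map_smul, smul_smul, ← add_smul, mul_smul_comm, coeff_smul,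
    coeff_eulerSq, ← sum_sq_shiftedShape hN, smul_eq_mul] at heig
  have hsq : ∑ i, (s i : ℂ) ^ 2 = ∑ i, (shiftedShape N ν i : ℂ) ^ 2 := mul_right_cancel₀ h heig
  have hsq' : ∑ i, (s i : ℤ) ^ 2 = ∑ i, (shiftedShape N ν i : ℤ) ^ 2 := by exact_mod_cast hsq
  -- dominance
  rw [coeff_vand_mul] at h
  obtain ⟨w, -, hw⟩ := Finset.exists_ne_zero_of_sum_ne_zero h
  have hle : (toExp fun i => ((w i).rev : ℕ)) ≤ s := by
    by_contra hle
    rw [if_neg hle, mul_zero] at hw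
    exact hw rfl
  rw [if_pos hle] at hw
  obtain ⟨htot, hdom⟩ := dominance_of_coeff_ne_zero (right_ne_zero_of_mul hw)
  have hle' : ∀ i, ((w i).rev : ℕ) ≤ s i := fun i => hle i
  have hsplit : ∀ I : Finset (Fin N), ∑ i ∈ I, s i =
      ∑ i ∈ I, (s - toExp fun i => ((w i).rev : ℕ)) i + ∑ i ∈ I, ((w i).rev : ℕ) := by
    intro I
    rw [← Finset.sum_add_distrib]
    refine Finset.sum_congr rfl fun i _ => ?_
    have := hle' i
    change s i = (s i - ((w i).rev : ℕ)) + _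
    omega
  -- The exponent splits into one from the Schur factor, dominated by ν, and a permutation of δ,
  -- whose sums over I are largest on the first positions.
  have hbound : ∀ I : Finset (Fin N),
      ∑ i ∈ I, s i ≤ ∑ i ∈ firstFin N I.card, shiftedShape N ν i := by
    intro I
    have hIc : I.card ≤ N := by simpa using I.card_le_univ
    rw [hsplit I]
    simp only [shiftedShape]
    rw [Finset.sum_add_distrib, sum_firstFin hIc (rowLen ν)]
    refine Nat.add_le_add (hdom I) ?_
    have h' := sum_rev_le (I.map w.toEmbedding)
    rw [Finset.sum_map, Finset.card_map] at h'
    exact h'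
  have htotal : ∑ i, s i = ∑ i, shiftedShape N ν i := by
    rw [hsplit, htot]
    simp only [shiftedShape]
    rw [Finset.sum_add_distrib, ← firstFin_self, sum_firstFin le_rfl (rowLen ν), sum_rowLen N hN,
      firstFin_self, Equiv.sum_comp w fun i : Fin N => (i.rev : ℕ)]
  -- sort the exponents
  obtain ⟨u, hu⟩ : ∃ u : Equiv.Perm (Fin N), Antitone fun i => s (u i) := by
    refine ⟨Tuple.sort fun i => OrderDual.toDual (s i), fun i j hij => ?_⟩
    exact Tuple.monotone_sort (fun i => OrderDual.toDual (s i)) hij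
  have hY : Antitone fun i => (s (u i) : ℤ) := fun i j hij => Int.ofNat_le.mpr (hu hij)
  have hfin := eq_of_majorize (X := fun i => (shiftedShape N ν i : ℤ)) hY ?_ ?_ ?_
  · refine ⟨u⁻¹, ?_⟩
    ext i
    obtain ⟨i, rfl⟩ := u.surjective i
    have := congrFun hfin i
    change s (u i) = shiftedShape N ν (u⁻¹ (u i))
    rw [← Equiv.Perm.mul_apply, inv_mul_cancel, Equiv.Perm.one_apply]
    exact_mod_cast this.symm
  · intro m hm
    have := hbound ((firstFin N m).map u.toEmbedding)
    rw [Finset.card_map, card_firstFin hm, ← sum_firstFin_comp_perm] at this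
    exact_mod_cast this
  · rw [Equiv.sum_comp u fun i => (s i : ℤ)]
    exact_mod_cast htotal.symm
  · rw [Equiv.sum_comp u fun i => (s i : ℤ) ^ 2]
    exact hsq'.symm

/-- Only the monomial w = u of the Vandermonde product contributes: for any other w, the
complementary exponent would violate dominance by ν. The remaining factor is the coefficient at a
permutation of ν, given by symmetry and `coeff_shape`. -/
theorem coeff_vand_mul_shape (hN : (rowLens ν).length ≤ N) (u : Equiv.Perm (Fin N)) :
    coeff (toExp (shiftedShape N ν ∘ u)) (vand N * powerFunctional N d (youngSymmetrizer ν)) =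
      csign u * hookScalar ν := by
  rw [coeff_vand_mul, Finset.sum_eq_single u]
  · have hle : (toExp fun i => ((u i).rev : ℕ)) ≤ toExp (shiftedShape N ν ∘ u) :=
      fun i => Nat.le_add_left _ _
    have hsub : toExp (shiftedShape N ν ∘ u) - (toExp fun i => ((u i).rev : ℕ)) =
        toExp ((fun i : Fin N => rowLen ν i) ∘ u) := by
      ext i
      exact Nat.add_sub_cancel _ _
    rw [if_pos hle, hsub, coeff_comp_perm, coeff_shape hN]
  · intro w _ hwu
    by_contra hne
    have hle : (toExp fun i => ((w i).rev : ℕ)) ≤ toExp (shiftedShape N ν ∘ u) := by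
      by_contra hle
      rw [if_neg hle, mul_zero] at hne
      exact hne rfl
    rw [if_pos hle] at hne
    obtain ⟨-, hdom⟩ := dominance_of_coeff_ne_zero (right_ne_zero_of_mul hne)
    apply hwu
    -- the exponents of the Vandermonde are forced
    have hY : Antitone fun i : Fin N => ((i.rev : ℕ) : ℤ) := fun i j hij =>
      Int.ofNat_le.mpr (Fin.rev_le_rev.mpr hij)
    have hfin := eq_of_majorize (X := fun i => (((w (u⁻¹ i)).rev : ℕ) : ℤ)) hY ?_ ?_ ?_
    · refine Equiv.ext fun i => ?_
      have := congrFun hfin (u i)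
      simp only [← Equiv.Perm.mul_apply, inv_mul_cancel, Equiv.Perm.one_apply] at this
      exact Fin.rev_injective (Fin.ext (by exact_mod_cast this))
    · intro m hm
      have h := hdom ((firstFin N m).map u⁻¹.toEmbedding)
      rw [Finset.card_map, card_firstFin hm, Finset.sum_map, ← sum_firstFin hm] at h
      have h' : ∑ i ∈ firstFin N m, (shiftedShape N ν i - ((w (u⁻¹ i)).rev : ℕ)) ≤
          ∑ i ∈ firstFin N m, rowLen ν i := by
        refine le_trans (le_of_eq ?_) h
        refine Finset.sum_congr rfl fun i _ => ?_
        change _ = shiftedShape N ν (u (u⁻¹ i)) - ((w (u⁻¹ i)).rev : ℕ)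
        rw [show u (u⁻¹ i) = i from u.apply_symm_apply i]
      -- The subtraction is truncated, but only a ≤ (a - b) + b is needed.
      have h'' : ∑ i ∈ firstFin N m, shiftedShape N ν i ≤
          ∑ i ∈ firstFin N m, (rowLen ν i + ((w (u⁻¹ i)).rev : ℕ)) := by
        rw [Finset.sum_add_distrib]
        refine le_trans ?_ (Nat.add_le_add_right h' _)
        rw [← Finset.sum_add_distrib]
        exact Finset.sum_le_sum fun i _ => by omega
      simp only [shiftedShape, Finset.sum_add_distrib] at h''
      have h3 := Nat.le_of_add_le_add_left h''
      exact_mod_cast h3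
    · exact Equiv.sum_comp (w * u⁻¹) fun i : Fin N => ((i.rev : ℕ) : ℤ)
    · exact Equiv.sum_comp (w * u⁻¹) fun i : Fin N => ((i.rev : ℕ) : ℤ) ^ 2
  · simp

/-- The Frobenius formula. -/
theorem vand_mul_powerFunctional (hN : (rowLens ν).length ≤ N) :
    vand N * powerFunctional N d (youngSymmetrizer ν) =
      hookScalar ν • alternant (shiftedShape N ν) := by
  ext s
  rw [coeff_smul, alternant_eq_sum, coeff_sum]
  simp only [coeff_smul, coeff_monomial, smul_eq_mul]
  by_cases hs : ∃ u : Equiv.Perm (Fin N), s = toExp (shiftedShape N ν ∘ u)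
  · obtain ⟨u, rfl⟩ := hs
    rw [coeff_vand_mul_shape hN, Finset.sum_eq_single u]
    · simp [mul_comm]
    · intro w _ hw
      rw [if_neg, mul_zero]
      intro h
      apply hw
      refine Equiv.ext fun i => (shiftedShape_strictAnti (ν := ν)).injective ?_
      exact DFunLike.congr_fun h i
    · simp
  · rw [Finset.sum_eq_zero, mul_zero]
    · by_contra h
      exact hs (exists_perm_of_coeff_ne_zero hN h)
    · intro w _
      rw [if_neg, mul_zero]
      exact fun h => hs ⟨w, h.symm⟩

/-- The value at `x` of the power sum attached to `σ`. -/
def wordSum (x : Fin N → ℂ) (σ : Equiv.Perm (Fin d)) : ℂ :=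
  ∑ W : Fin d → Fin N with W ∘ σ = W, ∏ k, x (W k)

theorem eval_permPoly (x : Fin N → ℂ) (σ : Equiv.Perm (Fin d)) :
    eval x (permPoly N σ) = wordSum x σ := by
  simp [permPoly, wordSum, wordMon]

/-- The polynomial Frobenius formula and the averaging identity `sum_chi_smul` share the factor
`hookScalar`, which is nonzero and cancels after evaluation at x. -/
theorem det_pow_eq (hN : (rowLens ν).length ≤ N) (x : Fin N → ℂ) :
    Matrix.det (Matrix.of fun i j : Fin N => x i ^ shiftedShape N ν j) =
      (∏ p ∈ posRoots N, (x p.1 - x p.2)) *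
        ((d.factorial : ℂ)⁻¹ * ∑ σ, chi ν σ * wordSum x σ) := by
  have h1 := congrArg (eval x) (sum_chi_smul ν (permPoly N)
    (fun σ g => permPoly_conj σ g) permPoly_inv)
  have h2 := congrArg (eval x) (vand_mul_powerFunctional (ν := ν) hN)
  have hvand : eval x (vand N) = ∏ p ∈ posRoots N, (x p.1 - x p.2) := by
    simp [vand, map_prod]
  have halt : eval x (alternant (shiftedShape N ν)) =
      Matrix.det (Matrix.of fun i j : Fin N => x i ^ shiftedShape N ν j) := by
    rw [alternant, RingHom.map_det]
    congr 1
    ext1 i j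
    simp
  rw [map_mul, hvand, smul_eval, halt, powerFunctional] at h2
  rw [smul_eval, smul_eval, map_sum] at h1
  simp only [smul_eval, eval_permPoly] at h1
  have hn := hookScalar_ne_zero ν
  have hf : (d.factorial : ℂ) ≠ 0 := by exact_mod_cast d.factorial_ne_zero
  apply mul_left_cancel₀ hn
  rw [← h2]
  have : eval x (linExt (permPoly N) (youngSymmetrizer ν)) =
      (d.factorial : ℂ)⁻¹ * (hookScalar ν * ∑ σ, chi ν σ * wordSum x σ) := by
    rw [h1, inv_mul_cancel_left₀ hf]
  rw [this]
  ring

end Frobenius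

/-! ### Sums over fixed words as power sums -/

section CyclePowerSums

open Equiv.Perm

variable {α : Type*} [Fintype α]

theorem apply_eq_of_sameCycle {β : Type*} {σ : Equiv.Perm α} {W : α → β} (h : W ∘ σ = W) {k l : α}
    (hkl : σ.SameCycle k l) : W k = W l := by
  obtain ⟨n, -, rfl⟩ := hkl.exists_pow_eq'
  have : ∀ n : ℕ, W ((σ ^ n) k) = W k := by
    intro n
    induction n with
    | zero => simp
    | succ n ih =>
      rw [pow_succ', Equiv.Perm.mul_apply]
      exact (congrFun h _).trans ih
  exact (this n).symm

variable [DecidableEq α]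

-- Orbits inside the support correspond to the cycle factors and give `cycleType`; orbits outside it
-- are single fixed points and give the parts equal to 1.
open Classical in
theorem prod_cycles_eq {M : Type*} [CommMonoid M] (σ : Equiv.Perm α) (g : ℕ → M) :
    ∏ o : Quotient (SameCycle.setoid σ),
        g (Finset.univ.filter fun k : α => (Quotient.mk (SameCycle.setoid σ) k) = o).card =
      (σ.partition.parts.map g).prod := by
  set mk : α → Quotient (SameCycle.setoid σ) := Quotient.mk (SameCycle.setoid σ) with hmk
  have mk_eq : ∀ k l, mk k = mk l ↔ σ.SameCycle k l := fun k l => Quotient.eq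
  rw [parts_partition, Multiset.map_add, Multiset.prod_add, Multiset.map_replicate,
    Multiset.prod_replicate, cycleType_def, Multiset.map_map,
    ← Finset.prod_filter_mul_prod_filter_not Finset.univ (fun o => o ∈ σ.support.image mk)]
  congr 1
  · change _ = ∏ c ∈ σ.cycleFactorsFinset, g c.support.card
    symm
    let F : Quotient (SameCycle.setoid σ) → Equiv.Perm α :=
      Quotient.lift (fun k => σ.cycleOf k) fun k l h => SameCycle.cycleOf_eq h
    have hF : ∀ k, F (mk k) = σ.cycleOf k := fun _ => rfl
    have hcard : ∀ k ∈ σ.support, (Finset.univ.filter fun l => mk l = mk k).card =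
        (σ.cycleOf k).support.card := by
      intro k hk
      congr 1
      ext l
      rw [mem_support_cycleOf_iff, Finset.mem_filter, mk_eq]
      exact ⟨fun h => ⟨h.2.symm, hk⟩, fun h => ⟨Finset.mem_univ _, h.1.symm⟩⟩
    refine (Finset.prod_bij (fun o _ => F o) ?_ ?_ ?_ ?_).symm
    · intro o ho
      obtain ⟨k, hk, rfl⟩ := Finset.mem_image.mp (Finset.mem_filter.mp ho).2
      exact cycleOf_mem_cycleFactorsFinset_iff.mpr hk
    · intro o ho o' ho' h
      obtain ⟨k, hk, rfl⟩ := Finset.mem_image.mp (Finset.mem_filter.mp ho).2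
      obtain ⟨l, hl, rfl⟩ := Finset.mem_image.mp (Finset.mem_filter.mp ho').2
      rw [hF, hF] at h
      rw [mk_eq]
      have : l ∈ (σ.cycleOf k).support := by
        rw [h, mem_support_cycleOf_iff]
        exact ⟨SameCycle.refl _ _, hl⟩
      exact (mem_support_cycleOf_iff.mp this).1
    · intro c hc
      obtain ⟨k, hk⟩ := (mem_cycleFactorsFinset_iff.mp hc).1.nonempty_support
      have hk' : k ∈ σ.support := mem_cycleFactorsFinset_support_le hc hk
      exact ⟨mk k, by simpa using ⟨k, by simpa using hk', rfl⟩, (cycle_is_cycleOf hk hc).symm⟩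
    · intro o ho
      obtain ⟨k, hk, rfl⟩ := Finset.mem_image.mp (Finset.mem_filter.mp ho).2
      rw [hcard k hk, hF]
  · have hsub : (Finset.univ.filter fun o => ¬ o ∈ σ.support.image mk) =
        (σ.supportᶜ).image mk := by
      ext o
      obtain ⟨k, rfl⟩ := Quotient.exists_rep o
      change (mk k ∈ _ ↔ mk k ∈ _)
      simp only [Finset.mem_filter, Finset.mem_univ, true_and, Finset.mem_image, Finset.mem_compl,
        not_exists, not_and]
      constructor
      · intro h
        exact ⟨k, fun hk => h k hk rfl, rfl⟩
      · rintro ⟨l, hl, hlk⟩ m hm hmk'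
        have h1 := (mk_eq m l).mp (hmk'.trans hlk.symm)
        exact hl ((SameCycle.mem_support_iff h1).mp hm)
    have hfix : ∀ k, k ∉ σ.support → ∀ l, mk l = mk k → l = k := by
      intro k hk l h
      have h1 := ((mk_eq l k).mp h).symm
      have hk' : Function.IsFixedPt σ k := by simpa [mem_support, Function.IsFixedPt] using hk
      exact ((SameCycle.eq_of_left h1 hk')).symm
    have hone : ∀ o ∈ (σ.supportᶜ).image mk,
        g (Finset.univ.filter fun k => mk k = o).card = g 1 := by
      intro o ho
      obtain ⟨k, hk, rfl⟩ := Finset.mem_image.mp ho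
      have : (Finset.univ.filter fun l => mk l = mk k) = {k} := by
        ext l
        simp only [Finset.mem_filter, Finset.mem_univ, true_and, Finset.mem_singleton]
        exact ⟨fun h => hfix k (Finset.mem_compl.mp hk) l h, fun h => by rw [h]⟩
      rw [this, Finset.card_singleton]
    rw [hsub, Finset.prod_congr rfl hone, Finset.prod_const, Finset.card_image_of_injOn,
      Finset.card_compl]
    intro k hk l hl h
    exact (hfix l (by simpa using hl) k h)

/-- A word fixed by σ is a free choice of one letter per cycle, so the sum factors over the cycles.
-/
theorem sum_fixed_words {N : ℕ} (x : Fin N → ℂ) (σ : Equiv.Perm α) :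
    ∑ W : α → Fin N with W ∘ σ = W, ∏ k, x (W k) =
      (σ.partition.parts.map fun m => ∑ i : Fin N, x i ^ m).prod := by
  classical
  rw [← prod_cycles_eq σ fun m => ∑ i : Fin N, x i ^ m, Finset.prod_univ_sum,
    Fintype.piFinset_univ]
  symm
  refine Finset.sum_bij (fun f _ => fun k => f (Quotient.mk (SameCycle.setoid σ) k)) ?_ ?_ ?_ ?_
  · intro f _
    simp only [Finset.mem_filter, Finset.mem_univ, true_and]
    funext k
    change f _ = f _
    congr 1
    refine Quotient.sound ?_
    exact sameCycle_apply_left.mpr (SameCycle.refl _ _)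
  · intro f _ f' _ h
    funext o
    obtain ⟨k, rfl⟩ := Quotient.exists_rep o
    exact congrFun h k
  · intro W hW
    have hW' := (Finset.mem_filter.mp hW).2
    exact ⟨Quotient.lift W fun k l h => apply_eq_of_sameCycle hW' h, Finset.mem_univ _, rfl⟩
  · intro f _
    rw [← Finset.prod_fiberwise Finset.univ (fun k => Quotient.mk (SameCycle.setoid σ) k)]
    refine Finset.prod_congr rfl fun o _ => ?_
    rw [← Finset.prod_const]
    exact Finset.prod_congr rfl fun k hk =>
      congrArg (fun o => x (f o)) (Finset.mem_filter.mp hk).2.symm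

theorem chi_conj {d : ℕ} (ν : Nat.Partition d) (σ g : Equiv.Perm (Fin d)) :
    chi ν (g * σ * g⁻¹) = chi ν σ := by
  apply mul_left_cancel₀ (hookScalar_ne_zero ν)
  rw [hookScalar_mul_chi, hookScalar_mul_chi]
  refine Fintype.sum_equiv (Equiv.mulLeft g⁻¹) _ _ fun h => ?_
  simp [mul_assoc]

/-- Permutations are grouped by cycle type. The representative chosen in `chiClass` is immaterial
because χ_ν is a class function. -/
theorem sum_partitions_eq {d N : ℕ} (ν : Nat.Partition d) (x : Fin N → ℂ) :
    ∑ μ : Nat.Partition d, ((conjClass μ).card : ℂ) * chiClass ν μ *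
        (μ.parts.map fun m => ∑ i : Fin N, x i ^ m).prod =
      ∑ σ, chi ν σ * wordSum x σ := by
  classical
  have hpart : ∀ σ : Equiv.Perm (Fin d), ∃ μ : Nat.Partition d, σ.partition.parts = μ.parts := by
    intro σ
    exact ⟨⟨σ.partition.parts, σ.partition.parts_pos, by
      rw [σ.partition.parts_sum, Fintype.card_fin]⟩, rfl⟩
  choose f hf using hpart
  have hmem : ∀ σ μ, σ ∈ conjClass μ ↔ f σ = μ := by
    intro σ μ
    simp only [conjClass, Finset.mem_filter, Finset.mem_univ, true_and]
    rw [hf, Nat.Partition.ext_iff]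
  rw [← Finset.sum_fiberwise Finset.univ f]
  refine Finset.sum_congr rfl fun μ _ => ?_
  have hfilter : (Finset.univ.filter fun σ => f σ = μ) = conjClass μ := by
    ext σ
    rw [hmem]
    simp
  rw [hfilter, Finset.sum_congr rfl (g := fun _ => chiClass ν μ *
    (μ.parts.map fun m => ∑ i : Fin N, x i ^ m).prod)]
  · rw [Finset.sum_const, nsmul_eq_mul, mul_assoc]
  · intro σ hσ
    have h1 : σ.partition.parts = μ.parts := by simpa [conjClass] using hσ
    have h2 : (conjClass_nonempty μ).choose.partition.parts = μ.parts := by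
      simpa [conjClass] using (conjClass_nonempty μ).choose_spec
    have hc : IsConj (conjClass_nonempty μ).choose σ :=
      partition_eq_of_isConj.mpr (Nat.Partition.ext (h2.trans h1.symm))
    obtain ⟨g, hg⟩ := isConj_iff.mp hc
    rw [wordSum, sum_fixed_words, h1, chiClass, ← hg, chi_conj]

end CyclePowerSums

/-! ### The index of the scaled root lattice -/

section LevelIndex

variable {m : ℕ}

theorem mk_eq_mk_iff {v w : Fin (m + 1) → ℤ} :
    (QuotientAddGroup.mk v : WeightLattice (m + 1)) = QuotientAddGroup.mk w ↔
      ∃ k : ℤ, ∀ i, w i = v i + k := by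
  rw [QuotientAddGroup.eq, AddSubgroup.mem_zmultiples_iff]
  refine exists_congr fun k => ?_
  rw [funext_iff]
  refine forall_congr' fun i => ?_
  simp only [Pi.smul_apply, smul_eq_mul, mul_one, Pi.add_apply, Pi.neg_apply]
  constructor <;> intro h <;> linarith

/-- The sum of the coordinates modulo the rank plus one. -/
def sumMod (m : ℕ) : WeightLattice (m + 1) →+ ZMod (m + 1) :=
  QuotientAddGroup.lift _
    ((Int.castAddHom (ZMod (m + 1))).comp (∑ i, Pi.evalAddMonoidHom (fun _ : Fin (m + 1) => ℤ) i))
    (by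
      rw [AddSubgroup.zmultiples_le]
      simp only [AddMonoidHom.mem_ker, AddMonoidHom.comp_apply, AddMonoidHom.finsetSum_apply,
        Pi.evalAddMonoidHom_apply, Finset.sum_const, Finset.card_univ, Fintype.card_fin,
        Int.coe_castAddHom]
      simp)

theorem sumMod_mk (v : Fin (m + 1) → ℤ) :
    sumMod m (QuotientAddGroup.mk v) = ((∑ i, v i : ℤ) : ZMod (m + 1)) := by
  simp [sumMod]

/-- The coordinate differences modulo `n`. -/
def diffMod (m n : ℕ) : WeightLattice (m + 1) →+ (Fin m → ZMod n) :=
  QuotientAddGroup.lift _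
    (AddMonoidHom.pi fun j : Fin m => (Int.castAddHom (ZMod n)).comp
      (Pi.evalAddMonoidHom (fun _ : Fin (m + 1) => ℤ) j.succ -
        Pi.evalAddMonoidHom (fun _ : Fin (m + 1) => ℤ) 0))
    (by
      rw [AddSubgroup.zmultiples_le]
      ext j
      simp)

theorem diffMod_mk (n : ℕ) (v : Fin (m + 1) → ℤ) (j : Fin m) :
    diffMod m n (QuotientAddGroup.mk v) j = ((v j.succ - v 0 : ℤ) : ZMod n) := by
  simp [diffMod]

theorem mk_mem_rootLattice {v : Fin (m + 1) → ℤ} (hv : ∑ i, v i = 0) :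
    (QuotientAddGroup.mk v : WeightLattice (m + 1)) ∈ rootLattice (m + 1) := by
  have h : v = ∑ i, v i • (Pi.single i (1 : ℤ) - Pi.single 0 (1 : ℤ) : Fin (m + 1) → ℤ) := by
    simp only [smul_sub, Finset.sum_sub_distrib, ← Finset.sum_smul, hv, zero_smul, sub_zero]
    funext j
    simp [Finset.sum_apply, Pi.single_apply]
  have h' : (QuotientAddGroup.mk v : WeightLattice (m + 1)) =
      ∑ i, v i • (QuotientAddGroup.mk (Pi.single i (1 : ℤ) - Pi.single 0 (1 : ℤ)) :
        WeightLattice (m + 1)) := by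
    conv_lhs => rw [h]
    exact map_sum (QuotientAddGroup.mk' _) _ _
  rw [h']
  refine AddSubgroup.sum_mem _ fun i _ => AddSubgroup.zsmul_mem _ ?_ _
  rcases eq_or_ne i 0 with rfl | hi
  · rw [sub_self]
    exact AddSubgroup.zero_mem _
  · exact AddSubgroup.subset_closure ⟨i, 0, hi, rfl⟩

/-- If the coordinate sum is (m + 1) k, subtracting k from every coordinate gives a representative
of sum zero, a combination of the roots e_i - e_0. -/
theorem rootLattice_eq_ker : rootLattice (m + 1) = (sumMod m).ker := by
  apply le_antisymm
  · rw [rootLattice, AddSubgroup.closure_le]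
    rintro x ⟨i, j, -, rfl⟩
    change sumMod m _ = 0
    rw [sumMod_mk]
    simp
  · intro x hx
    obtain ⟨v, rfl⟩ := QuotientAddGroup.mk_surjective x
    rw [AddMonoidHom.mem_ker, sumMod_mk, ZMod.intCast_zmod_eq_zero_iff_dvd] at hx
    obtain ⟨k, hk⟩ := hx
    have : (QuotientAddGroup.mk v : WeightLattice (m + 1)) =
        QuotientAddGroup.mk fun i => v i - k :=
      mk_eq_mk_iff.mpr ⟨-k, fun i => by ring⟩
    rw [this]
    apply mk_mem_rootLattice
    rw [Finset.sum_sub_distrib, hk]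
    simp

theorem index_rootLattice : (rootLattice (m + 1)).index = m + 1 := by
  rw [rootLattice_eq_ker, AddSubgroup.index_ker]
  have : (sumMod m).range = ⊤ := by
    rw [AddMonoidHom.range_eq_top]
    intro z
    refine ⟨QuotientAddGroup.mk (Pi.single 0 (z.val : ℤ)), ?_⟩
    rw [sumMod_mk]
    simp
  rw [this]
  simp

/-- When all coordinates are congruent to v_0 modulo n, v - v_0 (1, …, 1) represents the same weight
and is divisible by n. -/
theorem range_nsmul_eq_ker (n : ℕ) :
    (nsmulAddMonoidHom n : WeightLattice (m + 1) →+ _).range = (diffMod m n).ker := by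
  ext x
  obtain ⟨v, rfl⟩ := QuotientAddGroup.mk_surjective x
  constructor
  · rintro ⟨y, hy⟩
    rw [← hy, nsmulAddMonoidHom_apply, AddMonoidHom.mem_ker, map_nsmul]
    funext j
    simp
  · intro h
    rw [AddMonoidHom.mem_ker] at h
    have hdvd : ∀ i : Fin (m + 1), (n : ℤ) ∣ v i - v 0 := by
      intro i
      rcases Fin.eq_zero_or_eq_succ i with rfl | ⟨j, rfl⟩
      · simp
      · rw [← ZMod.intCast_zmod_eq_zero_iff_dvd, ← diffMod_mk, h]
        rfl
    choose w hw using hdvd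
    refine ⟨QuotientAddGroup.mk w, ?_⟩
    rw [nsmulAddMonoidHom_apply]
    change (QuotientAddGroup.mk (n • w) : WeightLattice (m + 1)) = _
    refine mk_eq_mk_iff.mpr ⟨v 0, fun i => ?_⟩
    simp only [Pi.smul_apply, nsmul_eq_mul]
    rw [← hw]
    ring

theorem index_range_nsmul (n : ℕ) [NeZero n] :
    (nsmulAddMonoidHom n : WeightLattice (m + 1) →+ _).range.index = n ^ m := by
  rw [range_nsmul_eq_ker, AddSubgroup.index_ker]
  have : (diffMod m n).range = ⊤ := by
    rw [AddMonoidHom.range_eq_top]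
    intro z
    refine ⟨QuotientAddGroup.mk (Fin.cons 0 fun j => ((z j).val : ℤ)), ?_⟩
    funext j
    rw [diffMod_mk]
    simp
  rw [this]
  simp

theorem ker_nsmul (n : ℕ) [NeZero n] :
    (nsmulAddMonoidHom n : WeightLattice (m + 1) →+ _).ker = ⊥ := by
  rw [eq_bot_iff]
  intro x hx
  obtain ⟨v, rfl⟩ := QuotientAddGroup.mk_surjective x
  rw [AddMonoidHom.mem_ker, nsmulAddMonoidHom_apply] at hx
  have hx' : (QuotientAddGroup.mk (n • v) : WeightLattice (m + 1)) = QuotientAddGroup.mk 0 := hx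
  obtain ⟨k, hk⟩ := mk_eq_mk_iff.mp hx'
  have hn : (n : ℤ) ≠ 0 := by exact_mod_cast NeZero.ne n
  rw [AddSubgroup.mem_bot]
  change _ = (QuotientAddGroup.mk 0 : WeightLattice (m + 1))
  refine mk_eq_mk_iff.mpr ⟨-v 0, fun i => ?_⟩
  have h0 := hk 0
  have hi := hk i
  simp only [Pi.zero_apply, Pi.smul_apply, nsmul_eq_mul] at h0 hi ⊢
  have : (n : ℤ) * v i = n * v 0 := by linarith
  rw [mul_left_cancel₀ hn this]
  ring

/-- Multiplication by n = ℓ + N is injective on the weight lattice P, so the index of n Q, for Q the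
root lattice, is [P : Q] [P : nP] = N n^{N-1}. -/
theorem levelIndex_eq (N ℓ : ℕ) [NeZero N] : levelIndex N ℓ = N * (ℓ + N) ^ (N - 1) := by
  obtain ⟨m, rfl⟩ : ∃ m, N = m + 1 := Nat.exists_eq_succ_of_ne_zero (NeZero.ne N)
  have : NeZero (ℓ + (m + 1)) := ⟨by omega⟩
  rw [levelIndex, AddSubgroup.index_map, ker_nsmul, sup_bot_eq, index_rootLattice,
    index_range_nsmul, Nat.add_sub_cancel]

end LevelIndex

/-! ### Shifted labels -/

section ShiftedLabels

variable {N ℓ : ℕ}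

theorem add_le_of_strictAnti {f : Fin N → ℕ} (hf : StrictAnti f) (k : ℕ) :
    ∀ i j : Fin N, (j : ℕ) = i + k → f j + k ≤ f i := by
  induction k with
  | zero =>
    intro i j h
    rw [show j = i from Fin.ext h]
    simp
  | succ k ih =>
    intro i j h
    have hj := j.2
    have h1 := ih i ⟨i + k, by omega⟩ rfl
    have h2 : f j < f ⟨i + k, by omega⟩ := hf (Fin.mk_lt_of_lt_val (by omega))
    omega

theorem eq_and_eq_of_comp_eq {f g : Fin N → ℕ} (hf : StrictAnti f) (hg : StrictAnti g)
    {w w' : Equiv.Perm (Fin N)} (h : f ∘ w = g ∘ w') : f = g ∧ w = w' := by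
  have hr : Set.range f = Set.range g := by
    rw [← w.surjective.range_comp f, h, w'.surjective.range_comp]
  have hfg : f = g := (hf.range_inj hg).mp hr
  refine ⟨hfg, Equiv.ext fun i => hf.injective ?_⟩
  have := congrFun h i
  rw [hfg]
  simpa [hfg] using this

variable [NeZero N]

/-- The strictly decreasing sequence `λ_i + N - 1 - i` of a label (`i` starting at 0). -/
def Label.sh (a : Label N ℓ) (i : Fin N) : ℕ := (a.1 i : ℕ) + (i.rev : ℕ)

theorem Label.sh_strictAnti (a : Label N ℓ) : StrictAnti a.sh := by
  intro i j hij
  have h1 : a.1 j ≤ a.1 i := a.2.1 hij.le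
  have h1' : (a.1 j : ℕ) ≤ (a.1 i : ℕ) := h1
  have h2 : (i : ℕ) < j := hij
  simp only [Label.sh, Fin.val_rev]
  have := j.2
  omega

theorem Label.sh_last (a : Label N ℓ) : a.sh (Fin.rev 0) = 0 := by
  simp only [Label.sh, a.2.2, Fin.rev_rev]
  simp

theorem Label.sh_lt (a : Label N ℓ) (i : Fin N) : a.sh i < ℓ + N := by
  have := (a.1 i).2
  have := i.2
  simp only [Label.sh, Fin.val_rev]
  omega

theorem Label.sh_injective : Function.Injective (Label.sh : Label N ℓ → Fin N → ℕ) := by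
  intro a b h
  apply Subtype.ext
  funext i
  have := congrFun h i
  simp only [Label.sh] at this
  exact Fin.ext (by omega)

theorem le_last (i : Fin N) : i ≤ Fin.rev 0 := by
  rw [Fin.le_def, Fin.val_rev]
  have := i.2
  simp
  omega

/-- Subtracting the staircase N - 1 - i keeps the sequence antitone; comparison with the last term
gives nonnegativity, and comparison with the first term gives the bound ℓ. -/
theorem exists_label_of_strictAnti {f : Fin N → ℕ} (hf : StrictAnti f) (hlast : f (Fin.rev 0) = 0)
    (hlt : ∀ i, f i < ℓ + N) : ∃ a : Label N ℓ, a.sh = f := by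
  have hN : 0 < N := NeZero.pos N
  have hz : ((0 : Fin N) : ℕ) = 0 := by simp
  have hlow : ∀ i : Fin N, (i.rev : ℕ) ≤ f i := by
    intro i
    have := add_le_of_strictAnti hf (i.rev : ℕ) i (Fin.rev 0) (by
      simp only [Fin.val_rev, hz]; have := i.2; omega)
    omega
  have hup : ∀ i : Fin N, f i - (i.rev : ℕ) < ℓ + 1 := by
    intro i
    have h1 := add_le_of_strictAnti hf i 0 i (by rw [hz]; omega)
    have h2 := hlt 0
    have := i.2
    rw [Fin.val_rev]
    omega
  refine ⟨⟨fun i => ⟨f i - (i.rev : ℕ), hup i⟩, ?_, ?_⟩, ?_⟩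
  · intro i j hij
    rw [Fin.le_def]
    have hij' : (i : ℕ) ≤ j := hij
    have := add_le_of_strictAnti hf (j - i) i j (by omega)
    simp only [Fin.val_rev]
    have := j.2
    omega
  · ext
    simp [hlast]
  · funext i
    have := hlow i
    simp only [Label.sh]
    omega

end ShiftedLabels

/-! ### Sums of products of alternants -/

section AlternantSums

variable {N : ℕ}

/-- The determinant `det (x_i ^ M_j)`. -/
def altVal (x : Fin N → ℂ) (M : Fin N → ℕ) : ℂ := Matrix.det (Matrix.of fun i j => x i ^ M j)

theorem altVal_eq_sum (x : Fin N → ℂ) (M : Fin N → ℕ) :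
    altVal x M = ∑ w : Equiv.Perm (Fin N), csign w * ∏ j, x (w j) ^ M j := by
  rw [altVal, Matrix.det_apply']
  rfl

theorem altVal_comp (x : Fin N → ℂ) (M : Fin N → ℕ) (w : Equiv.Perm (Fin N)) :
    altVal x (M ∘ w) = csign w * altVal x M :=
  Matrix.det_permute' w (Matrix.of fun i j => x i ^ M j)

theorem altVal_eq_zero (x : Fin N → ℂ) {M : Fin N → ℕ} (hM : ¬ Function.Injective M) :
    altVal x M = 0 := by
  simp only [Function.Injective, not_forall] at hM
  obtain ⟨i, j, h, hij⟩ := hM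
  refine Matrix.det_zero_of_column_eq hij fun k => ?_
  simp [h]

/-- With `altVal_add_period` this shows that, up to powers of ω, an alternant depends only on its
exponents modulo n and modulo a common translation. -/
theorem altVal_add_const {x : Fin N → ℂ} (hx : ∏ i, x i = 1) (M : Fin N → ℕ) (c : ℕ) :
    altVal x (fun j => M j + c) = altVal x M := by
  have h := Matrix.det_mul_column (fun i => x i ^ c) (Matrix.of fun i j => x i ^ M j)
  rw [Finset.prod_pow, hx, one_pow, one_mul] at h
  rw [altVal, altVal, ← h]
  congr 1
  ext1 i j
  simp [pow_add, mul_comm]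

theorem altVal_add_period {x : Fin N → ℂ} {n : ℕ} {ω : ℂ} (hx : ∀ i, x i ^ n = ω)
    (M e : Fin N → ℕ) : altVal x (fun j => M j + n * e j) = ω ^ (∑ j, e j) * altVal x M := by
  have h := Matrix.det_mul_row (fun j => ω ^ e j) (Matrix.of fun i j => x i ^ M j)
  rw [Finset.prod_pow_eq_pow_sum] at h
  rw [altVal, altVal, ← h]
  congr 1
  ext1 i j
  simp [pow_add, pow_mul, hx, mul_comm]

/-- The product of two alternants with the same exponents. -/
def altProd (x y : Fin N → ℂ) (M : Fin N → ℕ) : ℂ := altVal x M * altVal y M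

theorem altProd_comp (x y : Fin N → ℂ) (M : Fin N → ℕ) (w : Equiv.Perm (Fin N)) :
    altProd x y (M ∘ w) = altProd x y M := by
  rw [altProd, altProd, altVal_comp, altVal_comp]
  linear_combination altVal x M * altVal y M * csign_mul_self w

/-- With unrestricted exponents, the sums over the M_j are independent of each other once both
determinants are expanded. -/
theorem sum_altProd_eq (x y : Fin N → ℂ) (n : ℕ) :
    ∑ M : Fin N → Fin n, altProd x y (fun j => (M j : ℕ)) =
      ∑ w : Equiv.Perm (Fin N), ∑ w' : Equiv.Perm (Fin N), csign w * csign w' *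
        ∏ j, ∑ m ∈ Finset.range n, (x (w j) * y (w' j)) ^ m := by
  simp only [altProd, altVal_eq_sum, Finset.sum_mul_sum]
  rw [Finset.sum_comm]
  refine Finset.sum_congr rfl fun w _ => ?_
  rw [Finset.sum_comm]
  refine Finset.sum_congr rfl fun w' _ => ?_
  simp only [Finset.sum_range]
  rw [Finset.prod_univ_sum, Fintype.piFinset_univ, Finset.mul_sum]
  refine Finset.sum_congr rfl fun M _ => ?_
  simp only [mul_pow, Finset.prod_mul_distrib]
  ring

/-- The rank of `M j` among the values of `M`. -/
def rankIn {n : ℕ} (M : Fin N → Fin n) (j : Fin N) : ℕ :=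
  (Finset.univ.filter fun i => M i < M j).card

theorem sum_pow_rankIn {n : ℕ} {M : Fin N → Fin n} (hM : Function.Injective M) (ω : ℂ) :
    ∑ j, ω ^ rankIn M j = ∑ r ∈ Finset.range N, ω ^ r := by
  have hlt : ∀ i j, M i < M j → rankIn M i < rankIn M j := by
    intro i j h
    refine Finset.card_lt_card ?_
    rw [Finset.ssubset_iff_of_subset]
    · exact ⟨i, by simpa using h, by simp⟩
    · intro k hk
      simp only [Finset.mem_filter, Finset.mem_univ, true_and] at hk ⊢
      exact hk.trans h
  have hinj : Function.Injective (rankIn M) := by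
    intro i j h
    rcases lt_trichotomy (M i) (M j) with h' | h' | h'
    · exact absurd h (hlt i j h').ne
    · exact hM h'
    · exact absurd h.symm (hlt j i h').ne
  have hbound : ∀ j, rankIn M j < N := by
    intro j
    have : (Finset.univ.filter fun i => M i < M j) ⊂ Finset.univ := by
      rw [Finset.ssubset_univ_iff]
      intro h
      have := h ▸ Finset.mem_univ j
      simp at this
    simpa [rankIn] using Finset.card_lt_card this
  have himg : Finset.univ.image (rankIn M) = Finset.range N := by
    refine Finset.eq_of_subset_of_card_le ?_ ?_
    · intro r hr
      obtain ⟨j, -, rfl⟩ := Finset.mem_image.mp hr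
      exact Finset.mem_range.mpr (hbound j)
    · rw [Finset.card_image_of_injective _ hinj]
      simp
  rw [← himg, Finset.sum_image fun i _ j _ h => hinj h]

/-- Translating by -M_j modulo n makes exactly the entries below M_j wrap around; each contributes a
factor ω ω', and there are `rankIn M j` of them. -/
theorem altProd_sub {n : ℕ} [NeZero n] {x y : Fin N → ℂ} {ω ω' : ℂ} (hx : ∏ i, x i = 1)
    (hy : ∏ i, y i = 1) (hxn : ∀ i, x i ^ n = ω) (hyn : ∀ i, y i ^ n = ω') (M : Fin N → Fin n)
    (j : Fin N) :
    altProd x y (fun i => ((M i - M j : Fin n) : ℕ)) =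
      (ω * ω') ^ rankIn M j * altProd x y fun i => (M i : ℕ) := by
  have hval : (fun i => ((M i - M j : Fin n) : ℕ) + (M j : ℕ)) =
      fun i => (M i : ℕ) + n * if M i < M j then 1 else 0 := by
    funext i
    by_cases h : M i < M j
    · rw [if_pos h, Fin.coe_sub_iff_lt.mpr h]
      have := (M j).2
      omega
    · rw [if_neg h, Fin.coe_sub_iff_le.mpr (not_lt.mp h)]
      have : (M j : ℕ) ≤ M i := not_lt.mp h
      omega
  have hr : ∑ i, (if M i < M j then 1 else 0) = rankIn M j := by
    rw [rankIn, Finset.card_filter]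
  rw [altProd, altProd, ← altVal_add_const hx _ (M j : ℕ), ← altVal_add_const hy _ (M j : ℕ), hval,
    altVal_add_period hxn, altVal_add_period hyn, hr, mul_pow]
  ring

/-- Every M is a unique translate, by M_j, of a tuple vanishing at j. -/
theorem sum_zero_at {n : ℕ} [NeZero n] {x y : Fin N → ℂ} {ω ω' : ℂ} (hx : ∏ i, x i = 1)
    (hy : ∏ i, y i = 1) (hxn : ∀ i, x i ^ n = ω) (hyn : ∀ i, y i ^ n = ω') (j : Fin N) :
    (n : ℂ) * ∑ M : Fin N → Fin n with M j = 0, altProd x y (fun i => (M i : ℕ)) =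
      ∑ M : Fin N → Fin n, (ω * ω') ^ rankIn M j * altProd x y fun i => (M i : ℕ) := by
  have h1 : (n : ℂ) * ∑ M : Fin N → Fin n with M j = 0, altProd x y (fun i => (M i : ℕ)) =
      ∑ c : Fin n, ∑ M : Fin N → Fin n with M j = 0, altProd x y (fun i => (M i : ℕ)) := by
    simp
  rw [h1, ← Finset.sum_product']
  refine Finset.sum_bij' (fun p _ => fun i => p.2 i + p.1) (fun M _ => (M j, fun i => M i - M j))
    ?_ ?_ ?_ ?_ ?_
  · intro p _
    exact Finset.mem_univ _
  · intro M _
    simp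
  · rintro ⟨c, M⟩ hp
    have hM : M j = 0 := by simpa using hp
    simp [hM]
  · intro M _
    simp
  · rintro ⟨c, M⟩ hp
    have hM : M j = 0 := by simpa using hp
    rw [← altProd_sub hx hy hxn hyn]
    simp [hM]

/-- Tuples with a repeated value contribute zero. An injective tuple taking the value 0 has a unique
such place j, and sorting it gives a label together with a permutation. -/
theorem factorial_mul_sum_labels {ℓ : ℕ} [NeZero N] (x y : Fin N → ℂ) :
    (N.factorial : ℂ) * ∑ a : Label N ℓ, altProd x y a.sh =
      ∑ j : Fin N, ∑ M : Fin N → Fin (ℓ + N) with M j = ⟨0, Nat.add_pos_right ℓ (NeZero.pos N)⟩,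
        altProd x y (fun i => (M i : ℕ)) := by
  set z : Fin (ℓ + N) := ⟨0, Nat.add_pos_right ℓ (NeZero.pos N)⟩ with hz
  have hR : ∑ j : Fin N, ∑ M : Fin N → Fin (ℓ + N) with M j = z, altProd x y (fun i => (M i : ℕ)) =
      ∑ M : Fin N → Fin (ℓ + N) with Function.Injective M ∧ ∃ j, M j = z,
        altProd x y (fun i => (M i : ℕ)) := by
    simp only [Finset.sum_filter]
    rw [Finset.sum_comm]
    refine Finset.sum_congr rfl fun M _ => ?_
    by_cases hM : Function.Injective M
    · by_cases hj : ∃ j, M j = z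
      · obtain ⟨j, hj⟩ := hj
        rw [if_pos ⟨hM, j, hj⟩, Finset.sum_eq_single j]
        · rw [if_pos hj]
        · intro i _ hij
          exact if_neg fun h => hij (hM (h.trans hj.symm))
        · simp
      · rw [if_neg fun h => hj h.2]
        exact Finset.sum_eq_zero fun j _ => if_neg fun h => hj ⟨j, h⟩
    · rw [if_neg fun h => hM h.1]
      refine Finset.sum_eq_zero fun j _ => ?_
      have : altProd x y (fun i => (M i : ℕ)) = 0 := by
        rw [altProd, altVal_eq_zero, zero_mul]
        exact fun h => hM fun i j hij => h (congrArg Fin.val hij)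
      simp [this]
  have hL : (N.factorial : ℂ) * ∑ a : Label N ℓ, altProd x y a.sh =
      ∑ p : Label N ℓ × Equiv.Perm (Fin N), altProd x y (p.1.sh ∘ p.2) := by
    rw [Fintype.sum_prod_type, Finset.mul_sum]
    refine Finset.sum_congr rfl fun a _ => ?_
    simp [altProd_comp, Fintype.card_perm]
  rw [hR, hL]
  refine Finset.sum_bij (fun p _ => fun i => ⟨p.1.sh (p.2 i), p.1.sh_lt _⟩) ?_ ?_ ?_ ?_
  · rintro ⟨a, w⟩ -
    simp only [Finset.mem_filter, Finset.mem_univ, true_and]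
    refine ⟨fun i j h => ?_, w⁻¹ (Fin.rev 0), ?_⟩
    · have := Fin.mk.inj_iff.mp h
      exact w.injective (a.sh_strictAnti.injective this)
    · apply Fin.ext
      change a.sh (w (w⁻¹ (Fin.rev 0))) = 0
      rw [show w (w⁻¹ (Fin.rev 0)) = Fin.rev 0 from w.apply_symm_apply _, a.sh_last]
  · rintro ⟨a, w⟩ - ⟨b, w'⟩ - h
    have h' : a.sh ∘ w = b.sh ∘ w' := by
      funext i
      exact Fin.mk.inj_iff.mp (congrFun h i)
    obtain ⟨h1, h2⟩ := eq_and_eq_of_comp_eq a.sh_strictAnti b.sh_strictAnti h'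
    rw [Label.sh_injective h1, h2]
  · intro M hM
    obtain ⟨-, hinj, j, hj⟩ := Finset.mem_filter.mp hM
    obtain ⟨u, hu⟩ : ∃ u : Equiv.Perm (Fin N), Antitone fun i => (M (u i) : ℕ) := by
      refine ⟨Tuple.sort fun i => OrderDual.toDual (M i : ℕ), fun i j hij => ?_⟩
      exact Tuple.monotone_sort (fun i => OrderDual.toDual (M i : ℕ)) hij
    have hu' : StrictAnti fun i => (M (u i) : ℕ) :=
      hu.strictAnti_of_injective fun i j h => u.injective (hinj (Fin.ext h))
    have hlast : (M (u (Fin.rev 0)) : ℕ) = 0 := by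
      have h1 := hu (le_last (u⁻¹ j))
      simp only [show u (u⁻¹ j) = j from u.apply_symm_apply j, hj, hz] at h1
      omega
    obtain ⟨a, ha⟩ := exists_label_of_strictAnti (ℓ := ℓ) hu' hlast fun i => (M (u i)).2
    refine ⟨(a, u⁻¹), Finset.mem_univ _, ?_⟩
    funext i
    apply Fin.ext
    change a.sh (u⁻¹ i) = M i
    rw [ha]
    simp only [show u (u⁻¹ i) = i from u.apply_symm_apply i]
  · rintro ⟨a, w⟩ -
    rfl

/-- For injective M the ranks run once through 0, …, N - 1, so summing over the place j of the value
0 produces a geometric factor independent of M. -/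
theorem sum_labels_altProd {ℓ : ℕ} [NeZero N] {x y : Fin N → ℂ} {ω ω' : ℂ} (hx : ∏ i, x i = 1)
    (hy : ∏ i, y i = 1) (hxn : ∀ i, x i ^ (ℓ + N) = ω) (hyn : ∀ i, y i ^ (ℓ + N) = ω') :
    ((ℓ + N : ℕ) : ℂ) * ((N.factorial : ℂ) * ∑ a : Label N ℓ, altProd x y a.sh) =
      (∑ r ∈ Finset.range N, (ω * ω') ^ r) *
        ∑ M : Fin N → Fin (ℓ + N), altProd x y fun i => (M i : ℕ) := by
  have : NeZero (ℓ + N) := ⟨(Nat.add_pos_right ℓ (NeZero.pos N)).ne'⟩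
  rw [factorial_mul_sum_labels, Finset.mul_sum]
  have h : ∀ j : Fin N, ((ℓ + N : ℕ) : ℂ) * ∑ M : Fin N → Fin (ℓ + N) with
      M j = ⟨0, Nat.add_pos_right ℓ (NeZero.pos N)⟩, altProd x y (fun i => (M i : ℕ)) =
      ∑ M : Fin N → Fin (ℓ + N), (ω * ω') ^ rankIn M j * altProd x y fun i => (M i : ℕ) :=
    fun j => sum_zero_at hx hy hxn hyn j
  rw [Finset.sum_congr rfl fun j _ => h j, Finset.sum_comm, Finset.mul_sum]
  refine Finset.sum_congr rfl fun M _ => ?_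
  rw [← Finset.sum_mul]
  by_cases hM : Function.Injective M
  · rw [sum_pow_rankIn hM]
  · have : altProd x y (fun i => (M i : ℕ)) = 0 := by
      rw [altProd, altVal_eq_zero, zero_mul]
      exact fun h => hM fun i j hij => h (congrArg Fin.val hij)
    rw [this, mul_zero, mul_zero]

end AlternantSums

/-! ### Powers of `q` -/

section QPow

variable {N ℓ : ℕ}

theorem qpow_zero : qpow N ℓ 0 = 1 := by simp [qpow]

theorem qpow_add (x y : ℝ) : qpow N ℓ (x + y) = qpow N ℓ x * qpow N ℓ y := by
  rw [qpow, qpow, qpow, ← Complex.exp_add]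
  congr 1
  push_cast
  ring

theorem qpow_sum {ι : Type*} (s : Finset ι) (f : ι → ℝ) :
    qpow N ℓ (∑ i ∈ s, f i) = ∏ i ∈ s, qpow N ℓ (f i) := by
  classical
  induction s using Finset.induction_on with
  | empty => simp [qpow_zero]
  | insert i s hi ih => rw [Finset.sum_insert hi, Finset.prod_insert hi, qpow_add, ih]

theorem qpow_pow (x : ℝ) (k : ℕ) : qpow N ℓ x ^ k = qpow N ℓ (x * k) := by
  rw [qpow, qpow, ← Complex.exp_nat_mul]
  congr 1
  push_cast
  ring

theorem conj_qpow (x : ℝ) : conj (qpow N ℓ x) = qpow N ℓ (-x) := by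
  rw [qpow, qpow, ← Complex.exp_conj]
  congr 1
  simp [Complex.conj_ofNat]

theorem qpow_mul_qpow_neg (x : ℝ) : qpow N ℓ x * qpow N ℓ (-x) = 1 := by
  rw [← qpow_add, add_neg_cancel, qpow_zero]

theorem qpow_eq_one_iff [NeZero N] (x : ℝ) :
    qpow N ℓ x = 1 ↔ ∃ k : ℤ, x = k * ((ℓ : ℝ) + N) := by
  have hn : ((ℓ : ℝ) + N) ≠ 0 := by
    have : (0 : ℝ) < N := by exact_mod_cast NeZero.pos N
    positivity
  have hn' : ((ℓ : ℂ) + N) ≠ 0 := by exact_mod_cast hn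
  rw [qpow, Complex.exp_eq_one_iff]
  refine exists_congr fun k => ?_
  rw [div_eq_iff hn']
  constructor
  · intro h
    have h2 : (2 * Real.pi * Complex.I : ℂ) * x = (2 * Real.pi * Complex.I) * (k * ((ℓ : ℂ) + N)) := by
      rw [h]; ring
    have h3 := mul_left_cancel₀ Complex.two_pi_I_ne_zero h2
    exact_mod_cast h3
  · intro h
    rw [h]
    push_cast
    ring

end QPow

/-! ### The S-matrix through alternants -/

section SMatrix

variable {N ℓ : ℕ}

theorem killing_eq_sum (x y : Fin N → ℝ) : killing x y = ∑ i, (x i - (∑ j, x j) / N) * y i := by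
  simp only [killing, sub_mul, Finset.sum_sub_distrib, ← Finset.mul_sum]
  ring

theorem killing_coordWeight (i : Fin N) (y : Fin N → ℝ) :
    killing (coordWeight i) y = y i - (∑ j, y j) / N := by
  simp [killing, coordWeight, Pi.single_apply]

theorem killing_neg_right (x y : Fin N → ℝ) : killing x (-y) = -killing x y := by
  simp only [killing, Pi.neg_apply, mul_neg, Finset.sum_neg_distrib]
  ring

theorem sqrt_levelIndex_mul_self {ℓ : ℕ} :
    ((Real.sqrt (levelIndex N ℓ) : ℝ) : ℂ)⁻¹ * ((Real.sqrt (levelIndex N ℓ) : ℝ) : ℂ)⁻¹ =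
      (levelIndex N ℓ : ℂ)⁻¹ := by
  rw [← mul_inv, ← Complex.ofReal_mul, Real.mul_self_sqrt (Nat.cast_nonneg _)]
  simp

theorem csign_revPerm : csign (Fin.revPerm : Equiv.Perm (Fin N)) = (-1) ^ (posRoots N).card := by
  rw [csign, Equiv.Perm.sign_eq_prod_prod_Ioi, ← prod_posRoots fun i j : Fin N =>
    if (Fin.revPerm i : Fin N) < Fin.revPerm j then (1 : ℤˣ) else -1]
  rw [Finset.prod_congr rfl (g := fun _ => (-1 : ℤˣ)), Finset.prod_const]
  · push_cast
    rfl
  · intro p hp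
    have : p.1 < p.2 := by simpa [posRoots] using hp
    rw [if_neg]
    simp [this.le]

theorem rho_eq (i : Fin N) : rho N i = ((i.rev : ℕ) : ℝ) - ((N : ℝ) - 1) / 2 := by
  rw [rho, Fin.val_rev, Nat.cast_sub (by omega)]
  push_cast
  ring

variable [NeZero N]

theorem cast_N_ne_zero : (N : ℝ) ≠ 0 := by exact_mod_cast NeZero.ne N

theorem sum_sub_mean (y : Fin N → ℝ) : ∑ i, (y i - (∑ j, y j) / N) = 0 := by
  have := cast_N_ne_zero (N := N)
  rw [Finset.sum_sub_distrib]
  simp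
  field_simp
  ring

theorem Label.wt_add_rho (a : Label N ℓ) (i : Fin N) :
    (a.wt + rho N) i = (a.sh i : ℝ) - ((N : ℝ) - 1) / 2 := by
  rw [Pi.add_apply, rho_eq, Label.wt, Label.sh]
  push_cast
  ring

/-- The `i`-th coordinate of `λ + ρ` in the zero-sum normalization. -/
def Label.cc (a : Label N ℓ) (i : Fin N) : ℝ := killing (coordWeight i) (a.wt + rho N)

theorem Label.cc_eq_mean (a : Label N ℓ) (i : Fin N) :
    a.cc i = (a.wt + rho N) i - (∑ j, (a.wt + rho N) j) / N := killing_coordWeight _ _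

theorem Label.cc_eq (a : Label N ℓ) (i : Fin N) :
    a.cc i = (a.sh i : ℝ) - (∑ j, (a.sh j : ℝ)) / N := by
  have := cast_N_ne_zero (N := N)
  rw [Label.cc_eq_mean, Label.wt_add_rho, Finset.sum_congr rfl fun j _ => a.wt_add_rho j,
    Finset.sum_sub_distrib]
  simp
  field_simp
  ring

theorem Label.sum_cc (a : Label N ℓ) : ∑ i, a.cc i = 0 := by
  rw [Finset.sum_congr rfl fun i _ => a.cc_eq i]
  exact sum_sub_mean _

/-- The evaluation point `x_i = q^{⟨e_i^*, λ + ρ⟩}`. -/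
def Label.xv (a : Label N ℓ) (i : Fin N) : ℂ := qpow N ℓ (a.cc i)

/-- The conjugate evaluation point. -/
def Label.yv (a : Label N ℓ) (i : Fin N) : ℂ := qpow N ℓ (-a.cc i)

theorem Label.conj_xv (a : Label N ℓ) (i : Fin N) : conj (a.xv i) = a.yv i := conj_qpow _

theorem Label.xv_mul_yv (a : Label N ℓ) (i : Fin N) : a.xv i * a.yv i = 1 := qpow_mul_qpow_neg _

theorem Label.prod_xv (a : Label N ℓ) : ∏ i, a.xv i = 1 := by
  simp only [Label.xv]
  rw [← qpow_sum, a.sum_cc, qpow_zero]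

theorem Label.prod_yv (a : Label N ℓ) : ∏ i, a.yv i = 1 := by
  simp only [Label.yv]
  rw [← qpow_sum, Finset.sum_neg_distrib, a.sum_cc, neg_zero, qpow_zero]

theorem conj_altVal_xv (a : Label N ℓ) (M : Fin N → ℕ) :
    conj (altVal a.xv M) = altVal a.yv M := by
  rw [altVal, altVal, RingHom.map_det]
  congr 1
  ext1 i j
  simp [← a.conj_xv]

/-- In the zero-sum normalization of λ + ρ, the constant (N - 1)/2 separating μ + ρ from `b.sh`
pairs to zero, so the exponents become integers. -/
theorem calS_eq (a b : Label N ℓ) :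
    calS N ℓ a b = ((Real.sqrt (levelIndex N ℓ) : ℝ) : ℂ)⁻¹ * altVal a.xv b.sh := by
  rw [calS, altVal_eq_sum]
  congr 1
  refine Finset.sum_congr rfl fun w _ => ?_
  congr 1
  simp only [Label.xv, qpow_pow]
  rw [← qpow_sum]
  congr 1
  rw [killing_eq_sum, Finset.sum_congr rfl fun i _ => by rw [← a.cc_eq_mean i]]
  have h : ∑ i, a.cc i * weyl w (b.wt + rho N) i = ∑ i, a.cc i * (b.sh (w.symm i) : ℝ) := by
    have : ∀ i, a.cc i * weyl w (b.wt + rho N) i =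
        a.cc i * (b.sh (w.symm i) : ℝ) - a.cc i * (((N : ℝ) - 1) / 2) := by
      intro i
      rw [weyl, b.wt_add_rho]
      ring
    rw [Finset.sum_congr rfl fun i _ => this i, Finset.sum_sub_distrib, ← Finset.sum_mul, a.sum_cc]
    ring
  rw [h, ← Equiv.sum_comp w]
  simp

/-- The value does not depend on i, since the coordinates of λ + ρ differ by integers. This is the
periodicity needed for translating exponents. -/
theorem Label.xv_pow (a : Label N ℓ) (i : Fin N) :
    a.xv i ^ (ℓ + N) = qpow N ℓ (-((ℓ + N : ℝ) * (∑ j, (a.sh j : ℝ)) / N)) := by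
  rw [Label.xv, qpow_pow, a.cc_eq]
  have h : (((a.sh i : ℝ) - (∑ j, (a.sh j : ℝ)) / N) * ((ℓ + N : ℕ) : ℝ)) =
      ((a.sh i : ℤ) : ℝ) * ((ℓ : ℝ) + N) + -((ℓ + N : ℝ) * (∑ j, (a.sh j : ℝ)) / N) := by
    push_cast
    ring
  rw [h, qpow_add, (qpow_eq_one_iff _).mpr ⟨_, rfl⟩, one_mul]

theorem Label.yv_pow (a : Label N ℓ) (i : Fin N) :
    a.yv i ^ (ℓ + N) = qpow N ℓ ((ℓ + N : ℝ) * (∑ j, (a.sh j : ℝ)) / N) := by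
  rw [← a.conj_xv, ← map_pow, a.xv_pow, conj_qpow, neg_neg]

/-- Corresponding coordinates differ by k_j n with ∑ k_j = 0, where n = ℓ + N. As shifted labels lie
in [0, n), a positive k_j forces the offset κ < 0 and a negative one forces κ > 0, so all k_j
vanish. Then κ = 0, because both sequences contain 0 and are nonnegative. -/
theorem eq_of_xv_mul_yv_eq_one {a b : Label N ℓ} {w w' : Equiv.Perm (Fin N)}
    (h : ∀ j, a.xv (w j) * b.yv (w' j) = 1) : a = b ∧ w = w' := by
  have hnpos : (0 : ℝ) < (ℓ : ℝ) + N := by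
    have : (0 : ℝ) < N := by exact_mod_cast NeZero.pos N
    positivity
  have hk : ∀ j, ∃ k : ℤ, a.cc (w j) - b.cc (w' j) = k * ((ℓ : ℝ) + N) := by
    intro j
    have := h j
    rw [Label.xv, Label.yv, ← qpow_add, qpow_eq_one_iff] at this
    simpa [sub_eq_add_neg] using this
  choose k hk using hk
  have hsum : ∑ j, k j = 0 := by
    have h1 : ∑ j, (a.cc (w j) - b.cc (w' j)) = 0 := by
      rw [Finset.sum_sub_distrib, Equiv.sum_comp w, Equiv.sum_comp w', a.sum_cc, b.sum_cc, sub_zero]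
    rw [Finset.sum_congr rfl fun j _ => hk j, ← Finset.sum_mul] at h1
    have h2 := (mul_eq_zero.mp h1).resolve_right hnpos.ne'
    exact_mod_cast h2
  set κ : ℝ := (∑ j, (a.sh j : ℝ)) / N - (∑ j, (b.sh j : ℝ)) / N with hκ
  have hdiff : ∀ j, (a.sh (w j) : ℝ) - b.sh (w' j) = κ + k j * ((ℓ : ℝ) + N) := by
    intro j
    rw [← hk j, a.cc_eq, b.cc_eq, hκ]
    ring
  have hlt : ∀ (c : Label N ℓ) i, (c.sh i : ℝ) < (ℓ : ℝ) + N := fun c i => by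
    exact_mod_cast c.sh_lt i
  have hpos : ∀ j, 0 < k j → κ < 0 := by
    intro j hj
    have h1 : (1 : ℝ) ≤ k j := by exact_mod_cast hj
    have h2 := hdiff j
    have h3 := hlt a (w j)
    have h4 : (0 : ℝ) ≤ b.sh (w' j) := Nat.cast_nonneg _
    nlinarith
  have hneg : ∀ j, k j < 0 → 0 < κ := by
    intro j hj
    have h1 : (k j : ℝ) ≤ -1 := by exact_mod_cast Int.le_sub_one_of_lt hj
    have h2 := hdiff j
    have h3 := hlt b (w' j)
    have h4 : (0 : ℝ) ≤ a.sh (w j) := Nat.cast_nonneg _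
    nlinarith
  have hzero : ∀ j, k j = 0 := by
    by_contra hne
    push Not at hne
    obtain ⟨j, hj⟩ := hne
    obtain ⟨i, -, hi⟩ := Finset.exists_pos_of_sum_zero_of_exists_nonzero k hsum
      ⟨j, Finset.mem_univ _, hj⟩
    obtain ⟨i', -, hi'⟩ := Finset.exists_pos_of_sum_zero_of_exists_nonzero (fun j => -k j)
      (by rw [Finset.sum_neg_distrib, hsum, neg_zero]) ⟨j, Finset.mem_univ _, neg_ne_zero.mpr hj⟩
    have h1 := hpos i hi
    have h2 := hneg i' (neg_pos.mp hi')
    linarith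
  have hdiff' : ∀ j, (a.sh (w j) : ℝ) - b.sh (w' j) = κ := by
    intro j
    rw [hdiff, hzero]
    simp
  have hκ0 : κ = 0 := by
    apply le_antisymm
    · have := hdiff' (w.symm (Fin.rev 0))
      rw [Equiv.apply_symm_apply, a.sh_last] at this
      have h4 : (0 : ℝ) ≤ b.sh (w' (w.symm (Fin.rev 0))) := Nat.cast_nonneg _
      push_cast at this
      linarith
    · have := hdiff' (w'.symm (Fin.rev 0))
      rw [Equiv.apply_symm_apply, b.sh_last] at this
      have h4 : (0 : ℝ) ≤ a.sh (w (w'.symm (Fin.rev 0))) := Nat.cast_nonneg _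
      push_cast at this
      linarith
  have hcomp : a.sh ∘ w = b.sh ∘ w' := by
    funext j
    have := hdiff' j
    rw [hκ0, sub_eq_zero] at this
    exact_mod_cast this
  obtain ⟨h1, h2⟩ := eq_and_eq_of_comp_eq a.sh_strictAnti b.sh_strictAnti hcomp
  exact ⟨Label.sh_injective h1, h2⟩

theorem sum_altProd_labels (a b : Label N ℓ) :
    ∑ c : Label N ℓ, altProd a.xv b.yv c.sh = if a = b then (levelIndex N ℓ : ℂ) else 0 := by
  classical
  have hn0 : ((ℓ + N : ℕ) : ℂ) ≠ 0 := by
    exact_mod_cast (Nat.add_pos_right ℓ (NeZero.pos N)).ne'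
  have hf0 : (N.factorial : ℂ) ≠ 0 := by exact_mod_cast N.factorial_ne_zero
  have key := sum_labels_altProd (ℓ := ℓ) a.prod_xv b.prod_yv a.xv_pow b.yv_pow
  set ω := qpow N ℓ (-((ℓ + N : ℝ) * (∑ j, (a.sh j : ℝ)) / N)) *
    qpow N ℓ ((ℓ + N : ℝ) * (∑ j, (b.sh j : ℝ)) / N) with hω
  have hNR := cast_N_ne_zero (N := N)
  have hωN : ω ^ N = 1 := by
    rw [hω, ← qpow_add, qpow_pow, qpow_eq_one_iff]
    refine ⟨(∑ j, (b.sh j : ℤ)) - ∑ j, (a.sh j : ℤ), ?_⟩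
    push_cast
    field_simp
    ring
  apply mul_left_cancel₀ hf0
  apply mul_left_cancel₀ hn0
  rw [key]
  by_cases h1 : ω = 1
  -- Here the ratios x y are n-th roots of unity, so a geometric sum vanishes unless its ratio is 1.
  · have hprod : ∀ w w' : Equiv.Perm (Fin N),
        ∏ j, ∑ m ∈ Finset.range (ℓ + N), (a.xv (w j) * b.yv (w' j)) ^ m =
          if a = b ∧ w = w' then ((ℓ + N : ℕ) : ℂ) ^ N else 0 := by
      intro w w'
      by_cases hall : ∀ j, a.xv (w j) * b.yv (w' j) = 1
      · rw [if_pos (eq_of_xv_mul_yv_eq_one hall)]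
        simp [hall]
      · have hne : ¬ (a = b ∧ w = w') := by
          rintro ⟨rfl, rfl⟩
          exact hall fun j => a.xv_mul_yv _
        rw [if_neg hne]
        push Not at hall
        obtain ⟨j, hj⟩ := hall
        refine Finset.prod_eq_zero (Finset.mem_univ j) ?_
        have hz : (a.xv (w j) * b.yv (w' j)) ^ (ℓ + N) = 1 := by
          rw [mul_pow, a.xv_pow, b.yv_pow, ← hω, h1]
        rw [geom_sum_eq hj, hz, sub_self, zero_div]
    rw [sum_altProd_eq, h1]
    simp only [hprod]
    by_cases hab : a = b
    · have hs : ∀ w : Equiv.Perm (Fin N), ∑ w' : Equiv.Perm (Fin N), csign w * csign w' *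
          (if a = b ∧ w = w' then ((ℓ + N : ℕ) : ℂ) ^ N else 0) = ((ℓ + N : ℕ) : ℂ) ^ N := by
        intro w
        rw [Finset.sum_eq_single w]
        · rw [if_pos ⟨hab, rfl⟩, csign_mul_self, one_mul]
        · intro w' _ hw'
          rw [if_neg fun h => hw' h.2.symm, mul_zero]
        · simp
      rw [Finset.sum_congr rfl fun w _ => hs w, if_pos hab, levelIndex_eq]
      have hpow : ((ℓ + N : ℕ) : ℂ) ^ N = ((ℓ + N : ℕ) : ℂ) * ((ℓ + N : ℕ) : ℂ) ^ (N - 1) := by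
        rw [← pow_succ', Nat.sub_add_cancel (NeZero.pos N)]
      rw [hpow]
      simp [Fintype.card_perm]
      ring
    · simp [hab]
  -- Here ω is a nontrivial N-th root of unity, and the prefactor ∑_{r<N} ω^r is zero.
  · have hab : a ≠ b := by
      rintro rfl
      apply h1
      rw [hω, mul_comm, qpow_mul_qpow_neg]
    rw [geom_sum_eq h1, hωN, if_neg hab]
    simp

theorem levelIndex_pos : 0 < levelIndex N ℓ := by
  rw [levelIndex_eq]
  have : 0 < ℓ + N := Nat.add_pos_right ℓ (NeZero.pos N)
  have := NeZero.pos N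
  positivity

theorem calS_mul_conj (a b c : Label N ℓ) :
    calS N ℓ a c * conj (calS N ℓ b c) = (levelIndex N ℓ : ℂ)⁻¹ * altProd a.xv b.yv c.sh := by
  rw [calS_eq, calS_eq, map_mul, conj_altVal_xv, map_inv₀, Complex.conj_ofReal, altProd,
    ← sqrt_levelIndex_mul_self]
  ring

theorem I_pow_mul_conj (k : ℕ) : Complex.I ^ k * conj (Complex.I ^ k) = 1 := by
  rw [map_pow, Complex.conj_I, ← mul_pow]
  simp

theorem Smat_mul_conj (a b c : Label N ℓ) :
    Smat N ℓ a c * conj (Smat N ℓ b c) = calS N ℓ b c * conj (calS N ℓ a c) := by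
  rw [Smat, Smat, map_mul, Complex.conj_conj]
  linear_combination calS N ℓ b c * conj (calS N ℓ a c) * I_pow_mul_conj (posRoots N).card

theorem Smat_mul_conjTranspose : Smat N ℓ * (Smat N ℓ).conjTranspose = 1 := by
  ext a b
  rw [Matrix.mul_apply]
  simp only [Matrix.conjTranspose_apply]
  have h0 : (levelIndex N ℓ : ℂ) ≠ 0 := by exact_mod_cast levelIndex_pos.ne'
  rw [Finset.sum_congr rfl (g := fun c => (levelIndex N ℓ : ℂ)⁻¹ * altProd b.xv a.yv c.sh)]
  · rw [← Finset.mul_sum, sum_altProd_labels, Matrix.one_apply]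
    by_cases h : a = b
    · subst h; simp [h0]
    · simp [h, Ne.symm h]
  · intro c _
    rw [← calS_mul_conj, ← Smat_mul_conj]
    rfl

theorem conjTranspose_mul_Smat : (Smat N ℓ).conjTranspose * Smat N ℓ = 1 :=
  mul_eq_one_comm.mp Smat_mul_conjTranspose

theorem Smat_inv : (Smat N ℓ)⁻¹ = (Smat N ℓ).conjTranspose :=
  Matrix.inv_eq_right_inv Smat_mul_conjTranspose

/-! ### Duality -/

theorem Label.sh_dag (a : Label N ℓ) (i : Fin N) : a.dag.sh i + a.sh i.rev = a.sh 0 := by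
  have h : a.1 i.rev ≤ a.1 0 := a.2.1 (Fin.zero_le _)
  have h' : (a.1 i.rev : ℕ) ≤ a.1 0 := h
  have hz : ((0 : Fin N) : ℕ) = 0 := by simp
  have := i.2
  simp only [Label.sh, Label.dag, Fin.rev_rev, Fin.val_rev, hz]
  omega

theorem altVal_dag (a b : Label N ℓ) :
    altVal a.xv b.dag.sh = (-1) ^ (posRoots N).card * altVal a.yv b.sh := by
  -- Reversing the columns gives the sign. Multiplying row i by x_i^{b.sh 0} is free since ∏ x_i =
  -- 1, and turns powers of y_i = x_i⁻¹ into the dual powers of x_i.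
  rw [← csign_revPerm, ← altVal_comp, ← one_mul (altVal a.yv _), ← one_pow (b.sh 0), ← a.prod_xv,
    ← Finset.prod_pow, altVal, altVal, ← Matrix.det_mul_column]
  congr 1
  ext1 i j
  simp only [Matrix.of_apply, Function.comp_apply, Fin.revPerm_apply]
  rw [← b.sh_dag j, pow_add, mul_assoc, ← mul_pow, a.xv_mul_yv, one_pow, mul_one]

/-- The sign from reversing the exponents is compensated by conjugating i^{|Δ₊|}. -/
theorem Smat_dag (a b : Label N ℓ) : Smat N ℓ a b.dag = conj (Smat N ℓ a b) := by
  rw [Smat, Smat, map_mul, Complex.conj_conj, calS_eq, calS_eq, map_mul, altVal_dag,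
    map_mul, ← conj_altVal_xv, Complex.conj_conj, map_inv₀, Complex.conj_ofReal, map_pow, map_pow,
    Complex.conj_I, neg_pow Complex.I]
  simp
  ring

/-- Duality is λ ↦ -w₀ λ for the longest element w₀, up to a constant vector, and the scalar product
ignores all three operations. -/
theorem killing_comp_rev (x y : Fin N → ℝ) (c c' : ℝ) :
    killing (fun i => c - x i.rev) (fun i => c' - y i.rev) = killing x y := by
  have hNR := cast_N_ne_zero (N := N)
  have hx : ∑ i : Fin N, x i.rev = ∑ i, x i := Equiv.sum_comp Fin.revPerm x
  have hy : ∑ i : Fin N, y i.rev = ∑ i, y i := Equiv.sum_comp Fin.revPerm y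
  have hxy : ∑ i : Fin N, x i.rev * y i.rev = ∑ i, x i * y i :=
    Equiv.sum_comp Fin.revPerm fun i => x i * y i
  have h : ∀ i : Fin N, (c - x i.rev) * (c' - y i.rev) =
      c * c' - c * y i.rev - c' * x i.rev + x i.rev * y i.rev := fun i => by ring
  simp only [killing, h, Finset.sum_add_distrib, Finset.sum_sub_distrib, ← Finset.mul_sum, hx, hy,
    hxy]
  simp
  field_simp
  ring

theorem confWeight_dag (a : Label N ℓ) : confWeight a.dag = confWeight a := by
  rw [confWeight, confWeight]
  congr 1
  rw [← killing_comp_rev a.wt (a.wt + (2 : ℝ) • rho N) (a.1 0 : ℕ) (a.1 0 : ℕ)]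
  have h1 : a.dag.wt = fun i => ((a.1 0 : ℕ) : ℝ) - a.wt i.rev := by
    funext i
    have h : a.1 i.rev ≤ a.1 0 := a.2.1 (Fin.zero_le _)
    have h' : (a.1 i.rev : ℕ) ≤ a.1 0 := h
    simp only [Label.wt, Label.dag]
    rw [Nat.cast_sub h']
  have h2 : ∀ i : Fin N, rho N i = - rho N i.rev := by
    intro i
    rw [rho_eq, rho_eq, Fin.rev_rev, Fin.val_rev, Nat.cast_sub (by omega)]
    push_cast
    ring
  congr 1
  funext i
  rw [Pi.add_apply, h1, Pi.smul_apply, h2 i]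
  simp only [Pi.add_apply, Pi.smul_apply, smul_eq_mul]
  ring

end SMatrix

/-! ### The orthonormal basis and the 2-point function -/

section TwoPoint

variable {N ℓ : ℕ} [NeZero N]

theorem eps_apply (a m : Label N ℓ) : eps a m = Smat N ℓ a m := by
  simp [eps, e, Finset.sum_apply, Pi.single_apply]

/-- Duality turns the bilinear pairing into the Hermitian product of rows of S, so this is
unitarity. -/
theorem pairing_eps (a₁ a₂ : Label N ℓ) :
    pairing (eps a₁) (eps a₂) = if a₁ = a₂ then 1 else 0 := by
  have h := congrFun (congrFun (Smat_mul_conjTranspose (N := N) (ℓ := ℓ)) a₁) a₂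
  rw [Matrix.mul_apply, Matrix.one_apply] at h
  rw [← h, pairing]
  refine Finset.sum_congr rfl fun m _ => ?_
  rw [eps_apply, eps_apply, Smat_dag]
  rfl

theorem sum_inv_smul_eps (τ : Label N ℓ) : ∑ a : Label N ℓ, (Smat N ℓ)⁻¹ τ a • eps a = e τ := by
  funext m
  have h := congrFun (congrFun (conjTranspose_mul_Smat (N := N) (ℓ := ℓ)) τ) m
  rw [Matrix.mul_apply, Matrix.one_apply] at h
  rw [Finset.sum_apply, Smat_inv]
  simp only [Pi.smul_apply, eps_apply, smul_eq_mul]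
  rw [h, e, Pi.single_apply]
  simp only [eq_comm]

/-- By unitarity and `Smat_dag`, column τ of S is row τ† of its inverse. -/
theorem sum_Smat_smul_eps (τ : Label N ℓ) : ∑ a : Label N ℓ, Smat N ℓ a τ • eps a = e τ.dag := by
  rw [← sum_inv_smul_eps]
  refine Finset.sum_congr rfl fun a _ => ?_
  congr 1
  rw [Smat_inv, Matrix.conjTranspose_apply, Smat_dag]
  simp

theorem sum_smul_eps_tmul_eps (g : Label N ℓ → ℂ) :
    ∑ a₁ : Label N ℓ, ∑ a₂ : Label N ℓ,
        (∑ τ : Label N ℓ, g τ * Smat N ℓ a₂ τ * (Smat N ℓ)⁻¹ τ a₁) • (eps a₁ ⊗ₜ[ℂ] eps a₂) =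
      ∑ τ : Label N ℓ, g τ • (e τ ⊗ₜ[ℂ] e τ.dag) := by
  have h : ∀ τ : Label N ℓ, g τ • (e τ ⊗ₜ[ℂ] e τ.dag) = ∑ a₁ : Label N ℓ, ∑ a₂ : Label N ℓ,
      (g τ * Smat N ℓ a₂ τ * (Smat N ℓ)⁻¹ τ a₁) • (eps a₁ ⊗ₜ[ℂ] eps a₂) := by
    intro τ
    rw [← sum_Smat_smul_eps, ← sum_inv_smul_eps, TensorProduct.sum_tmul, Finset.smul_sum]
    refine Finset.sum_congr rfl fun a₁ _ => ?_
    rw [TensorProduct.tmul_sum, Finset.smul_sum]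
    refine Finset.sum_congr rfl fun a₂ _ => ?_
    rw [TensorProduct.smul_tmul_smul, smul_smul]
    congr 1
    ring
  simp only [h, Finset.sum_smul]
  rw [Finset.sum_comm]
  conv_rhs => rw [Finset.sum_comm]; enter [2, a]; rw [Finset.sum_comm]
  rw [Finset.sum_comm]

theorem Rmat_e (t u : ℂ) (a : Label N ℓ) :
    Rmat N ℓ t u (e a) =
      Complex.exp (u * t * ((confWeight a : ℂ) + (centralCharge N ℓ : ℂ) / 24)) • e a := by
  funext m
  rw [Rmat, Matrix.toLin'_apply, Matrix.mulVec_diagonal, e, Pi.smul_apply, Pi.single_apply,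
    smul_eq_mul]
  split_ifs with h
  · rw [h]
  · simp

/-- τ and τ† have the same conformal weight, so the exponents in u₁ and u₂ add up. -/
theorem map_Rmat_bivector (t u₁ u₂ : ℂ) :
    TensorProduct.map (Rmat N ℓ t u₁) (Rmat N ℓ t u₂) (bivector N ℓ) =
      ∑ a₁ : Label N ℓ, ∑ a₂ : Label N ℓ, Bcoef t a₁ a₂ (u₁ + u₂) • (eps a₁ ⊗ₜ[ℂ] eps a₂) := by
  simp only [Bcoef]
  rw [sum_smul_eps_tmul_eps, bivector, map_sum]
  refine Finset.sum_congr rfl fun τ _ => ?_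
  rw [TensorProduct.map_tmul, Rmat_e, Rmat_e, TensorProduct.smul_tmul_smul, ← Complex.exp_add,
    confWeight_dag]
  congr 2
  ring

theorem bivector_eq :
    bivector N ℓ = ∑ a₁ : Label N ℓ, ∑ a₂ : Label N ℓ,
      (if a₁ = a₂ then 1 else 0 : ℂ) • (eps a₁ ⊗ₜ[ℂ] eps a₂) := by
  have h := sum_smul_eps_tmul_eps (N := N) (ℓ := ℓ) fun _ => 1
  simp only [one_smul, one_mul] at h
  rw [bivector, ← h]
  refine Finset.sum_congr rfl fun a₁ _ => Finset.sum_congr rfl fun a₂ _ => ?_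
  have h2 := congrFun (congrFun (Smat_mul_conjTranspose (N := N) (ℓ := ℓ)) a₂) a₁
  rw [← Smat_inv, Matrix.mul_apply, Matrix.one_apply] at h2
  rw [h2]
  simp only [eq_comm]

theorem twoPoint_eq (t u₁ u₂ : ℂ) :
    twoPoint N ℓ t u₁ u₂ = ∑ a₁ : Label N ℓ, ∑ a₂ : Label N ℓ,
      (((if a₁ = a₂ then 1 else 0) - Bcoef t a₁ a₂ (u₁ + u₂)) / (u₁ + u₂)) •
        (eps a₁ ⊗ₜ[ℂ] eps a₂) := by
  rw [twoPoint, map_Rmat_bivector, bivector_eq, ← Finset.sum_sub_distrib, Finset.smul_sum]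
  refine Finset.sum_congr rfl fun a₁ _ => ?_
  rw [← Finset.sum_sub_distrib, Finset.smul_sum]
  refine Finset.sum_congr rfl fun a₂ _ => ?_
  rw [div_eq_inv_mul, mul_smul]
  congr 1
  exact (sub_smul (if a₁ = a₂ then (1 : ℂ) else 0) (Bcoef t a₁ a₂ (u₁ + u₂))
    (eps a₁ ⊗ₜ[ℂ] eps a₂)).symm

end TwoPoint

/-! ### Quantum dimensions -/

section QuantumDimension

variable {N ℓ : ℕ}

theorem killing_root (p : Fin N × Fin N) (y : Fin N → ℝ) :
    killing (root p) y = killing (coordWeight p.1) y - killing (coordWeight p.2) y := by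
  simp only [killing, root, Pi.sub_apply, sub_mul, Finset.sum_sub_distrib]
  ring

theorem qpow_sub_qpow (x y : ℝ) :
    qpow N ℓ x - qpow N ℓ y = qpow N ℓ ((x + y) / 2) * qbracket N ℓ (x - y) := by
  rw [qbracket, mul_sub, ← qpow_add, ← qpow_add]
  congr 2 <;> ring

/-- The half-sum prefactors multiply to a power of q whose exponent is a multiple of ∑ c_i = 0. -/
theorem prod_qpow_sub {c : Fin N → ℝ} (hc : ∑ i, c i = 0) :
    ∏ p ∈ posRoots N, (qpow N ℓ (c p.1) - qpow N ℓ (c p.2)) =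
      ∏ p ∈ posRoots N, qbracket N ℓ (c p.1 - c p.2) := by
  have h : ∏ p ∈ posRoots N, qpow N ℓ ((c p.1 + c p.2) / 2) = 1 := by
    rw [← qpow_sum, ← Finset.sum_div, sum_posRoots_add, hc]
    simp [qpow_zero]
  rw [Finset.prod_congr rfl fun p _ => qpow_sub_qpow (c p.1) (c p.2), Finset.prod_mul_distrib, h,
    one_mul]

variable [NeZero N]

/-- For the root e_i - e_j the height is j - i, strictly between 0 and ℓ + N, so q raised to it is
not 1. -/
theorem qbracket_rho_ne_zero {p : Fin N × Fin N} (hp : p ∈ posRoots N) :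
    qbracket N ℓ (killing (root p) (rho N)) ≠ 0 := by
  have hlt : p.1 < p.2 := by simpa [posRoots] using hp
  have hlt' : (p.1 : ℕ) < p.2 := hlt
  have h : killing (root p) (rho N) = ((p.2 : ℕ) : ℝ) - ((p.1 : ℕ) : ℝ) := by
    rw [killing_root, killing_coordWeight, killing_coordWeight, rho, rho]
    ring
  rw [h]
  intro h0
  have h1 : qpow N ℓ (((p.2 : ℕ) : ℝ) - ((p.1 : ℕ) : ℝ)) = 1 := by
    rw [qbracket, sub_eq_zero] at h0
    have h2 := congrArg (qpow N ℓ ((((p.2 : ℕ) : ℝ) - ((p.1 : ℕ) : ℝ)) / 2) * ·) h0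
    simp only [← qpow_add] at h2
    rw [show ∀ z : ℝ, z / 2 + z / 2 = z from fun z => by ring,
      show ∀ z : ℝ, z / 2 + -z / 2 = 0 from fun z => by ring, qpow_zero] at h2
    exact h2
  obtain ⟨k, hk⟩ := (qpow_eq_one_iff _).mp h1
  have hk' : ((p.2 : ℕ) : ℤ) - ((p.1 : ℕ) : ℤ) = k * ((ℓ : ℤ) + N) := by exact_mod_cast hk
  have hp2 := p.2.2
  rcases lt_or_ge 0 k with hk0 | hk0
  · nlinarith
  · nlinarith

theorem prod_qbracket_eq (a : Label N ℓ) :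
    ∏ p ∈ posRoots N, qbracket N ℓ (a.cc p.1 - a.cc p.2) =
      (∏ p ∈ posRoots N, qbracket N ℓ (killing (root p) (rho N))) * qdim a := by
  rw [qdim, ← Finset.prod_mul_distrib]
  refine Finset.prod_congr rfl fun p hp => ?_
  rw [mul_div_cancel₀ _ (qbracket_rho_ne_zero hp), killing_root]
  rfl

theorem prod_xv_sub (a : Label N ℓ) :
    ∏ p ∈ posRoots N, (a.xv p.1 - a.xv p.2) =
      (∏ p ∈ posRoots N, qbracket N ℓ (killing (root p) (rho N))) * qdim a := by
  rw [← prod_qbracket_eq, ← prod_qpow_sub a.sum_cc]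
  rfl

theorem prod_yv_sub (a : Label N ℓ) :
    ∏ p ∈ posRoots N, (a.yv p.1 - a.yv p.2) =
      conj ((∏ p ∈ posRoots N, qbracket N ℓ (killing (root p) (rho N))) * qdim a) := by
  rw [← prod_xv_sub, map_prod]
  refine Finset.prod_congr rfl fun p _ => ?_
  rw [map_sub, a.conj_xv, a.conj_xv]

end QuantumDimension

/-! ### Labels and partitions -/

section Partitions

variable {N ℓ : ℕ}

/-- Both lists are weakly decreasing and have the same underlying multiset. -/
theorem ofFn_eq_append {d k : ℕ} {ν : Nat.Partition d} {f : Fin N → ℕ} (hf : Antitone f)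
    (h : Finset.univ.val.map f = ν.parts + Multiset.replicate k 0) :
    List.ofFn f = rowLens ν ++ List.replicate k 0 := by
  have hperm : (List.ofFn f).Perm (rowLens ν ++ List.replicate k 0) := by
    rw [← Multiset.coe_eq_coe, ← Multiset.coe_add, rowLens, Multiset.sort_eq,
      Multiset.coe_replicate, ← h]
    simp
  refine hperm.eq_of_pairwise (le := (· ≥ ·)) (fun a b _ _ h1 h2 => le_antisymm h2 h1) ?_ ?_
  · rw [List.pairwise_ofFn]
    exact fun i j hij => hf hij.le
  · rw [List.pairwise_append]
    refine ⟨Multiset.pairwise_sort ν.parts (· ≥ ·), ?_, ?_⟩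
    · rw [List.pairwise_replicate]
      exact Or.inr le_rfl
    · intro a _ b hb
      rw [List.eq_of_mem_replicate hb]
      exact Nat.zero_le a

theorem rowLen_eq_of_map_eq {d k : ℕ} {ν : Nat.Partition d} {f : Fin N → ℕ} (hf : Antitone f)
    (h : Finset.univ.val.map f = ν.parts + Multiset.replicate k 0) (i : Fin N) :
    rowLen ν i = f i := by
  have h1 := congrArg (fun l => l.getD (i : ℕ) 0) (ofFn_eq_append hf h)
  have h2 : (List.ofFn f).getD (i : ℕ) 0 = f i := by simp
  rw [h2] at h1
  rw [h1, rowLen]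
  rcases lt_or_ge (i : ℕ) (rowLens ν).length with hi | hi
  · rw [List.getD_append _ _ _ _ hi]
  · rw [List.getD_append_right _ _ _ _ hi, List.getD_eq_default _ _ hi]
    simp

theorem parts_eq_filter {d : ℕ} {ν : Nat.Partition d} (hN : (rowLens ν).length ≤ N) :
    ν.parts = (Finset.univ.val.map fun i : Fin N => rowLen ν i).filter (0 < ·) := by
  have h : (List.ofFn fun i : Fin N => rowLen ν i) =
      rowLens ν ++ List.replicate (N - (rowLens ν).length) 0 := by
    apply List.ext_getElem
    · simp; omega
    · intro i h1 h2
      rw [List.getElem_ofFn]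
      rcases lt_or_ge i (rowLens ν).length with hi | hi
      · rw [List.getElem_append_left hi, rowLen_of_lt ν hi]
        rfl
      · rw [List.getElem_append_right hi, rowLen_of_le ν hi]
        simp
  have h' : (Finset.univ.val.map fun i : Fin N => rowLen ν i) =
      ν.parts + Multiset.replicate (N - (rowLens ν).length) 0 := by
    have h2 : ((List.ofFn fun i : Fin N => rowLen ν i : List ℕ) : Multiset ℕ) =
        (Finset.univ.val.map fun i : Fin N => rowLen ν i) := by simp
    rw [← h2, h, ← Multiset.coe_add, rowLens, Multiset.sort_eq, Multiset.coe_replicate]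
  rw [h', Multiset.filter_add, Multiset.filter_eq_self.mpr fun _ h => ν.parts_pos h,
    Multiset.filter_eq_nil.mpr, add_zero]
  intro a ha
  rw [Multiset.eq_of_mem_replicate ha]
  exact lt_irrefl 0

theorem filter_partition_eq_empty {d : ℕ} (hd : (N - 1) * ℓ < d) :
    (Finset.univ.filter fun ν : Nat.Partition d =>
      ν.parts.card ≤ N - 1 ∧ ∀ p ∈ ν.parts, p ≤ ℓ) = ∅ := by
  rw [Finset.filter_eq_empty_iff]
  rintro ν - ⟨h1, h2⟩
  have h3 := Multiset.sum_le_card_nsmul ν.parts ℓ h2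
  rw [ν.parts_sum, smul_eq_mul] at h3
  have := h3.trans (Nat.mul_le_mul_right ℓ h1)
  omega

variable [NeZero N]

/-- The multiset of nonzero parts of a label. -/
def Label.parts (a : Label N ℓ) : Multiset ℕ :=
  (Finset.univ.val.map fun i => (a.1 i : ℕ)).filter (0 < ·)

theorem Label.sum_parts (a : Label N ℓ) : a.parts.sum = ∑ i, (a.1 i : ℕ) := by
  have h := congrArg Multiset.sum
    (Multiset.filter_add_not (0 < ·) (Finset.univ.val.map fun i => (a.1 i : ℕ)))
  rw [Multiset.sum_add] at h
  have h0 : (Multiset.filter (fun x => ¬ 0 < x)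
      (Finset.univ.val.map fun i => (a.1 i : ℕ))).sum = 0 := by
    rw [Multiset.sum_eq_zero_iff]
    intro x hx
    have := (Multiset.mem_filter.mp hx).2
    omega
  rw [h0, add_zero] at h
  exact h

/-- The partition attached to a label. -/
def Label.partition (a : Label N ℓ) : Nat.Partition (∑ i, (a.1 i : ℕ)) where
  parts := a.parts
  parts_pos h := (Multiset.mem_filter.mp h).2
  parts_sum := a.sum_parts

theorem Label.card_parts_le (a : Label N ℓ) : a.parts.card ≤ N - 1 := by
  have hN : 0 < N := NeZero.pos N
  have h := congrArg Multiset.card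
    (Multiset.filter_add_not (0 < ·) (Finset.univ.val.map fun i => (a.1 i : ℕ)))
  rw [Multiset.card_add, Multiset.card_map] at h
  have h0 : 0 < (Multiset.filter (fun x => ¬ 0 < x)
      (Finset.univ.val.map fun i => (a.1 i : ℕ))).card := by
    rw [Multiset.card_pos_iff_exists_mem]
    refine ⟨0, Multiset.mem_filter.mpr ⟨?_, lt_irrefl 0⟩⟩
    rw [Multiset.mem_map]
    exact ⟨Fin.rev 0, Finset.mem_univ_val _, by rw [a.2.2]; rfl⟩
  have h1 : (Finset.univ : Finset (Fin N)).val.card = N := by simp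
  rw [h1] at h
  rw [Label.parts]
  omega

theorem Label.le_of_mem_parts (a : Label N ℓ) {m : ℕ} (hm : m ∈ a.parts) : m ≤ ℓ := by
  obtain ⟨i, -, rfl⟩ := Multiset.mem_map.mp (Multiset.mem_filter.mp hm).1
  exact Nat.lt_succ_iff.mp (a.1 i).2

/-- Identifies the exponents in the S-matrix with those in the Frobenius formula. -/
theorem shiftedShape_partition (a : Label N ℓ) : shiftedShape N a.partition = a.sh := by
  funext i
  rw [shiftedShape, Label.sh]
  congr 1
  refine rowLen_eq_of_map_eq (f := fun i => (a.1 i : ℕ)) (fun i j hij => a.2.1 hij)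
    (k := (Multiset.filter (fun x => ¬ 0 < x) (Finset.univ.val.map fun i => (a.1 i : ℕ))).card) ?_ i
  rw [← Multiset.filter_add_not (0 < ·) (Finset.univ.val.map fun i => (a.1 i : ℕ))]
  congr 1
  rw [Multiset.eq_replicate]
  refine ⟨by simp, fun x hx => ?_⟩
  have := (Multiset.mem_filter.mp hx).2
  omega

theorem length_rowLens {d : ℕ} (ν : Nat.Partition d) : (rowLens ν).length = ν.parts.card := by
  rw [rowLens, Multiset.length_sort]

theorem sigma_partition_ext {d d' : ℕ} {ν : Nat.Partition d} {ν' : Nat.Partition d'}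
    (h : ν.parts = ν'.parts) : (⟨d, ν⟩ : Σ d, Nat.Partition d) = ⟨d', ν'⟩ := by
  obtain rfl : d = d' := by rw [← ν.parts_sum, ← ν'.parts_sum, h]
  rw [Nat.Partition.ext h]

theorem exists_label_of_partition {d : ℕ} {ν : Nat.Partition d} (h1 : ν.parts.card ≤ N - 1)
    (h2 : ∀ p ∈ ν.parts, p ≤ ℓ) : ∃ a : Label N ℓ, a.parts = ν.parts := by
  have hN : 0 < N := NeZero.pos N
  obtain ⟨a, ha⟩ := exists_label_of_strictAnti (ℓ := ℓ) (shiftedShape_strictAnti (N := N) (ν := ν))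
    (by
      rw [shiftedShape, rowLen_of_le]
      · simp
      · rw [length_rowLens]
        simpa using h1)
    (by
      intro i
      have : rowLen ν i ≤ ℓ := by
        rcases lt_or_ge (i : ℕ) (rowLens ν).length with hi | hi
        · rw [rowLen_of_lt ν hi]
          refine h2 _ ?_
          rw [← Multiset.mem_sort (r := (· ≥ ·))]
          exact List.get_mem _ _
        · rw [rowLen_of_le ν hi]
          exact Nat.zero_le ℓ
      rw [shiftedShape]
      have := i.rev.2
      omega)
  refine ⟨a, ?_⟩
  rw [parts_eq_filter (ν := ν) (N := N) (by rw [length_rowLens]; omega), Label.parts]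
  congr 2
  funext i
  have := congrFun ha i
  rw [shiftedShape, Label.sh] at this
  omega

theorem sum_partition_eq (g : (Σ d, Nat.Partition d) → ℂ) :
    ∑ a : Label N ℓ, g ⟨_, a.partition⟩ =
      ∑ d ∈ Finset.range ((N - 1) * ℓ + 1),
        ∑ ν : Nat.Partition d with ν.parts.card ≤ N - 1 ∧ ∀ p ∈ ν.parts, p ≤ ℓ, g ⟨d, ν⟩ := by
  rw [Finset.sum_sigma']
  refine Finset.sum_nbij (fun a => ⟨_, a.partition⟩) ?_ ?_ ?_ ?_
  · intro a _
    rw [Finset.mem_sigma, Finset.mem_filter, Finset.mem_range]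
    refine ⟨?_, Finset.mem_univ _, a.card_parts_le, fun p hp => a.le_of_mem_parts hp⟩
    have h1 := Multiset.sum_le_card_nsmul a.parts ℓ fun p hp => a.le_of_mem_parts hp
    rw [a.sum_parts, smul_eq_mul] at h1
    exact Nat.lt_succ_of_le (h1.trans (Nat.mul_le_mul_right ℓ a.card_parts_le))
  · intro a _ b _ hab
    apply Label.sh_injective
    rw [← shiftedShape_partition, ← shiftedShape_partition]
    exact congrArg (fun s : Σ d, Nat.Partition d => shiftedShape N s.2) hab
  · rintro ⟨d, ν⟩ hν
    rw [Finset.mem_coe, Finset.mem_sigma, Finset.mem_filter] at hν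
    obtain ⟨a, ha⟩ := exists_label_of_partition hν.2.2.1 hν.2.2.2
    exact ⟨a, Finset.mem_coe.mpr (Finset.mem_univ a), sigma_partition_ext ha⟩
  · intro a _
    rfl

end Partitions

/-! ### The coefficients through Hurwitz series -/

section Hurwitz

variable {N ℓ : ℕ}

/-- The Schur polynomial of `ν` evaluated through the Frobenius formula. -/
def schurVal {d : ℕ} (ν : Nat.Partition d) (x : Fin N → ℂ) : ℂ :=
  (d.factorial : ℂ)⁻¹ * ∑ σ, chi ν σ * wordSum x σ

/-- For fixed ν the double sum over (μ₁, μ₂) is a product of two sums over conjugacy classes, each a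
Schur value times d!; the two factors d! cancel the prefactor 1/d!². -/
theorem sum_powerSum_mul_truncHurwitz {d : ℕ} (β₁ β₂ : Fin N → ℝ) (T : ℂ) :
    ∑ μ₁ : Nat.Partition d, ∑ μ₂ : Nat.Partition d,
        powerSum N ℓ μ₁ β₁ * powerSum N ℓ μ₂ β₂ * truncHurwitz N ℓ d μ₁ μ₂ T =
      ∑ ν : Nat.Partition d with ν.parts.card ≤ N - 1 ∧ ∀ p ∈ ν.parts, p ≤ ℓ,
        Complex.exp (T * contentSum ν) *
          (schurVal ν (fun i => qpow N ℓ (killing (coordWeight i) β₁)) *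
            schurVal ν fun i => qpow N ℓ (killing (coordWeight i) β₂)) := by
  have h : ∀ ν : Nat.Partition d, Complex.exp (T * contentSum ν) *
          (schurVal ν (fun i => qpow N ℓ (killing (coordWeight i) β₁)) *
            schurVal ν fun i => qpow N ℓ (killing (coordWeight i) β₂)) =
      ∑ μ₁ : Nat.Partition d, ∑ μ₂ : Nat.Partition d,
        powerSum N ℓ μ₁ β₁ * powerSum N ℓ μ₂ β₂ * (1 / (d.factorial : ℂ) ^ 2 *
          (((conjClass μ₁).card : ℂ) * ((conjClass μ₂).card : ℂ) *
            chiClass ν μ₁ * chiClass ν μ₂ * Complex.exp (T * fTransp ν))) := by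
    intro ν
    rw [schurVal, schurVal, ← sum_partitions_eq, ← sum_partitions_eq, mul_mul_mul_comm,
      Finset.sum_mul_sum, Finset.mul_sum, Finset.mul_sum]
    refine Finset.sum_congr rfl fun μ₁ _ => ?_
    rw [Finset.mul_sum, Finset.mul_sum]
    refine Finset.sum_congr rfl fun μ₂ _ => ?_
    rw [fTransp_eq_contentSum, powerSum, powerSum]
    ring
  simp only [h, truncHurwitz, Finset.mul_sum]
  conv_rhs => rw [Finset.sum_comm]
  refine Finset.sum_congr rfl fun μ₁ _ => ?_
  conv_rhs => rw [Finset.sum_comm]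

variable [NeZero N]

/-- ⟨λ, λ + 2ρ⟩ = |λ + ρ|² - |ρ|² is quadratic in the shifted exponents, whose norm involves the
content sum. This is the origin of N d/2 and d²/(2N) in the exponential prefactor. -/
theorem confWeight_eq (a : Label N ℓ) :
    2 * ((ℓ : ℂ) + N) * (confWeight a : ℂ) =
      2 * contentSum a.partition + (N : ℂ) * (∑ i, (a.1 i : ℕ) : ℕ) -
        ((∑ i, (a.1 i : ℕ) : ℕ) : ℂ) ^ 2 / N := by
  have hn : ((ℓ : ℂ) + N) ≠ 0 := by
    have : (ℓ + N : ℕ) ≠ 0 := by have := NeZero.pos N; omega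
    exact_mod_cast this
  have hlen : (rowLens a.partition).length ≤ N := by
    rw [length_rowLens]
    exact a.card_parts_le.trans (Nat.sub_le N 1)
  have h := sum_sq_shiftedShape (N := N) hlen
  rw [shiftedShape_partition, cutJoinConst] at h
  have hrho : ∑ i, rho N i = 0 := by
    have h0 := sum_sub_mean (rho N)
    have h1 : ∑ i : Fin N, rho N i = ∑ i : Fin N, rho N (Fin.revPerm i) :=
      (Equiv.sum_comp Fin.revPerm (rho N)).symm
    have h2 : ∀ i : Fin N, rho N (Fin.revPerm i) = -rho N i := by
      intro i
      rw [rho_eq, Fin.revPerm_apply, Fin.rev_rev, rho]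
      ring
    simp only [h2, Finset.sum_neg_distrib] at h1
    linarith
  have hk : killing a.wt (a.wt + (2 : ℝ) • rho N) = ∑ i, (a.sh i : ℝ) ^ 2 -
      ∑ i : Fin N, ((i.rev : ℕ) : ℝ) ^ 2 - ((N : ℝ) - 1) * (∑ i, (a.1 i : ℕ) : ℕ) -
        ((∑ i, (a.1 i : ℕ) : ℕ) : ℝ) ^ 2 / N := by
    have hs : ∑ i, (a.wt + (2 : ℝ) • rho N) i = ∑ i, a.wt i := by
      simp only [Pi.add_apply, Pi.smul_apply, smul_eq_mul, Finset.sum_add_distrib,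
        ← Finset.mul_sum, hrho]
      ring
    have hd : ((∑ i, (a.1 i : ℕ) : ℕ) : ℝ) = ∑ i, a.wt i := by
      push_cast
      rfl
    rw [killing, hs, hd, Finset.mul_sum (s := Finset.univ) (a := (N : ℝ) - 1), ← Finset.sum_sub_distrib, ← Finset.sum_sub_distrib, sq]
    congr 1
    refine Finset.sum_congr rfl fun i _ => ?_
    rw [Pi.add_apply, Pi.smul_apply, rho_eq, Label.sh, Label.wt, smul_eq_mul]
    push_cast
    ring
  have hk' := congrArg (fun z : ℝ => (z : ℂ)) hk
  push_cast at hk' h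
  rw [confWeight]
  push_cast
  rw [mul_div_cancel₀ _ (by simpa using hn), hk', h]
  ring

/-- S⁻¹ is the conjugate transpose, the phases i^{|Δ₊|} cancel, and only a product of two alternants
with exponents τ remains. -/
theorem Bcoef_eq_sum (t : ℂ) (a₁ a₂ : Label N ℓ) (u : ℂ) :
    Bcoef t a₁ a₂ u = (levelIndex N ℓ : ℂ)⁻¹ * ∑ τ : Label N ℓ,
      Complex.exp (u * t * ((confWeight τ : ℂ) + (centralCharge N ℓ : ℂ) / 24)) *
        altProd a₁.xv a₂.yv τ.sh := by
  rw [Bcoef, Finset.mul_sum]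
  refine Finset.sum_congr rfl fun τ _ => ?_
  have h := Smat_mul_conj a₂ a₁ τ
  rw [calS_mul_conj] at h
  rw [Smat_inv, Matrix.conjTranspose_apply, mul_assoc]
  change _ * (_ * conj _) = _
  rw [h, mul_left_comm]
  congr 3
  ring

/-- Each alternant is Vandermonde times Schur; the two Vandermonde factors are P · dim_q at a₁ and
the conjugate of P · dim_q at a₂, where P is the product of brackets at ρ, hence |P|². -/
theorem altProd_partition (a₁ a₂ τ : Label N ℓ) :
    altProd a₁.xv a₂.yv τ.sh =
      ((‖∏ p ∈ posRoots N, qbracket N ℓ (killing (root p) (rho N))‖ ^ 2 : ℝ) : ℂ) *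
        qdim a₁ * conj (qdim a₂) *
          (schurVal τ.partition a₁.xv * schurVal τ.partition a₂.yv) := by
  have hlen : (rowLens τ.partition).length ≤ N := by
    rw [length_rowLens]
    exact τ.card_parts_le.trans (Nat.sub_le N 1)
  rw [altProd, altVal, altVal, ← shiftedShape_partition, det_pow_eq hlen, det_pow_eq hlen,
    prod_xv_sub, prod_yv_sub, map_mul, Complex.ofReal_pow, ← Complex.mul_conj', schurVal, schurVal]
  ring

/-- The term of the coefficient `B` attached to a partition. -/
def hurwitzTerm (N ℓ : ℕ) (T : ℂ) (x y : Fin N → ℂ) (s : Σ d, Nat.Partition d) : ℂ :=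
  Complex.exp (((N : ℂ) * (s.1 : ℂ) / 2 - (s.1 : ℂ) ^ 2 / (2 * (N : ℂ)) +
      ((ℓ : ℂ) + (N : ℂ)) * (centralCharge N ℓ : ℂ) / 24) * T) *
    (Complex.exp (T * contentSum s.2) * (schurVal s.2 x * schurVal s.2 y))

theorem Bcoef_eq_sum_range (t : ℂ) (a₁ a₂ : Label N ℓ) (u T : ℂ)
    (hT : T = u * t / ((ℓ : ℂ) + (N : ℂ))) :
    Bcoef t a₁ a₂ u = (levelIndex N ℓ : ℂ)⁻¹ *
      ((‖∏ p ∈ posRoots N, qbracket N ℓ (killing (root p) (rho N))‖ ^ 2 : ℝ) : ℂ) *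
        qdim a₁ * conj (qdim a₂) * ∑ d ∈ Finset.range ((N - 1) * ℓ + 1),
          ∑ ν : Nat.Partition d with ν.parts.card ≤ N - 1 ∧ ∀ p ∈ ν.parts, p ≤ ℓ,
            hurwitzTerm N ℓ T a₁.xv a₂.yv ⟨d, ν⟩ := by
  have hn : ((ℓ : ℂ) + N) ≠ 0 := by
    have : (ℓ + N : ℕ) ≠ 0 := by have := NeZero.pos N; omega
    exact_mod_cast this
  have hN : (N : ℂ) ≠ 0 := by exact_mod_cast NeZero.ne N
  rw [Bcoef_eq_sum, ← sum_partition_eq, mul_assoc, mul_assoc, mul_assoc]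
  congr 1
  rw [← mul_assoc, ← mul_assoc, Finset.mul_sum]
  refine Finset.sum_congr rfl fun τ _ => ?_
  rw [altProd_partition, hurwitzTerm, ← mul_assoc (Complex.exp _) (Complex.exp _),
    ← Complex.exp_add, mul_left_comm]
  congr 3
  have h := confWeight_eq τ
  have hu : u * t = T * ((ℓ : ℂ) + N) := by rw [hT, div_mul_cancel₀ _ hn]
  rw [hu]
  have h' : ((ℓ : ℂ) + N) * (confWeight τ : ℂ) = contentSum τ.partition +
      (N : ℂ) * (∑ i, (τ.1 i : ℕ) : ℕ) / 2 - ((∑ i, (τ.1 i : ℕ) : ℕ) : ℂ) ^ 2 / (2 * N) := by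
    rw [← mul_right_inj' (two_ne_zero (α := ℂ)), ← mul_assoc, h]
    field_simp
  rw [mul_assoc, mul_add, h']
  ring

theorem Bcoef_eq_tsum (t : ℂ) (a₁ a₂ : Label N ℓ) (u T : ℂ)
    (hT : T = u * t / ((ℓ : ℂ) + (N : ℂ))) :
    ∃ F : ℕ → ℂ,
      (∀ d : ℕ, F d =
        Complex.exp (((N : ℂ) * (d : ℂ) / 2 - (d : ℂ) ^ 2 / (2 * (N : ℂ)) +
            ((ℓ : ℂ) + (N : ℂ)) * (centralCharge N ℓ : ℂ) / 24) * T) *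
          ∑ μ₁ : Nat.Partition d, ∑ μ₂ : Nat.Partition d,
            powerSum N ℓ μ₁ (a₁.wt + rho N) * powerSum N ℓ μ₂ (-(a₂.wt + rho N)) *
              truncHurwitz N ℓ d μ₁ μ₂ T) ∧
      Summable F ∧
      Bcoef t a₁ a₂ u =
        (levelIndex N ℓ : ℂ)⁻¹ *
          ((‖∏ p ∈ posRoots N, qbracket N ℓ (killing (root p) (rho N))‖ ^ 2 : ℝ) : ℂ) *
          qdim a₁ * conj (qdim a₂) * ∑' d : ℕ, F d := by
  -- A diagram with at most N - 1 rows of length at most ℓ has at most (N - 1) ℓ boxes, so the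
  -- series is a finite sum.
  have hzero : ∀ d ∉ Finset.range ((N - 1) * ℓ + 1),
      ∑ ν : Nat.Partition d with ν.parts.card ≤ N - 1 ∧ ∀ p ∈ ν.parts, p ≤ ℓ,
        hurwitzTerm N ℓ T a₁.xv a₂.yv ⟨d, ν⟩ = 0 := by
    intro d hd
    rw [Finset.mem_range, not_lt] at hd
    rw [filter_partition_eq_empty (by omega), Finset.sum_empty]
  refine ⟨fun d => ∑ ν : Nat.Partition d with ν.parts.card ≤ N - 1 ∧ ∀ p ∈ ν.parts, p ≤ ℓ,
    hurwitzTerm N ℓ T a₁.xv a₂.yv ⟨d, ν⟩, ?_, summable_of_ne_finset_zero hzero, ?_⟩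
  · intro d
    rw [sum_powerSum_mul_truncHurwitz, Finset.mul_sum]
    refine Finset.sum_congr rfl fun ν _ => ?_
    rw [hurwitzTerm]
    simp only [killing_neg_right]
    rfl
  · rw [tsum_eq_sum hzero, Bcoef_eq_sum_range t a₁ a₂ u T hT]

end Hurwitz

end WZW

end

/-! ### The main theorem -/

theorem mainTheorem10 (N ℓ : ℕ) [NeZero N] (t : ℂ) :
    -- the vectors `ε_λ` are orthonormal for the pairing, hence form a basis
    (∀ a₁ a₂ : WZW.Label N ℓ,
      WZW.pairing (WZW.eps a₁) (WZW.eps a₂) = if a₁ = a₂ then 1 else 0) ∧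
    -- the `B_{λ₁λ₂}` give the coefficients of the 2-point function in this basis
    (∀ u₁ u₂ : ℂ, u₁ + u₂ ≠ 0 →
      WZW.twoPoint N ℓ t u₁ u₂ =
        ∑ a₁ : WZW.Label N ℓ, ∑ a₂ : WZW.Label N ℓ,
          (((if a₁ = a₂ then 1 else 0) - WZW.Bcoef t a₁ a₂ (u₁ + u₂)) / (u₁ + u₂)) •
            (WZW.eps a₁ ⊗ₜ[ℂ] WZW.eps a₂)) ∧
    -- their expression through truncated double Hurwitz series
    (∀ (a₁ a₂ : WZW.Label N ℓ) (u T : ℂ), T = u * t / ((ℓ : ℂ) + (N : ℂ)) →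
      ∃ F : ℕ → ℂ,
        (∀ d : ℕ, F d =
          Complex.exp (((N : ℂ) * (d : ℂ) / 2 - (d : ℂ) ^ 2 / (2 * (N : ℂ)) +
              ((ℓ : ℂ) + (N : ℂ)) * (WZW.centralCharge N ℓ : ℂ) / 24) * T) *
            ∑ μ₁ : Nat.Partition d, ∑ μ₂ : Nat.Partition d,
              WZW.powerSum N ℓ μ₁ (a₁.wt + WZW.rho N) *
                WZW.powerSum N ℓ μ₂ (-(a₂.wt + WZW.rho N)) *
                WZW.truncHurwitz N ℓ d μ₁ μ₂ T) ∧
        Summable F ∧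
        WZW.Bcoef t a₁ a₂ u =
          (WZW.levelIndex N ℓ : ℂ)⁻¹ *
            ((‖∏ p ∈ WZW.posRoots N,
                WZW.qbracket N ℓ (WZW.killing (WZW.root p) (WZW.rho N))‖ ^ 2 : ℝ) : ℂ) *
            WZW.qdim a₁ * conj (WZW.qdim a₂) * ∑' d : ℕ, F d) := by
  exact ⟨WZW.pairing_eps, fun u₁ u₂ _ => WZW.twoPoint_eq t u₁ u₂, WZW.Bcoef_eq_tsum t⟩
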